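/- Let $\Gamma$ be a directed graph with $n$ nodes and $m$ arcs, without parallel arcs, given by its weighted adjacency matrix $D$, where $d_{uv}=\infty$ signals the absence of the arc $(u,v)$. Let $D$ have separated variables with lower and upper bounds: the weight of each arc is either a constant in $[0,\infty)$ or one of $k$ variables $x_1,\dots,x_k$, each variable is the weight of exactly one arc, and $x_i$ ranges over an interval $[\lambda_i,\mu_i]$ with $0\le\lambda_i<\mu_i\le\infty$ (a ray if $\mu_i=\infty$). Let $B\subset\mathbb R^k$ be the product of these intervals. Suppose that $D$ is generic: whenever each variable is replaced by its lower bound or by its upper bound (if finite), no two different sets of arcs have the same sum of weights. For sums of arc weights $f,g$ write $f\le g$ if $f(z)\le g(z)$ for all $z\in B$, and $f<g$ if $f\le g$ and not $g\le f$; $f$ and $g$ are incomparable if neither $f\le g$ nor $g\le f$. Let $t$ be a node. A spanning tree $T$ of $\Gamma$ with all arcs directed toward $t$ is a shortest-path tree if $d_{vw}+p_w\not<p_v$ for every arc $(v,w)$, where $p_v=p^T_v$ is the length of the path from $v$ to $t$ in $T$. Its cell is the polyhedron $P(T)=\{z\in B: p_v(z)\le d_{vw}(z)+p_w(z)\text{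 for all arcs }(v,w)\}$. Let $\Sigma$ be the number of shortest-path trees toward $t$, and let $\mathcal G$ be the graph on these trees in which two trees are adjacent if they differ in the outgoing arc of exactly one node $u$ and the two paths from $u$ to $t$ are incomparable. The regions of column $t$ of the Kleene star $D^*=(I\oplus D)^{\odot(n-1)}$ are the sets with nonempty interior of the form $\{z\in B: q_v(z)=D^*_{vt}(z)\text{ for all nodes } v\}$ with monomials $q_v$. Then \[ \Sigma\ \le\ \min\Bigl(\Phi(n,k),\ n^{n-2},\ \tbinom{m}{n-1}\Bigr),\qquad \Phi(n,k)=\sum_{i=0}^{k}\binom{k}{i}(i+1)^{n-i-1}. \] Moreover, consider the following traversal. It starts with a queue that contains the tree obtained from Dijkstra's algorithm for $x_i=\lambda_i$ (if $t$ cannot be reached from all nodes, nothing is returned). While the queue is nonempty, it removes a tree $T$, and for each arc $(v,w)$ such that $p^T_v$ and $d_{vw}+p^T_w$ are incomparable, it records the inequality $p^T_v\le d_{vw}+p^T_w$, replaces the arc of $T$ out of $v$ by $(v,w)$, and puts the resulting tree into the queue if it is a shortest-path tree that has not been considered before; then it returns $T$, $p^T$ and the recorded inequalities. This traversal terminates and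 returns, each exactly once, precisely those shortest-path trees toward $t$ that are connected in $\mathcal G$ to a shortest-path tree whose cell has nonempty interior. Each returned tree $T$ comes with its distances $p^T$ and with a system of inequalities that describes $P(T)$ within $B$, and each region of column $t$ of $D^*$ is the cell of exactly one returned tree. In the unit cost model, with the input in read-only memory, an implementation of this traversal takes $O(k\,m^2\,\Sigma+n^2)$ time and $O(\max(k,1)\,(n+m)\,\max(\Sigma,1))$ space, with absolute constants. -/

import Mathlib

/-!
# Parameterized shortest-path trees

Networks with `n` nodes whose arc weights are constants or pairwise distinct variables, their
shortest-path trees toward a target node, the regions of the parameter space, and a traversal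
algorithm with an explicit count of elementary steps and of memory cells.
-/

noncomputable section

/-! ## Tropical monomials and networks -/

/-- A tropical monomial `coeff ⊙ x ^ exp` in `k` variables, that is, the linear form
`coeff + ∑ i, exp i * x i`. -/
@[ext] structure TropMonomial (k : ℕ) where
  coeff : ℝ
  exp : Fin k → ℕ

namespace TropMonomial

variable {k : ℕ}

/-- The value of the monomial at a point of the parameter space. -/
def eval (f : TropMonomial k) (z : Fin k → ℝ) : ℝ := f.coeff + ∑ i, (f.exp i : ℝ) * z i

/-- The tropical product, that is, the sum of linear forms. -/
instance : Add (TropMonomial k) := ⟨fun f g => ⟨f.coeff + g.coeff, fun i => f.exp i + g.exp i⟩⟩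

instance : Zero (TropMonomial k) := ⟨⟨0, fun _ => 0⟩⟩

end TropMonomial

/-- The weight of an arc: a constant, or one of the `k` variables. -/
inductive ArcWeight (k : ℕ) where
  | const (c : ℝ) : ArcWeight k
  | var (i : Fin k) : ArcWeight k

/-- An arc weight as a tropical monomial. -/
def ArcWeight.toMonomial {k : ℕ} : ArcWeight k → TropMonomial k
  | .const c => ⟨c, fun _ => 0⟩
  | .var i => ⟨0, Pi.single i 1⟩

/-- A weighted adjacency matrix `D` on `n` nodes over the tropical polynomials in `k` variables,
whose finite entries are constants or single variables, together with a lower and an upper bound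
for each variable. The entry `none` stands for the weight `∞`, that is, for the absence of the
arc; the upper bound `⊤` stands for an unbounded variable. -/
structure ParamNetwork (n k : ℕ) where
  D : Matrix (Fin n) (Fin n) (Option (ArcWeight k))
  lo : Fin k → ℝ
  hi : Fin k → WithTop ℝ

/-- A set of arcs with at most one arc out of each node, given by the successor of each node. -/
abbrev SuccMap (n : ℕ) := Fin n → Option (Fin n)

namespace ParamNetwork

variable {n k : ℕ} (G : ParamNetwork n k)

/-- All weights are nonnegative, and the weight interval of each variable is nondegenerate. -/
def NonnegBounds : Prop :=
  (∀ u v c, G.D u v = some (.const c) → 0 ≤ c) ∧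
    ∀ i, 0 ≤ G.lo i ∧ (G.lo i : WithTop ℝ) < G.hi i

/-- Separated variables: the variables correspond to the arcs with nonconstant weight. -/
def SeparatedVariables : Prop :=
  ∀ i, ∃! e : Fin n × Fin n, G.D e.1 e.2 = some (.var i)

/-- The set of arcs. -/
def arcs : Set (Fin n × Fin n) := {e | G.D e.1 e.2 ≠ none}

/-- The number `m` of arcs. -/
def numArcs : ℕ := G.arcs.ncard

/-- The weight of the arc `(u, v)` as a monomial (junk value `0` if there is no such arc). -/
def weight (u v : Fin n) : TropMonomial k := ((G.D u v).map ArcWeight.toMonomial).getD 0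

/-- Genericity: no two different collections of arcs have the same sum of weights, where each
variable weight is replaced by its lower bound or by its upper bound, if that is finite. -/
def Generic : Prop :=
  ∀ z : Fin k → ℝ, (∀ i, z i = G.lo i ∨ (z i : WithTop ℝ) = G.hi i) →
    ∀ A B : Finset (Fin n × Fin n), ↑A ⊆ G.arcs → ↑B ⊆ G.arcs →
      ∑ e ∈ A, (G.weight e.1 e.2).eval z = ∑ e ∈ B, (G.weight e.1 e.2).eval z → A = B

/-- The feasible domain of the parameters. -/
def box : Set (Fin k → ℝ) := {z | ∀ i, G.lo i ≤ z i ∧ (z i : WithTop ℝ) ≤ G.hi i}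

/-- Comparison of monomials as functions on the feasible domain. -/
def LE (f g : TropMonomial k) : Prop := ∀ z ∈ G.box, f.eval z ≤ g.eval z

/-- The strict relation `f < g`, that is, `f ≤ g` and not `g ≤ f`. -/
def LT (f g : TropMonomial k) : Prop := G.LE f g ∧ ¬ G.LE g f

def Incomparable (f g : TropMonomial k) : Prop := ¬ G.LE f g ∧ ¬ G.LE g f

/-! ## Shortest-path trees -/

/-- A spanning tree with all arcs directed toward `t`: there is exactly one arc out of each node
other than `t`, none out of `t`, and following the arcs one reaches `t` from everywhere. -/
def IsSpanningTree (t : Fin n) (T : SuccMap n) : Prop :=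
  T t = none ∧ (∀ v, v ≠ t → ∃ w, T v = some w) ∧ (∀ v w, T v = some w → (v, w) ∈ G.arcs) ∧
    ∀ v, Relation.ReflTransGen (fun a b => T a = some b) v t

/-- The total weight of the path that starts at `v` and follows at most the given number of arcs
of `T`. -/
def pathLength (T : SuccMap n) : ℕ → Fin n → TropMonomial k
  | 0, _ => 0
  | s + 1, v =>
    match T v with
    | none => 0
    | some w => G.weight v w + pathLength T s w

/-- The length `p_v` of the path from `v` to the target in the spanning tree `T`. -/
def dist (T : SuccMap n) (v : Fin n) : TropMonomial k := G.pathLength T n v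

/-- Shortest-path trees: `d_vw + p_w < p_v` holds for no arc `(v, w)`. -/
def IsShortestPathTree (t : Fin n) (T : SuccMap n) : Prop :=
  G.IsSpanningTree t T ∧
    ∀ v w, (v, w) ∈ G.arcs → ¬ G.LT (G.weight v w + G.dist T w) (G.dist T v)

/-- The number of shortest-path trees with target `t`. -/
def numTrees (t : Fin n) : ℕ := {T | G.IsShortestPathTree t T}.ncard

/-- The graph on the shortest-path trees with target `t`: two trees are adjacent if they differ
in the arc out of exactly one node, and the two paths from this node are incomparable. -/
def treeGraph (t : Fin n) : SimpleGraph {T // G.IsShortestPathTree t T} where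
  Adj T U := ∃ u, T.1 u ≠ U.1 u ∧ (∀ v, v ≠ u → T.1 v = U.1 v) ∧
    G.Incomparable (G.dist T.1 u) (G.dist U.1 u)
  symm := ⟨fun _ _ ⟨u, h, h', hi⟩ => ⟨u, h.symm, fun v hv => (h' v hv).symm, hi.2, hi.1⟩⟩
  loopless := ⟨fun _ ⟨_, h, _⟩ => h rfl⟩

/-- The polyhedral cell of a tree in the feasible domain: `p_v ≤ d_vw + p_w` for all arcs. -/
def cell (T : SuccMap n) : Set (Fin k → ℝ) :=
  {z ∈ G.box | ∀ v w, (v, w) ∈ G.arcs →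
    (G.dist T v).eval z ≤ (G.weight v w + G.dist T w).eval z}

/-- The matrix `D` over the `(min, +)`-semiring obtained by evaluation at the point `z`. -/
def evalMatrix (z : Fin k → ℝ) : Matrix (Fin n) (Fin n) (Tropical (WithTop ℝ)) := fun u v =>
  match G.D u v with
  | none => Tropical.trop ⊤
  | some a => Tropical.trop ((a.toMonomial.eval z : ℝ) : WithTop ℝ)

/-- The Kleene star `(I ⊕ D) ^ (n - 1)`, evaluated at the point `z`. -/
def kleeneStar (z : Fin k → ℝ) : Matrix (Fin n) (Fin n) (Tropical (WithTop ℝ)) :=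
  (1 + G.evalMatrix z) ^ (n - 1)

/-- The regions of the subdivision of the feasible domain that is induced by the column with
label `t` of the Kleene star: full-dimensional sets of all those points at which the entries of
this column are attained at fixed monomials. -/
def IsRegion (t : Fin n) (R : Set (Fin k → ℝ)) : Prop :=
  (interior R).Nonempty ∧ ∃ q : Fin n → TropMonomial k,
    R = {z ∈ G.box | ∀ v,
      G.kleeneStar z v t = Tropical.trop (((q v).eval z : ℝ) : WithTop ℝ)}

end ParamNetwork

/-- `Φ(n, k) = ∑ i = 0, …, k, binom(k, i) (i + 1) ^ (n - i - 1)`; the exponent may be negative. -/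
def treeBound (n k : ℕ) : ℝ :=
  ∑ i ∈ Finset.range (k + 1), (k.choose i : ℝ) * ((i : ℝ) + 1) ^ ((n : ℤ) - i - 1)

/-! ## Computations with a count of steps and memory cells (unit cost model)

A memory cell holds a real number, a natural number, a node, a truth value or a pointer. The
elementary operations are arithmetic operations, comparisons, and reading, writing or creating
one cell. Branching and passing the contents of finitely many registers on are charged to the
elementary operations and loop iterations that they accompany. The input (the network and the
target) is given as a read-only table and does not count as used memory.
-/

/-- The result of a computation, together with the number of its steps, the number of cells that
it has allocated and not released at its end, and the maximal number of cells that are allocated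
at any moment during its run. -/
structure Metered (α : Type) where
  val : α
  time : ℕ
  live : ℕ
  peak : ℕ

/-- Sequential composition: the steps add up, and everything that the first computation has not
released remains allocated during the second one. -/
instance : Monad Metered where
  pure a := ⟨a, 0, 0, 0⟩
  bind x f := ⟨(f x.val).val, x.time + (f x.val).time, x.live + (f x.val).live,
    max x.peak (x.live + (f x.val).peak)⟩

/-- The number of memory cells that an object occupies. -/
class Sized (α : Type) where
  cells : α → ℕ

instance : Sized Bool := ⟨fun _ => 1⟩
instance : Sized ℕ := ⟨fun _ => 1⟩
instance : Sized (WithTop ℝ) := ⟨fun _ => 1⟩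
instance {n : ℕ} : Sized (Fin n) := ⟨fun _ => 1⟩
instance {k : ℕ} : Sized (ArcWeight k) := ⟨fun _ => 2⟩
instance {k : ℕ} : Sized (TropMonomial k) := ⟨fun _ => k + 1⟩
instance {α : Type} [Sized α] : Sized (Option α) := ⟨fun x => 1 + x.elim 0 Sized.cells⟩
instance {α β : Type} [Sized α] [Sized β] : Sized (α × β) :=
  ⟨fun x => Sized.cells x.1 + Sized.cells x.2⟩
instance {n : ℕ} {α : Type} [Sized α] : Sized (Fin n → α) := ⟨fun a => ∑ i, Sized.cells (a i)⟩
instance {α : Type} [Sized α] : Sized (List α) :=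
  ⟨fun l => 1 + (l.map fun a => 1 + Sized.cells a).sum⟩

/-- One elementary operation: one step, and one cell for the result. -/
def elem {α : Type} (a : α) : Metered α := ⟨a, 1, 1, 1⟩

/-- Writing one entry of an array in place (the old array is not used anymore). -/
def write {n : ℕ} {α : Type} (a : Fin n → α) (i : Fin n) (x : α) : Metered (Fin n → α) :=
  elem (Function.update a i x)

/-- A new array, whose entries are computed one by one; auxiliary cells are released after each
entry. -/
def tabulate {n : ℕ} {α : Type} [Sized α] (f : Fin n → Metered α) : Metered (Fin n → α) where
  val i := (f i).val
  time := ∑ i, ((f i).time + 1)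
  live := ∑ i, Sized.cells (f i).val
  peak := ∑ i, Sized.cells (f i).val + Finset.univ.sup fun i => (f i).peak

/-- A loop over a list (or over the indices `0, …, n - 1` if the list is `List.finRange n`) that
updates a state. After each iteration all cells are released except for those of the new
state. -/
def loop {σ α : Type} [Sized σ] (body : σ → α → Metered σ) : σ → List α → Metered σ
  | s, [] => ⟨s, 1, Sized.cells s, Sized.cells s⟩
  | s, a :: l =>
    let x := body s a
    let y := loop body x.val l
    ⟨y.val, 1 + x.time + y.time, y.live, max (Sized.cells s + x.peak) y.peak⟩

/-- A while loop that ends as soon as the body yields a result on the right. The first natural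
number is no part of the computation; it bounds the number of iterations, and the value is `none`
if the loop has not ended after that many iterations. -/
def whileLoop {σ ρ : Type} [Sized σ] [Sized ρ] (body : σ → Metered (σ ⊕ ρ)) :
    ℕ → σ → Metered (Option ρ)
  | 0, s => ⟨none, 0, Sized.cells s, Sized.cells s⟩
  | fuel + 1, s =>
    let x := body s
    match x.val with
    | .inl s' =>
      let y := whileLoop body fuel s'
      ⟨y.val, 1 + x.time + y.time, y.live, max (Sized.cells s + x.peak) y.peak⟩
    | .inr r => ⟨some r, 1 + x.time, Sized.cells r, Sized.cells s + x.peak⟩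

/-- Reversal of a list. -/
def reverseList {α : Type} [Sized α] (l : List α) : Metered (List α) :=
  loop (fun r a => elem (a :: r)) [] l

/-! ## The dictionary of visited trees

A set of successor maps is stored as a search tree on the words `T 0, T 1, …, T (n - 1)`: a node
holds a letter, a pointer to the dictionary of the continuations after this letter, and a pointer
to the next alternative for the letter.
-/

inductive Dictionary (n : ℕ) where
  | empty : Dictionary n
  | node (letter : Option (Fin n)) (next alt : Dictionary n) : Dictionary n

namespace Dictionary

variable {n : ℕ}

def size : Dictionary n → ℕ
  | empty => 1
  | node _ c a => 3 + c.size + a.size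

instance : Sized (Dictionary n) := ⟨size⟩

/-- Is the word `T` on the given list of remaining positions contained in the dictionary? -/
def lookup (T : SuccMap n) : Dictionary n → List (Fin n) → Metered Bool
  | _, [] => elem true
  | empty, _ :: _ => elem false
  | node x c a, v :: l => do
    let y ← elem (T v)
    let b ← elem (decide (x = y))
    if b then lookup T c l else lookup T a (v :: l)

/-- The dictionary that contains only the word `T` on the given positions. -/
def single (T : SuccMap n) : List (Fin n) → Metered (Dictionary n)
  | [] => elem empty
  | v :: l => do
    let y ← elem (T v)
    let c ← single T l
    let a ← elem empty
    elem (node y c a)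

/-- Insertion of the word `T` on the given positions. -/
def insert (T : SuccMap n) : Dictionary n → List (Fin n) → Metered (Dictionary n)
  | d, [] => elem d
  | empty, v :: l => single T (v :: l)
  | node x c a, v :: l => do
    let y ← elem (T v)
    let b ← elem (decide (x = y))
    if b then do
      let c' ← insert T c l
      elem (node x c' a)
    else do
      let a' ← insert T a (v :: l)
      elem (node x c a')

end Dictionary

/-! ## The algorithm -/

/-- A tree as it is stored in the queue: its arcs, its nodes in an order in which every node comes
after its successor, and the parameterized distances to the target. -/
structure TreeRecord (n k : ℕ) where
  tree : SuccMap n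
  order : List (Fin n)
  dist : Fin n → TropMonomial k

instance {n k : ℕ} : Sized (TreeRecord n k) :=
  ⟨fun e => Sized.cells e.tree + Sized.cells e.order + Sized.cells e.dist⟩

/-- What is returned for each tree: its arcs, the distances, and a system of inequalities, where
the pair `(f, g)` stands for `f ≤ g`. -/
structure TreeOutput (n k : ℕ) where
  tree : SuccMap n
  dist : Fin n → TropMonomial k
  ineqs : List (TropMonomial k × TropMonomial k)

instance {n k : ℕ} : Sized (TreeOutput n k) :=
  ⟨fun e => Sized.cells e.tree + Sized.cells e.dist + Sized.cells e.ineqs⟩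

/-- The state of Dijkstra's algorithm: tentative distances with the first arcs of corresponding
paths, the settled nodes as an array, and as a list (last settled node first). -/
structure DijkstraState (n : ℕ) where
  label : Fin n → WithTop ℝ × Option (Fin n)
  settled : Fin n → Bool
  order : List (Fin n)

instance {n : ℕ} : Sized (DijkstraState n) :=
  ⟨fun s => Sized.cells s.label + Sized.cells s.settled + Sized.cells s.order⟩

/-- The state of the traversal: the queue, stored as a front list and a reversed back list, the
dictionary of the trees considered so far, and the output. -/
structure SearchState (n k : ℕ) where
  front : List (TreeRecord n k)
  back : List (TreeRecord n k)
  visited : Dictionary n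
  out : List (TreeOutput n k)

instance {n k : ℕ} : Sized (SearchState n k) :=
  ⟨fun s => Sized.cells s.front + Sized.cells s.back + Sized.cells s.visited +
    Sized.cells s.out⟩

namespace ParamNetwork

variable {n k : ℕ} (G : ParamNetwork n k)

/-- The monomial `0`. -/
def zeroM : Metered (TropMonomial k) := do
  let e ← tabulate fun _ => elem 0
  elem ⟨0, e⟩

/-- The sum of an arc weight and a monomial. -/
def addArc (a : ArcWeight k) (f : TropMonomial k) : Metered (TropMonomial k) :=
  match a with
  | .const c => do
    let x ← elem f.coeff
    let y ← elem (c + x)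
    let e ← tabulate fun j => elem (f.exp j)
    elem ⟨y, e⟩
  | .var i => do
    let x ← elem f.coeff
    let e ← tabulate fun j => do
      let y ← elem (f.exp j)
      let b ← elem (decide (j = i))
      if b then elem (1 + y) else pure y
    elem ⟨x, e⟩

/-- The comparison `f ≤ g` on the feasible domain: computes the supremum of `f - g`. -/
def leM (f g : TropMonomial k) : Metered Bool := do
  let a ← elem f.coeff
  let b ← elem g.coeff
  let d ← elem (a - b)
  let s ← loop (fun (s : WithTop ℝ) i => do
      let a ← elem (f.exp i)
      let b ← elem (g.exp i)
      let c ← elem (decide (a ≤ b))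
      let r ← elem ((a : ℝ) - (b : ℝ))
      if c then do
        let l ← elem (G.lo i)
        let y ← elem (r * l)
        elem (s + (y : WithTop ℝ))
      else do
        let h ← elem (G.hi i)
        let y ← elem (h.map fun x => r * x)
        elem (s + y))
    (d : WithTop ℝ) (List.finRange k)
  elem (decide (s ≤ 0))

/-- The list of all arcs with their weights. -/
def listArcs : Metered (List (Fin n × Fin n × ArcWeight k)) :=
  loop (fun l v => loop (fun l w => do
      let d ← elem (G.D v w)
      match d with
      | none => pure l
      | some a => elem ((v, w, a) :: l)) l (List.finRange n)) [] (List.finRange n)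

/-- The value of an arc weight if all variables are set to their lower bounds. -/
def minWeight : ArcWeight k → Metered ℝ
  | .const c => elem c
  | .var i => elem (G.lo i)

/-- One round of Dijkstra's algorithm: settles an unsettled node of minimal finite label, if there
is one, and updates the labels of the unsettled nodes with an arc to it. -/
def dijkstraRound (s : DijkstraState n) : Metered (DijkstraState n) := do
  let best ← loop (fun (b : Option (Fin n)) v => do
      let z ← elem (s.settled v)
      let x ← elem (s.label v).1
      let c ← elem (decide (x = ⊤))
      if z || c then pure b else
      match b with
      | none => elem (some v)
      | some u => do
        let y ← elem (s.label u).1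
        let d ← elem (decide (x < y))
        if d then elem (some v) else pure b)
    none (List.finRange n)
  match best with
  | none => pure s
  | some v => do
    let x ← elem (s.label v).1
    let label ← tabulate fun u => do
      let d ← elem (G.D u v)
      let z ← elem (s.settled u)
      let old ← elem (s.label u)
      match d with
      | none => pure old
      | some a => do
        let c ← G.minWeight a
        let y ← elem ((c : WithTop ℝ) + x)
        let b ← elem (decide (y < old.1))
        if b && !z then elem (y, some v) else pure old
    let settled ← write s.settled v true
    let order ← elem (v :: s.order)
    pure ⟨label, settled, order⟩

/-- Dijkstra's algorithm with target `t`, where all variables are set to their lower bounds. -/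
def dijkstra (t : Fin n) : Metered (DijkstraState n) := do
  let label ← tabulate fun v => do
    let b ← elem (decide (v = t))
    if b then elem ((0 : WithTop ℝ), none) else elem (⊤, none)
  let settled ← tabulate fun _ => elem false
  loop (fun s _ => G.dijkstraRound s) ⟨label, settled, []⟩ (List.finRange n)

/-- The parameterized distances in a tree, whose nodes are given in an order in which every node
comes after its successor. -/
def distances (T : SuccMap n) (order : List (Fin n)) : Metered (Fin n → TropMonomial k) := do
  let p ← tabulate fun _ => zeroM
  loop (fun (p : Fin n → TropMonomial k) v => do
      let y ← elem (T v)
      match y with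
      | none => pure p
      | some w => do
        let d ← elem (G.D v w)
        match d with
        | none => pure p
        | some a => do
          let f ← elem (p w)
          let g ← addArc a f
          write p v g) p order

/-- The tree that arises by replacing the arc out of `v` by `(v, w)`. In the new order the nodes
from which the old path to the target passes through `v` come last. -/
def exchange (e : TreeRecord n k) (v w : Fin n) : Metered (TreeRecord n k) := do
  let below ← tabulate fun _ => elem false
  let below ← loop (fun (below : Fin n → Bool) u => do
      let b ← elem (decide (u = v))
      if b then write below u true else do
        let y ← elem (e.tree u)
        match y with
        | none => pure below
        | some x => do
          let z ← elem (below x)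
          write below u z) below e.order
  let parts ← loop (fun (l : List (Fin n) × List (Fin n)) u => do
      let b ← elem (below u)
      if b then do
        let r ← elem (u :: l.2)
        pure (l.1, r)
      else do
        let r ← elem (u :: l.1)
        pure (r, l.2)) ([], []) e.order
  let tail ← reverseList parts.2
  let order ← loop (fun l u => elem (u :: l)) tail parts.1
  let copy ← tabulate fun u => elem (e.tree u)
  let T ← write copy v (some w)
  let p ← G.distances T order
  pure ⟨T, order, p⟩

/-- Is the tree with distances `p` a shortest-path tree? -/
def checkTree (arcList : List (Fin n × Fin n × ArcWeight k)) (p : Fin n → TropMonomial k) :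
    Metered Bool :=
  loop (fun (ok : Bool) e => do
      let f ← elem (p e.1)
      let h ← elem (p e.2.1)
      let g ← addArc e.2.2 h
      let l ← G.leM g f
      let r ← G.leM f g
      elem (ok && !(l && !r))) true arcList

/-- Compares all arcs with the tree `e`; returns the inequalities for `e`, and the queue (back
part) and the dictionary, both enlarged by the new neighbors of `e`. -/
def expand (arcList : List (Fin n × Fin n × ArcWeight k)) (e : TreeRecord n k)
    (back : List (TreeRecord n k)) (visited : Dictionary n) :
    Metered (List (TropMonomial k × TropMonomial k) × List (TreeRecord n k) × Dictionary n) :=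
  loop (fun (s : List (TropMonomial k × TropMonomial k) ×
        List (TreeRecord n k) × Dictionary n) a => do
      let f ← elem (e.dist a.1)
      let h ← elem (e.dist a.2.1)
      let g ← addArc a.2.2 h
      let l ← G.leM f g
      let r ← G.leM g f
      if l || r then pure s else do
        let ineqs ← elem ((f, g) :: s.1)
        let e' ← G.exchange e a.1 a.2.1
        let ok ← G.checkTree arcList e'.dist
        if ok then do
          let seen ← s.2.2.lookup e'.tree (List.finRange n)
          if seen then pure (ineqs, s.2) else do
            let visited ← s.2.2.insert e'.tree (List.finRange n)
            let back ← elem (e' :: s.2.1)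
            pure (ineqs, back, visited)
        else pure (ineqs, s.2)) ([], back, visited) arcList

/-- One iteration of the traversal: removes the next tree from the queue, and treats it. -/
def searchStep (arcList : List (Fin n × Fin n × ArcWeight k)) (s : SearchState n k) :
    Metered (SearchState n k ⊕ List (TreeOutput n k)) :=
  match s.front, s.back with
  | e :: front, _ => do
    let r ← G.expand arcList e s.back s.visited
    let out ← elem (⟨e.tree, e.dist, r.1⟩ :: s.out)
    pure (.inl ⟨front, r.2.1, r.2.2, out⟩)
  | [], _ :: _ => do
    let front ← reverseList s.back
    pure (.inl ⟨front, [], s.visited, s.out⟩)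
  | [], [] => pure (.inr s.out)

/-- The traversal of the graph of shortest-path trees with target `t` by breadth-first search,
starting at the tree that Dijkstra's algorithm yields for the lower bounds. If there is a node
from which `t` cannot be reached, then the output is empty. The value is `none` if the search is
not finished after the given number of iterations. -/
def traverse (t : Fin n) (fuel : ℕ) : Metered (Option (List (TreeOutput n k))) := do
  let arcList ← G.listArcs
  let s ← G.dijkstra t
  let order ← reverseList s.order
  let count ← loop (fun (c : ℕ) _ => elem (c + 1)) 0 order
  let b ← elem (decide (count = n))
  if b then do
    let T ← tabulate fun v => elem (s.label v).2
    let p ← G.distances T order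
    let visited ← Dictionary.insert T Dictionary.empty (List.finRange n)
    let queue ← elem [⟨T, order, p⟩]
    whileLoop (G.searchStep arcList) fuel ⟨queue, [], visited, []⟩
  else pure (some [])

end ParamNetwork

end

/-! ## Tropical monomials -/

namespace TropMonomial

variable {k : ℕ}

/-! Distances in a spanning tree are affine functions of the parameters. Genericity enters at the
lower corner of the box: comparing an arc with the empty set makes all weights positive
(`Generic.weight_pos`), and two trees whose paths from `v` have the same length there leave `v` by
the same arc (`Generic.succ_eq`).

Geometry. If spanning trees exist, one of them is optimal at any given point of the box
(`Generic.exists_mem_cell`). An affine function of constant sign that vanishes at an interior point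
is zero, so a tree that is optimal at an interior point is a shortest-path tree. Two trees optimal
at the same interior point have equal distances there; the arcs of one can be swapped into the other
one at a time, all swapped arcs being tight, and each swap is an edge of `treeGraph`
(`Generic.reachable_of_mem_cell`). The interior of the box is connected and covered by finitely many
closed cells, so all trees with full-dimensional cells lie in one component
(`Generic.reachable_of_interior`). The tree found by Dijkstra's algorithm at the lower corner is one
of them, because every arc outside it has strict slack there (`Generic.interior_cell_nonempty`).
Column `t` of the Kleene star is given on a cell by the distances of its tree. By Baire, some cell
meets a given region in a set with interior, where the monomials are forced; hence the region equals
that cell.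

Counting. A recursion over the children of the roots yields Cayley's bound. Arc sets of trees have
`n - 1` elements, which yields the binomial coefficient. For `treeBound`, a shortest-path tree is
determined by the exponents of its distances, and these by the first variable on each path. If the
tree uses a set `S` of variables, the target and the tails of these arcs have forced values, and
each other node has at most `#S + 1` choices.

Algorithm. Exchanging an arc for an incomparable alternative produces exactly the neighbors in
`treeGraph`, so breadth-first search lists one component; comparable arcs contribute no inequality
that is needed for the cell. Comparing two monomials takes `O(k)` steps, checking a tree `O(km)`,
and searching the dictionary `O(n + m)`, as the letters at a node are its outgoing arcs and `none`.
Each of the at most `Σ` visited trees is expanded once, over `m` arcs; a potential function also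
pays for the queue. If `k = 0`, no two monomials are incomparable and the expensive branch never
runs. -/

@[simp] theorem add_coeff (f g : TropMonomial k) : (f + g).coeff = f.coeff + g.coeff := rfl
@[simp] theorem add_exp (f g : TropMonomial k) (i : Fin k) :
    (f + g).exp i = f.exp i + g.exp i := rfl

@[simp] theorem zero_coeff : (0 : TropMonomial k).coeff = 0 := rfl
@[simp] theorem zero_exp (i : Fin k) : (0 : TropMonomial k).exp i = 0 := rfl

@[simp] theorem eval_zero (z : Fin k → ℝ) : (0 : TropMonomial k).eval z = 0 := by
  simp [eval]

@[simp] theorem eval_add (f g : TropMonomial k) (z : Fin k → ℝ) :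
    (f + g).eval z = f.eval z + g.eval z := by
  simp only [eval, add_coeff, add_exp, Nat.cast_add, add_mul, Finset.sum_add_distrib]
  ring

theorem eval_lineMap (f : TropMonomial k) (y z : Fin k → ℝ) (s : ℝ) :
    f.eval (z + s • (y - z)) = f.eval z + s * (f.eval y - f.eval z) := by
  simp only [eval, Pi.add_apply, Pi.smul_apply, Pi.sub_apply, smul_eq_mul, mul_add,
    Finset.sum_add_distrib, mul_sub, Finset.sum_sub_distrib, Finset.mul_sum]
  have : ∀ i, (f.exp i : ℝ) * (s * y i) = s * (f.exp i * y i) := fun i => by ring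
  have h' : ∀ i, (f.exp i : ℝ) * (s * z i) = s * (f.exp i * z i) := fun i => by ring
  simp only [this, h', ← Finset.mul_sum]
  ring

theorem continuous_eval (f : TropMonomial k) : Continuous f.eval := by
  unfold eval; fun_prop

end TropMonomial

@[simp] theorem ArcWeight.eval_const {k : ℕ} (c : ℝ) (z : Fin k → ℝ) :
    (ArcWeight.const c).toMonomial.eval z = c := by
  simp [ArcWeight.toMonomial, TropMonomial.eval]

@[simp] theorem ArcWeight.eval_var {k : ℕ} (i : Fin k) (z : Fin k → ℝ) :
    (ArcWeight.var i).toMonomial.eval z = z i := by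
  simp [ArcWeight.toMonomial, TropMonomial.eval, Pi.single_apply]

namespace ParamNetwork

variable {n k : ℕ} {G : ParamNetwork n k} {t : Fin n} {T U : SuccMap n}

theorem weight_eq {u v : Fin n} {a : ArcWeight k} (h : G.D u v = some a) :
    G.weight u v = a.toMonomial := by
  simp [weight, h]

theorem mem_arcs {u v : Fin n} : (u, v) ∈ G.arcs ↔ G.D u v ≠ none := Iff.rfl

theorem exists_weight {u v : Fin n} (h : (u, v) ∈ G.arcs) : ∃ a, G.D u v = some a :=
  Option.ne_none_iff_exists'.1 h

/-! ## Spanning trees -/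

theorem IsSpanningTree.induction (hT : G.IsSpanningTree t T) {P : Fin n → Prop} (ht : P t)
    (step : ∀ v w, T v = some w → P w → P v) (v : Fin n) : P v := by
  refine Relation.ReflTransGen.head_induction_on (hT.2.2.2 v) ht ?_
  intro a c h _ hc
  exact step a c h hc

theorem IsSpanningTree.exists_depth (hT : G.IsSpanningTree t T) :
    ∃ r : Fin n → ℕ, (∀ v, r v < n) ∧ r t = 0 ∧ ∀ v w, T v = some w → r v = r w + 1 := by
  classical
  let par : Fin n → Fin n := fun v => (T v).getD v
  have hpt : par t = t := by simp [par, hT.1]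
  have hex : ∀ v, ∃ s, par^[s] v = t := by
    refine hT.induction ⟨0, rfl⟩ ?_
    rintro v w h ⟨s, hs⟩
    refine ⟨s + 1, ?_⟩
    have : par v = w := by simp [par, h]
    simpa [Function.iterate_succ_apply, this] using hs
  let r : Fin n → ℕ := fun v => Nat.find (hex v)
  have hr0 : r t = 0 := by simp [r, Nat.find_eq_zero]
  have hstep : ∀ v w, T v = some w → r v = r w + 1 := by
    intro v w h
    have hvt : v ≠ t := by rintro rfl; rw [hT.1] at h; cases h
    have hp : par v = w := by simp [par, h]
    have h0 : ¬ (par^[0] v = t) := by simpa using hvt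
    have := Nat.find_comp_succ (hex v)
      (by obtain ⟨s, hs⟩ := hex w; exact ⟨s, by simpa [Function.iterate_succ_apply, hp] using hs⟩)
      h0
    simp only [Function.iterate_succ_apply, hp] at this
    exact this
  refine ⟨r, fun v => ?_, hr0, hstep⟩
  -- All values `0, …, r v` occur as depths, so there are at least `r v + 1` nodes.
  have hall : ∀ v, ∀ j ≤ r v, ∃ u, r u = j := by
    refine hT.induction ?_ ?_
    · intro j hj; exact ⟨t, by omega⟩
    · intro v w h ih j hj
      rcases eq_or_ne j (r v) with rfl | hne
      · exact ⟨v, rfl⟩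
      · exact ih j (by have := hstep v w h; omega)
  have hsub : Finset.range (r v + 1) ⊆ Finset.univ.image r := by
    intro j hj
    obtain ⟨u, hu⟩ := hall v j (by simpa [Nat.lt_succ_iff] using hj)
    exact Finset.mem_image.2 ⟨u, Finset.mem_univ _, hu⟩
  have := (Finset.card_le_card hsub).trans Finset.card_image_le
  simpa using this

theorem IsSpanningTree.dist_target (hT : G.IsSpanningTree t T) : G.dist T t = 0 := by
  unfold dist
  cases n with
  | zero => rfl
  | succ n => simp [pathLength, hT.1]

/-- `dist` follows up to `n` arcs and all depths are below `n`, so it has always reached the target;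
steps beyond the depth of a node add nothing. -/
theorem IsSpanningTree.dist_eq (hT : G.IsSpanningTree t T) {v w : Fin n} (h : T v = some w) :
    G.dist T v = G.weight v w + G.dist T w := by
  obtain ⟨r, hr, hr0, hs⟩ := hT.exists_depth
  have key : ∀ v, ∀ a b, r v ≤ a → r v ≤ b → G.pathLength T a v = G.pathLength T b v := by
    refine hT.induction ?_ ?_
    · intro a b _ _
      cases a <;> cases b <;> simp [pathLength, hT.1]
    · intro v w h ih a b ha hb
      have := hs v w h
      obtain ⟨a, rfl⟩ : ∃ a', a = a' + 1 := ⟨a - 1, by omega⟩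
      obtain ⟨b, rfl⟩ : ∃ b', b = b' + 1 := ⟨b - 1, by omega⟩
      simp only [pathLength, h]
      rw [ih a b (by omega) (by omega)]
  obtain ⟨m, rfl⟩ : ∃ m, n = m + 1 := ⟨n - 1, by have := hr v; omega⟩
  have hv := hr v
  have h1 := hs v w h
  unfold dist
  rw [key w (m + 1) m (by omega) (by omega)]
  simp [pathLength, h]

theorem IsSpanningTree.irrefl (hT : G.IsSpanningTree t T) {v w : Fin n} (h : T v = some w) :
    ¬ Relation.ReflTransGen (fun a b => T a = some b) w v := by
  obtain ⟨r, -, -, hs⟩ := hT.exists_depth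
  have : ∀ x, Relation.ReflTransGen (fun a b => T a = some b) w x → r x ≤ r w := by
    intro x hx
    induction hx with
    | refl => exact le_rfl
    | tail _ h ih => have := hs _ _ h; omega
  intro hw
  have h1 := this _ hw
  have h2 := hs _ _ h
  omega

theorem IsSpanningTree.ne_target (hT : G.IsSpanningTree t T) {v w : Fin n} (h : T v = some w) :
    v ≠ t := by
  rintro rfl; rw [hT.1] at h; cases h

/-- A successor map whose arcs decrease a potential is a spanning tree. -/
theorem isSpanningTree_of_decreasing {α : Type*} [Preorder α] (φ : Fin n → α) (ht : T t = none)
    (hsome : ∀ v, v ≠ t → ∃ w, T v = some w) (harc : ∀ v w, T v = some w → (v, w) ∈ G.arcs)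
    (hφ : ∀ v w, T v = some w → φ w < φ v) : G.IsSpanningTree t T := by
  refine ⟨ht, hsome, harc, fun v => ?_⟩
  have wf : WellFounded fun a b : Fin n => φ a < φ b :=
    @Finite.wellFounded_of_trans_of_irrefl _ _ _ ⟨fun _ _ _ => lt_trans⟩ ⟨fun _ => lt_irrefl _⟩
  induction v using wf.induction with
  | _ v ih =>
    rcases eq_or_ne v t with rfl | hv
    · exact .refl
    · obtain ⟨w, hw⟩ := hsome v hv
      exact .head hw (ih w (hφ v w hw))

/-- If two trees differ in the arc out of `u` only, then the distance of the head of this arc is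
the same in both. -/
theorem IsSpanningTree.dist_exchange (hT : G.IsSpanningTree t T) (hU : G.IsSpanningTree t U)
    {u w : Fin n} (h : ∀ v, v ≠ u → T v = U v) (hw : U u = some w) :
    G.dist U u = G.weight u w + G.dist T w := by
  -- A node whose path in `U` avoids `u` has the same path in `T`. The head `w` is such a node
  -- because `U` has no cycle.
  have key : ∀ x, ¬ Relation.ReflTransGen (fun a b => U a = some b) x u →
      G.dist T x = G.dist U x := by
    refine hU.induction ?_ ?_
    · intro _; rw [hT.dist_target, hU.dist_target]
    · intro v x hv ih hn
      have hvu : v ≠ u := by rintro rfl; exact hn .refl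
      rw [hU.dist_eq hv, hT.dist_eq ((h v hvu).trans hv), ih fun hx => hn (.head hv hx)]
  rw [hU.dist_eq hw, key w (hU.irrefl hw)]

/-! ## Paths as sets of arcs -/

open Classical in
/-- The arcs of the path from `v` to the target. -/
noncomputable def pathArcs (T : SuccMap n) (v : Fin n) : Finset (Fin n × Fin n) :=
  {e | T e.1 = some e.2 ∧ Relation.ReflTransGen (fun a b => T a = some b) v e.1}

theorem mem_pathArcs {v a b : Fin n} : (a, b) ∈ pathArcs T v ↔
    T a = some b ∧ Relation.ReflTransGen (fun a b => T a = some b) v a := by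
  simp [pathArcs]

theorem IsSpanningTree.sum_pathArcs (hT : G.IsSpanningTree t T) (z : Fin k → ℝ) (v : Fin n) :
    ∑ e ∈ pathArcs T v, (G.weight e.1 e.2).eval z = (G.dist T v).eval z := by
  classical
  revert v
  refine hT.induction ?_ ?_
  · have : pathArcs T t = ∅ := by
      ext ⟨a, b⟩
      rw [mem_pathArcs]
      simp only [Finset.notMem_empty, iff_false, not_and]
      intro h hr
      rcases hr.cases_head with rfl | ⟨c, hc, -⟩
      · exact hT.ne_target h rfl
      · exact hT.ne_target hc rfl
    rw [this, hT.dist_target]; simp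
  · intro v w h ih
    have : pathArcs T v = insert (v, w) (pathArcs T w) := by
      ext ⟨a, b⟩
      rw [Finset.mem_insert, mem_pathArcs, mem_pathArcs, Prod.mk.injEq]
      constructor
      · rintro ⟨h1, h2⟩
        rcases h2.cases_head with rfl | ⟨c, hc, hr⟩
        · rw [h] at h1; exact Or.inl ⟨rfl, (Option.some.inj h1).symm⟩
        · rw [h] at hc; obtain rfl := Option.some.inj hc; exact Or.inr ⟨h1, hr⟩
      · rintro (⟨rfl, rfl⟩ | ⟨h1, h2⟩)
        · exact ⟨h, .refl⟩
        · exact ⟨h1, .head h h2⟩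
    rw [this, Finset.sum_insert, ih, hT.dist_eq h, TropMonomial.eval_add]
    rw [mem_pathArcs]
    exact fun hh => hT.irrefl h hh.2

theorem pathArcs_subset (hT : G.IsSpanningTree t T) (v : Fin n) :
    (pathArcs T v : Set (Fin n × Fin n)) ⊆ G.arcs := by
  rintro ⟨a, b⟩ h
  exact hT.2.2.1 a b (mem_pathArcs.1 h).1

/-- At the lower corner, equal lengths mean equal arc sets, and the arc set of the path from `v`
contains only one arc out of `v`. -/
theorem Generic.succ_eq (hG : G.Generic) (hT : G.IsSpanningTree t T) (hU : G.IsSpanningTree t U)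
    {v : Fin n} (h : (G.dist T v).eval G.lo = (G.dist U v).eval G.lo) : T v = U v := by
  rcases eq_or_ne v t with rfl | hv
  · rw [hT.1, hU.1]
  · obtain ⟨w, hw⟩ := hT.2.1 v hv
    have := hG G.lo (fun i => Or.inl rfl) _ _ (pathArcs_subset hT v) (pathArcs_subset hU v)
      (by rw [hT.sum_pathArcs, hU.sum_pathArcs, h])
    have hm : (v, w) ∈ pathArcs T v := mem_pathArcs.2 ⟨hw, .refl⟩
    rw [this] at hm
    rw [hw, (mem_pathArcs.1 hm).1]

/-! ## Positivity of the weights -/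

theorem lo_mem_box (hB : G.NonnegBounds) : G.lo ∈ G.box := fun i => ⟨le_rfl, (hB.2 i).2.le⟩

/-- Genericity separates the single arc from the empty set at the lower corner, so its weight is
nonzero there; constants stay fixed, and variables do not fall below their lower bounds. -/
theorem Generic.weight_pos (hB : G.NonnegBounds) (hG : G.Generic) {v w : Fin n}
    (h : (v, w) ∈ G.arcs) {z : Fin k → ℝ} (hz : z ∈ G.box) : 0 < (G.weight v w).eval z := by
  have key : (G.weight v w).eval G.lo ≠ 0 := by
    intro h0
    have := hG G.lo (fun i => Or.inl rfl) {(v, w)} ∅ (by simpa using h) (by simp) (by simpa using h0)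
    simp at this
  obtain ⟨a, ha⟩ := exists_weight h
  rw [weight_eq ha] at key ⊢
  cases a with
  | const c =>
    simp only [ArcWeight.eval_const] at key ⊢
    exact lt_of_le_of_ne (hB.1 v w c ha) key.symm
  | var i =>
    simp only [ArcWeight.eval_var] at key ⊢
    exact (lt_of_le_of_ne (hB.2 i).1 key.symm).trans_le (hz i).1

theorem Generic.dist_lt (hB : G.NonnegBounds) (hG : G.Generic) (hT : G.IsSpanningTree t T)
    {z : Fin k → ℝ} (hz : z ∈ G.box) {v w : Fin n} (h : T v = some w) :
    (G.dist T w).eval z < (G.dist T v).eval z := by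
  rw [hT.dist_eq h, TropMonomial.eval_add]
  linarith [hG.weight_pos hB (hT.2.2.1 v w h) hz]

theorem Generic.dist_nonneg (hB : G.NonnegBounds) (hG : G.Generic) (hT : G.IsSpanningTree t T)
    {z : Fin k → ℝ} (hz : z ∈ G.box) (v : Fin n) : 0 ≤ (G.dist T v).eval z := by
  revert v
  refine hT.induction ?_ ?_
  · rw [hT.dist_target]; simp
  · intro v w h ih
    exact ih.trans (hG.dist_lt hB hT hz h).le

/-- Replacing an arc by one that leads to a node at smaller distance yields a tree. -/
theorem Generic.isSpanningTree_update (hB : G.NonnegBounds) (hG : G.Generic)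
    (hT : G.IsSpanningTree t T) {z : Fin k → ℝ} (hz : z ∈ G.box) {v w : Fin n} (hv : v ≠ t)
    (h : (v, w) ∈ G.arcs) (hlt : (G.dist T w).eval z < (G.dist T v).eval z) :
    G.IsSpanningTree t (Function.update T v (some w)) := by
  -- The distances in the old tree, taken at `z`, serve as potential: they decrease along the old
  -- arcs by positivity and along the new arc by assumption.
  refine isSpanningTree_of_decreasing (fun x => (G.dist T x).eval z) ?_ ?_ ?_ ?_
  · rw [Function.update_of_ne hv.symm, hT.1]
  · intro x hx
    by_cases hxv : x = v
    · subst hxv; exact ⟨w, Function.update_self ..⟩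
    · rw [Function.update_of_ne hxv]; exact hT.2.1 x hx
  · intro x y hxy
    by_cases hxv : x = v
    · subst hxv; rw [Function.update_self] at hxy; cases hxy; exact h
    · rw [Function.update_of_ne hxv] at hxy; exact hT.2.2.1 x y hxy
  · intro x y hxy
    by_cases hxv : x = v
    · subst hxv; rw [Function.update_self] at hxy; cases hxy; exact hlt
    · rw [Function.update_of_ne hxv] at hxy; exact hG.dist_lt hB hT hz hxy

/-! ## Trees that are optimal at a point -/

theorem mem_cell_iff {z : Fin k → ℝ} : z ∈ G.cell T ↔ z ∈ G.box ∧ ∀ v w, (v, w) ∈ G.arcs →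
    (G.dist T v).eval z ≤ (G.weight v w).eval z + (G.dist T w).eval z := by
  simp [cell, TropMonomial.eval_add]

/-- A feasible potential is a lower bound for the distances in a tree. -/
theorem IsSpanningTree.le_dist (hT : G.IsSpanningTree t T) {z : Fin k → ℝ} {φ : Fin n → ℝ}
    (ht : φ t ≤ 0) (hφ : ∀ v w, (v, w) ∈ G.arcs → φ v ≤ (G.weight v w).eval z + φ w)
    (v : Fin n) : φ v ≤ (G.dist T v).eval z := by
  revert v
  refine hT.induction ?_ ?_
  · rw [hT.dist_target]; simpa using ht
  · intro v w h ih
    rw [hT.dist_eq h, TropMonomial.eval_add]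
    linarith [hφ v w (hT.2.2.1 v w h)]

/-- On the cell of `T`, the distances of `T` form a feasible potential, which bounds the distances
in every tree from below. -/
theorem dist_le_of_mem_cell {z : Fin k → ℝ} (hT : G.IsSpanningTree t T) (hz : z ∈ G.cell T)
    (hU : G.IsSpanningTree t U) (v : Fin n) : (G.dist T v).eval z ≤ (G.dist U v).eval z :=
  hU.le_dist (φ := fun v => (G.dist T v).eval z) (by rw [hT.dist_target]; simp)
    (mem_cell_iff.1 hz).2 v

theorem dist_eq_of_mem_cell {z : Fin k → ℝ} (hT : G.IsSpanningTree t T) (hz : z ∈ G.cell T)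
    (hU : G.IsSpanningTree t U) (hz' : z ∈ G.cell U) (v : Fin n) :
    (G.dist T v).eval z = (G.dist U v).eval z :=
  le_antisymm (dist_le_of_mem_cell hT hz hU v) (dist_le_of_mem_cell hU hz' hT v)

/-- Distances of a tree that consists of tight arcs for a potential. -/
theorem IsSpanningTree.dist_eq_potential (hT : G.IsSpanningTree t T) {z : Fin k → ℝ}
    {φ : Fin n → ℝ} (ht : φ t = 0)
    (hφ : ∀ v w, T v = some w → φ v = (G.weight v w).eval z + φ w) (v : Fin n) :
    (G.dist T v).eval z = φ v := by
  revert v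
  refine hT.induction ?_ ?_
  · rw [hT.dist_target, ht]; simp
  · intro v w h ih
    rw [hT.dist_eq h, TropMonomial.eval_add, ih, hφ v w h]

theorem finite_trees (P : SuccMap n → Prop) : {T | P T}.Finite := Set.toFinite _

/-- Take a spanning tree that minimizes the sum of all distances at `z`. A violated arc could be
exchanged in, which lowers the distance of its tail and raises none. -/
theorem Generic.exists_mem_cell (hB : G.NonnegBounds) (hG : G.Generic)
    (hU : G.IsSpanningTree t U) {z : Fin k → ℝ} (hz : z ∈ G.box) :
    ∃ T, G.IsSpanningTree t T ∧ z ∈ G.cell T := by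
  obtain ⟨T, hT, hmin⟩ := Set.exists_min_image {T | G.IsSpanningTree t T}
    (fun T => ∑ v, (G.dist T v).eval z) (finite_trees _) ⟨U, hU⟩
  refine ⟨T, hT, mem_cell_iff.2 ⟨hz, fun v w h => ?_⟩⟩
  by_contra! hlt
  have hT : G.IsSpanningTree t T := hT
  have hw := hG.weight_pos hB h hz
  have hv : v ≠ t := by
    rintro rfl
    rw [hT.dist_target, TropMonomial.eval_zero] at hlt
    linarith [hG.dist_nonneg hB hT hz w]
  have hT' := hG.isSpanningTree_update hB hT hz hv h (by linarith)
  set T' := Function.update T v (some w) with hT'def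
  have hv' : T' v = some w := Function.update_self ..
  have hne : ∀ x, x ≠ v → T x = T' x := fun x hx => (Function.update_of_ne hx _ _).symm
  have hle : ∀ x, (G.dist T' x).eval z ≤ (G.dist T x).eval z := by
    refine hT'.induction ?_ ?_
    · rw [hT.dist_target, hT'.dist_target]
    · intro x y hxy ih
      rw [hT'.dist_eq hxy, TropMonomial.eval_add]
      by_cases hxv : x = v
      · subst hxv; rw [hv'] at hxy; cases hxy; linarith
      · rw [hT.dist_eq ((hne x hxv).trans hxy), TropMonomial.eval_add]; linarith
  have hlt' : (G.dist T' v).eval z < (G.dist T v).eval z := by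
    rw [hT.dist_exchange hT' hne hv', TropMonomial.eval_add]; exact hlt
  exact absurd (hmin T' hT') (not_le.2
    (Finset.sum_lt_sum (fun x _ => hle x) ⟨v, Finset.mem_univ _, hlt'⟩))

end ParamNetwork

namespace ParamNetwork

variable {n k : ℕ} {G : ParamNetwork n k} {t : Fin n} {T U : SuccMap n}

/-! ## Geometry of the feasible domain -/

theorem exists_pos_segment {S : Set (Fin k → ℝ)} {z : Fin k → ℝ} (hz : z ∈ interior S)
    (y : Fin k → ℝ) : ∃ ε : ℝ, 0 < ε ∧ z + ε • (y - z) ∈ S ∧ z + (-ε) • (y - z) ∈ S := by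
  have hc : Continuous fun s : ℝ => z + s • (y - z) := by fun_prop
  have : (fun s : ℝ => z + s • (y - z)) ⁻¹' interior S ∈ nhds (0 : ℝ) :=
    hc.continuousAt.preimage_mem_nhds (isOpen_interior.mem_nhds (by simpa using hz))
  obtain ⟨ε, hε, hsub⟩ := Metric.mem_nhds_iff.1 this
  refine ⟨ε / 2, by positivity, interior_subset (hsub ?_), interior_subset (hsub ?_)⟩
  · rw [Metric.mem_ball, dist_zero_right, Real.norm_eq_abs, abs_of_pos] <;> linarith
  · rw [Metric.mem_ball, dist_zero_right, Real.norm_eq_abs, abs_neg, abs_of_pos] <;> linarith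

/-- A linear form of constant sign on a set that vanishes at an interior point is zero. -/
theorem LE.of_eval_eq {f g : TropMonomial k} (h : G.LE g f) {z : Fin k → ℝ}
    (hz : z ∈ interior G.box) (he : f.eval z = g.eval z) : G.LE f g := by
  intro y _
  obtain ⟨ε, hε, -, h2⟩ := exists_pos_segment hz y
  -- The inequality is used at the point opposite to `y` with respect to `z`, where it turns into
  -- the reverse inequality at `y`.
  have := h _ h2
  rw [f.eval_lineMap, g.eval_lineMap] at this
  nlinarith

theorem eval_eq_of_eqOn_open {f g : TropMonomial k} {S : Set (Fin k → ℝ)} {z : Fin k → ℝ}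
    (hz : z ∈ interior S) (h : ∀ y ∈ S, f.eval y = g.eval y) (y : Fin k → ℝ) :
    f.eval y = g.eval y := by
  obtain ⟨ε, hε, h1, -⟩ := exists_pos_segment hz y
  have := h _ h1
  rw [f.eval_lineMap, g.eval_lineMap, h z (interior_subset hz)] at this
  have h3 : ε * (f.eval y - g.eval y) = 0 := by linarith
  rcases mul_eq_zero.1 h3 with h | h <;> linarith

theorem convex_box : Convex ℝ G.box := by
  intro x hx y hy a b ha hb hab i
  have e : (a • x + b • y) i = a * x i + b * y i := rfl
  refine ⟨?_, ?_⟩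
  · rw [e]
    have h1 := mul_le_mul_of_nonneg_left (hx i).1 ha
    have h2 := mul_le_mul_of_nonneg_left (hy i).1 hb
    have : G.lo i = a * G.lo i + b * G.lo i := by rw [← add_mul, hab, one_mul]
    linarith
  · rw [e]
    have h1 := (hx i).2
    have h2 := (hy i).2
    revert h1 h2
    cases G.hi i with
    | top => simp
    | coe c =>
      intro h1 h2
      have h1 := mul_le_mul_of_nonneg_left (WithTop.coe_le_coe.1 h1) ha
      have h2 := mul_le_mul_of_nonneg_left (WithTop.coe_le_coe.1 h2) hb
      have : c = a * c + b * c := by rw [← add_mul, hab, one_mul]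
      exact WithTop.coe_le_coe.2 (by linarith)

theorem NonnegBounds.interior_box_nonempty (hB : G.NonnegBounds) :
    (interior G.box).Nonempty := by
  have hb : ∀ i, ∃ b : ℝ, G.lo i < b ∧ (b : WithTop ℝ) ≤ G.hi i := by
    intro i
    have := (hB.2 i).2
    revert this
    cases G.hi i with
    | top => exact fun _ => ⟨G.lo i + 1, by linarith, le_top⟩
    | coe c => exact fun h => ⟨c, WithTop.coe_lt_coe.1 h, le_rfl⟩
  choose b hb hb' using hb
  have hsub : Set.pi Set.univ (fun i => Set.Ioo (G.lo i) (b i)) ⊆ G.box := fun z hz i =>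
    ⟨(hz i trivial).1.le, (WithTop.coe_le_coe.2 (hz i trivial).2.le).trans (hb' i)⟩
  refine ⟨fun i => (G.lo i + b i) / 2, interior_maximal hsub
    (isOpen_set_pi Set.finite_univ fun _ _ => isOpen_Ioo) fun i _ => ?_⟩
  have := hb i
  constructor <;> linarith

theorem isClosed_box : IsClosed G.box := by
  have : G.box = ⋂ i, ({z | G.lo i ≤ z i} ∩ {z | (z i : WithTop ℝ) ≤ G.hi i}) := by
    ext z; simp [box]
  rw [this]
  refine isClosed_iInter fun i => (isClosed_le (by fun_prop) (by fun_prop)).inter ?_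
  cases G.hi i with
  | top => simp
  | coe c =>
    simp only [WithTop.coe_le_coe]
    exact isClosed_le (by fun_prop) (by fun_prop)

theorem isClosed_cell : IsClosed (G.cell T) := by
  have : G.cell T = G.box ∩ ⋂ v, ⋂ w, ⋂ _ : (v, w) ∈ G.arcs,
      {z | (G.dist T v).eval z ≤ (G.weight v w + G.dist T w).eval z} := by
    ext z; simp [cell]
  rw [this]
  exact isClosed_box.inter (isClosed_iInter fun v => isClosed_iInter fun w =>
    isClosed_iInter fun _ => isClosed_le (TropMonomial.continuous_eval _)
      (TropMonomial.continuous_eval _))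

theorem cell_subset_box : G.cell T ⊆ G.box := fun _ h => h.1

/-! ## Trees that are optimal at interior points -/

/-- If `d_vw + p_w ≤ p_v` on the box, optimality at `z` forces equality there; since `z` is
interior, the two forms then agree on the box and the relation is not strict. -/
theorem IsSpanningTree.isShortestPathTree (hT : G.IsSpanningTree t T) {z : Fin k → ℝ}
    (hz : z ∈ interior G.box) (hc : z ∈ G.cell T) : G.IsShortestPathTree t T := by
  refine ⟨hT, fun v w h hlt => hlt.2 ?_⟩
  exact LE.of_eval_eq hlt.1 hz (le_antisymm (hc.2 v w h) (hlt.1 z hc.1))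

/-- Comparability together with equality at an interior point would give equality on the whole box,
in particular at the lower corner, where genericity applies. -/
theorem Generic.incomparable (hB : G.NonnegBounds) (hG : G.Generic) (hT : G.IsSpanningTree t T)
    (hU : G.IsSpanningTree t U) {z : Fin k → ℝ} (hz : z ∈ interior G.box) {u : Fin n}
    (hu : T u ≠ U u) (he : (G.dist T u).eval z = (G.dist U u).eval z) :
    G.Incomparable (G.dist T u) (G.dist U u) := by
  have key : ¬ (G.LE (G.dist T u) (G.dist U u) ∧ G.LE (G.dist U u) (G.dist T u)) := fun h =>
    hu (hG.succ_eq hT hU (le_antisymm (h.1 _ (lo_mem_box hB)) (h.2 _ (lo_mem_box hB))))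
  exact ⟨fun h => key ⟨h, LE.of_eval_eq h hz he.symm⟩,
    fun h => key ⟨LE.of_eval_eq h hz he, h⟩⟩

/-- Two trees that are optimal at the same interior point are connected by exchanges. -/
theorem Generic.reachable_of_mem_cell (hB : G.NonnegBounds) (hG : G.Generic) {z : Fin k → ℝ}
    (hz : z ∈ interior G.box) (hU : G.IsShortestPathTree t U) (hzU : z ∈ G.cell U)
    (hT : G.IsShortestPathTree t T) (hzT : z ∈ G.cell T) :
    (G.treeGraph t).Reachable ⟨T, hT⟩ ⟨U, hU⟩ := by
  classical
  -- Induction on the number of nodes at which `T` differs from `U`; each step adopts one arc of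
  -- `U`.
  induction hc : (Finset.univ.filter fun v => T v ≠ U v).card using Nat.strong_induction_on
    generalizing T with
  | _ c ih =>
    by_cases hTU : T = U
    · subst hTU; exact .rfl
    obtain ⟨u, hu⟩ : ∃ u, T u ≠ U u := by
      by_contra! h; exact hTU (funext h)
    have hut : u ≠ t := by rintro rfl; exact hu (by rw [hT.1.1, hU.1.1])
    obtain ⟨w, hw⟩ := hU.1.2.1 u hut
    have harc := hU.1.2.2.1 u w hw
    have heq := dist_eq_of_mem_cell hT.1 hzT hU.1 hzU
    have hzB := cell_subset_box hzT
    have htight : (G.dist T u).eval z = (G.weight u w).eval z + (G.dist T w).eval z := by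
      rw [heq, heq, hU.1.dist_eq hw, TropMonomial.eval_add]
    have hS' := hG.isSpanningTree_update hB hT.1 hzB hut harc
      (by linarith [hG.weight_pos hB harc hzB])
    set T' := Function.update T u (some w) with hT'def
    have hv' : T' u = some w := Function.update_self ..
    have hne : ∀ x, x ≠ u → T x = T' x := fun x hx => (Function.update_of_ne hx _ _).symm
    -- The adopted arc is tight at `z`, so no distance changes at `z` and `T'` is still optimal
    -- there.
    have hd : ∀ v, (G.dist T' v).eval z = (G.dist T v).eval z := by
      refine hS'.dist_eq_potential (by rw [hT.1.dist_target]; simp) ?_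
      intro x y hxy
      by_cases hxv : x = u
      · subst hxv; rw [hv'] at hxy; cases hxy; exact htight
      · rw [hT.1.dist_eq ((hne x hxv).trans hxy), TropMonomial.eval_add]
    have hzT' : z ∈ G.cell T' := mem_cell_iff.2 ⟨hzB, fun v w h => by
      rw [hd, hd]; exact (mem_cell_iff.1 hzT).2 v w h⟩
    have hT' := hS'.isShortestPathTree hz hzT'
    have hadj : (G.treeGraph t).Adj ⟨T, hT⟩ ⟨T', hT'⟩ := by
      have hu' : T u ≠ T' u := by rw [hv', ← hw]; exact hu
      exact ⟨u, hu', hne, hG.incomparable hB hT.1 hS' hz hu' (hd u).symm⟩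
    refine hadj.reachable.trans (ih _ ?_ hT' hzT' rfl)
    rw [← hc]
    refine Finset.card_lt_card ⟨fun x => ?_, fun h => ?_⟩
    · simp only [Finset.mem_filter, Finset.mem_univ, true_and]
      intro hx hx'
      by_cases hxu : x = u
      · subst hxu; exact hx (hv'.trans hw.symm)
      · exact hx ((hne x hxu).symm.trans hx')
    · have := h (Finset.mem_filter.2 ⟨Finset.mem_univ u, hu⟩)
      simp only [Finset.mem_filter, Finset.mem_univ, true_and] at this
      exact this (hv'.trans hw.symm)

/-- All trees with full-dimensional cells are connected by exchanges. -/
theorem Generic.reachable_of_interior (hB : G.NonnegBounds) (hG : G.Generic)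
    (hT : G.IsShortestPathTree t T) (hU : G.IsShortestPathTree t U)
    (hTi : (interior (G.cell T)).Nonempty) (hUi : (interior (G.cell U)).Nonempty) :
    (G.treeGraph t).Reachable ⟨T, hT⟩ ⟨U, hU⟩ := by
  obtain ⟨x, hx⟩ := hTi
  obtain ⟨y, hy⟩ := hUi
  by_contra hcon
  -- `A` and `B` collect the cells of the trees inside and outside the component of `T`. Both are
  -- closed, so connectedness yields an interior point of the box in both, where the trees of two
  -- such cells are connected after all.
  let A : Set (Fin k → ℝ) := ⋃ S ∈ {S | ∃ h : G.IsShortestPathTree t S,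
    (G.treeGraph t).Reachable ⟨T, hT⟩ ⟨S, h⟩}, G.cell S
  let B : Set (Fin k → ℝ) := ⋃ S ∈ {S | ∃ h : G.IsShortestPathTree t S,
    ¬ (G.treeGraph t).Reachable ⟨T, hT⟩ ⟨S, h⟩}, G.cell S
  have hA : IsClosed A := (finite_trees _).isClosed_biUnion fun _ _ => isClosed_cell
  have hB' : IsClosed B := (finite_trees _).isClosed_biUnion fun _ _ => isClosed_cell
  have hconn : IsPreconnected (interior G.box) := convex_box.interior.isPreconnected
  have hcov : interior G.box ⊆ A ∪ B := by
    intro z hz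
    obtain ⟨S, hS, hzS⟩ := hG.exists_mem_cell hB hT.1 (interior_subset hz)
    have hS' := hS.isShortestPathTree hz hzS
    by_cases hr : (G.treeGraph t).Reachable ⟨T, hT⟩ ⟨S, hS'⟩
    · exact Or.inl (Set.mem_biUnion (show S ∈ {S | _} from ⟨hS', hr⟩) hzS)
    · exact Or.inr (Set.mem_biUnion (show S ∈ {S | _} from ⟨hS', hr⟩) hzS)
  obtain ⟨z, hz, hzA, hzB⟩ := isPreconnected_closed_iff.1 hconn A B hA hB' hcov
    ⟨x, interior_mono cell_subset_box hx,
      Set.mem_biUnion (show T ∈ {S | _} from ⟨hT, .rfl⟩) (interior_subset hx)⟩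
    ⟨y, interior_mono cell_subset_box hy,
      Set.mem_biUnion (show U ∈ {S | _} from ⟨hU, hcon⟩) (interior_subset hy)⟩
  obtain ⟨S, ⟨hS, hr⟩, hzS⟩ := Set.mem_iUnion₂.1 hzA
  obtain ⟨S', ⟨hS', hr'⟩, hzS'⟩ := Set.mem_iUnion₂.1 hzB
  exact hr' (hr.trans (hG.reachable_of_mem_cell hB hz hS' hzS' hS hzS))

/-- The cell of the tree that is optimal at the lower bounds is full-dimensional. -/
theorem Generic.interior_cell_nonempty (hB : G.NonnegBounds) (hG : G.Generic)
    (hT : G.IsSpanningTree t T) (hc : G.lo ∈ G.cell T) : (interior (G.cell T)).Nonempty := by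
  have hlo := lo_mem_box hB
  -- `N` requires strict inequality for every arc whose inequality is not an identity of monomials.
  -- It is an open neighborhood of the lower corner.
  let N : Set (Fin k → ℝ) := ⋂ v, ⋂ w, {z | (v, w) ∈ G.arcs →
    G.dist T v ≠ G.weight v w + G.dist T w →
      (G.dist T v).eval z < (G.weight v w + G.dist T w).eval z}
  have hN : IsOpen N := by
    refine isOpen_iInter_of_finite fun v => isOpen_iInter_of_finite fun w => ?_
    by_cases h : (v, w) ∈ G.arcs ∧ G.dist T v ≠ G.weight v w + G.dist T w
    · simp only [h, ne_eq, not_false_eq_true, forall_const]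
      exact isOpen_lt (TropMonomial.continuous_eval _) (TropMonomial.continuous_eval _)
    · have : {z : Fin k → ℝ | (v, w) ∈ G.arcs → G.dist T v ≠ G.weight v w + G.dist T w →
          (G.dist T v).eval z < (G.weight v w + G.dist T w).eval z} = Set.univ :=
        Set.eq_univ_of_forall fun z h1 h2 => absurd ⟨h1, h2⟩ h
      rw [this]; exact isOpen_univ
  have hloN : G.lo ∈ N := by
    simp only [N, Set.mem_iInter]
    intro v w h hne
    -- An arc that is tight at the lower corner can be exchanged in without changing the length from
    -- `v`; by genericity it already belongs to `T`, so the inequality is an identity.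
    refine lt_of_le_of_ne (hc.2 v w h) fun he => hne ?_
    rw [TropMonomial.eval_add] at he
    have hw := hG.weight_pos hB h hlo
    have hv : v ≠ t := by
      rintro rfl
      rw [hT.dist_target, TropMonomial.eval_zero] at he
      linarith [hG.dist_nonneg hB hT hlo w]
    have hT' := hG.isSpanningTree_update hB hT hlo hv h (by linarith)
    have hne : ∀ x, x ≠ v → T x = Function.update T v (some w) x :=
      fun x hx => (Function.update_of_ne hx _ _).symm
    have hd := hT.dist_exchange hT' hne (Function.update_self ..)
    have := hG.succ_eq hT hT' (v := v) (by rw [hd, TropMonomial.eval_add]; exact he)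
    rw [Function.update_self] at this
    exact hT.dist_eq this
  have hsub : N ∩ interior G.box ⊆ G.cell T := by
    rintro z ⟨hz, hzB⟩
    refine ⟨interior_subset hzB, fun v w h => ?_⟩
    by_cases he : G.dist T v = G.weight v w + G.dist T w
    · rw [← he]
    · exact (Set.mem_iInter₂.1 hz v w h he).le
  -- The lower corner lies on the boundary, but a convex set with interior points is contained in
  -- the closure of its interior, so `N` meets the interior.
  have hcl : G.lo ∈ closure (interior G.box) := by
    rw [convex_box.closure_interior_eq_closure_of_nonempty_interior hB.interior_box_nonempty]
    exact subset_closure hlo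
  obtain ⟨z, hz⟩ := mem_closure_iff.1 hcl N hN hloN
  exact ⟨z, interior_maximal hsub (hN.inter isOpen_interior) hz⟩

/-! ## The Kleene star -/

theorem one_add_evalMatrix (z : Fin k → ℝ) (v w : Fin n) :
    (1 + G.evalMatrix z) v w = (if v = w then 1 else 0) + G.evalMatrix z v w := by
  rw [Matrix.add_apply, Matrix.one_apply]

theorem trop_sum_le {ι : Type*} [Fintype ι] (f : ι → Tropical (WithTop ℝ)) (i : ι) :
    ∑ j, f j ≤ f i := by
  classical
  rw [← Finset.add_sum_erase _ _ (Finset.mem_univ i)]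
  exact inf_le_left

theorem le_trop_sum {ι : Type*} [Fintype ι] (f : ι → Tropical (WithTop ℝ))
    {a : Tropical (WithTop ℝ)} (h : ∀ i, a ≤ f i) : a ≤ ∑ j, f j := by
  classical
  refine Finset.sum_induction f (a ≤ ·) (fun x y hx hy => le_inf hx hy) ?_ fun i _ => h i
  exact le_top

theorem evalMatrix_eq {z : Fin k → ℝ} {v w : Fin n} (h : (v, w) ∈ G.arcs) :
    G.evalMatrix z v w = Tropical.trop (((G.weight v w).eval z : ℝ) : WithTop ℝ) := by
  obtain ⟨a, ha⟩ := exists_weight h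
  simp [evalMatrix, ha, weight_eq ha]

theorem evalMatrix_eq_zero {z : Fin k → ℝ} {v w : Fin n} (h : (v, w) ∉ G.arcs) :
    G.evalMatrix z v w = 0 := by
  have : G.D v w = none := by simpa [mem_arcs] using h
  simp [evalMatrix, this]

/-- No power of `1 + D` can fall below a feasible potential, and the tree path of a node of depth at
most `s` is one of the walks that the power `s` minimizes over. The power `n - 1` suffices because
depths are below `n`. -/
theorem kleeneStar_eq_dist (hT : G.IsSpanningTree t T) {z : Fin k → ℝ} (hz : z ∈ G.cell T)
    (v : Fin n) :
    G.kleeneStar z v t = Tropical.trop (((G.dist T v).eval z : ℝ) : WithTop ℝ) := by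
  have hlow : ∀ (s : ℕ) v, Tropical.trop (((G.dist T v).eval z : ℝ) : WithTop ℝ) ≤
      ((1 + G.evalMatrix z) ^ s) v t := by
    intro s
    induction s with
    | zero =>
      intro v
      rw [pow_zero, Matrix.one_apply]
      split_ifs with h
      · subst h; rw [hT.dist_target, TropMonomial.eval_zero]; exact le_rfl
      · exact le_top
    | succ s ih =>
      intro v
      rw [pow_succ', Matrix.mul_apply]
      refine le_trop_sum _ fun w => ?_
      rw [one_add_evalMatrix, add_mul]
      refine le_inf ?_ ?_
      · split_ifs with h
        · subst h; rw [one_mul]; exact ih v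
        · rw [zero_mul]; exact le_top
      · by_cases h : (v, w) ∈ G.arcs
        · refine le_trans ?_ (mul_le_mul_right (ih w) _)
          rw [evalMatrix_eq h, ← Tropical.trop_add, ← WithTop.coe_add]
          exact Tropical.trop_monotone (WithTop.coe_le_coe.2 ((mem_cell_iff.1 hz).2 v w h))
        · rw [evalMatrix_eq_zero h, zero_mul]; exact le_top
  obtain ⟨r, hr, hr0, hs⟩ := hT.exists_depth
  have hup : ∀ (s : ℕ) v, r v ≤ s → ((1 + G.evalMatrix z) ^ s) v t ≤
      Tropical.trop (((G.dist T v).eval z : ℝ) : WithTop ℝ) := by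
    intro s
    induction s with
    | zero =>
      intro v hv
      have : v = t := by
        by_contra hvt
        obtain ⟨w, hw⟩ := hT.2.1 v hvt
        have := hs v w hw
        omega
      subst this
      rw [pow_zero, Matrix.one_apply_eq, hT.dist_target, TropMonomial.eval_zero]
      exact le_rfl
    | succ s ih =>
      intro v hv
      rw [pow_succ', Matrix.mul_apply]
      by_cases hvt : v = t
      · refine (trop_sum_le _ v).trans ?_
        rw [one_add_evalMatrix, if_pos rfl, add_mul, one_mul]
        exact inf_le_left.trans (ih v (by rw [hvt, hr0]; omega))
      · obtain ⟨w, hw⟩ := hT.2.1 v hvt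
        refine (trop_sum_le _ w).trans ?_
        rw [one_add_evalMatrix, add_mul]
        refine inf_le_right.trans ?_
        rw [evalMatrix_eq (hT.2.2.1 v w hw), hT.dist_eq hw, TropMonomial.eval_add,
          WithTop.coe_add, Tropical.trop_add]
        exact mul_le_mul_right (ih w (by have := hs v w hw; omega)) _
  exact le_antisymm (hup _ v (by have := hr v; omega)) (hlow _ v)

/-- The zero of the semiring is `∞`, so a nonzero entry comes from an actual walk to `t`. -/
theorem reflTransGen_of_kleeneStar_ne {z : Fin k → ℝ} {v : Fin n} (h : G.kleeneStar z v t ≠ 0) :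
    Relation.ReflTransGen (fun a b => (a, b) ∈ G.arcs) v t := by
  have : ∀ (s : ℕ) v, ((1 + G.evalMatrix z) ^ s) v t ≠ 0 →
      Relation.ReflTransGen (fun a b => (a, b) ∈ G.arcs) v t := by
    intro s
    induction s with
    | zero =>
      intro v h
      by_cases hv : v = t
      · subst hv; exact .refl
      · rw [pow_zero, Matrix.one_apply_ne hv] at h; exact absurd rfl h
    | succ s ih =>
      intro v h
      rw [pow_succ', Matrix.mul_apply] at h
      obtain ⟨w, -, hw⟩ := Finset.exists_ne_zero_of_sum_ne_zero h
      have h1 : ((1 + G.evalMatrix z) ^ s) w t ≠ 0 := right_ne_zero_of_mul hw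
      have h2 := left_ne_zero_of_mul hw
      by_cases hvw : v = w
      · subst hvw; exact ih v h1
      · rw [one_add_evalMatrix, if_neg hvw, zero_add] at h2
        refine .head ?_ (ih w h1)
        by_contra hcon
        exact h2 (evalMatrix_eq_zero hcon)
  exact this _ v h

/-! ## Regions -/

/-- At each point of the box some tree `U` is optimal and computes the star. If `T` gives the same
values there, it inherits all inequalities of `U`. -/
theorem cell_eq_setOf_kleeneStar_eq (hT : G.IsSpanningTree t T) (hS : ∃ S, G.IsSpanningTree t S)
    (hB : G.NonnegBounds) (hG : G.Generic) :
    G.cell T = {z ∈ G.box | ∀ v, G.kleeneStar z v t =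
      Tropical.trop (((G.dist T v).eval z : ℝ) : WithTop ℝ)} := by
  ext z
  refine ⟨fun h => ⟨h.1, kleeneStar_eq_dist hT h⟩, fun ⟨hz, h⟩ => ?_⟩
  obtain ⟨S, hS⟩ := hS
  obtain ⟨U, hU, hzU⟩ := hG.exists_mem_cell hB hS hz
  have : ∀ v, (G.dist T v).eval z = (G.dist U v).eval z := by
    intro v
    have := (h v).symm.trans (kleeneStar_eq_dist hU hzU v)
    simpa using this
  refine mem_cell_iff.2 ⟨hz, fun v w hvw => ?_⟩
  rw [this, this]
  exact (mem_cell_iff.1 hzU).2 v w hvw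

/-- Both trees have minimal distances throughout a set with interior, so the affine forms coincide
everywhere, and at the lower corner they determine all arcs. -/
theorem Generic.eq_of_cell_eq (hG : G.Generic) (hT : G.IsSpanningTree t T)
    (hU : G.IsSpanningTree t U) (h : G.cell T = G.cell U) (hi : (interior (G.cell T)).Nonempty) :
    T = U := by
  obtain ⟨z, hz⟩ := hi
  funext v
  refine hG.succ_eq hT hU (eval_eq_of_eqOn_open hz (fun y hy => ?_) _)
  exact dist_eq_of_mem_cell hT hy hU (h ▸ hy) v

/-- Some cell meets the region in a set with interior. The monomials `q v` agree there with the
distances of the tree, hence everywhere, so region and cell are given by the same equations. -/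
theorem Generic.exists_cell_of_isRegion (hB : G.NonnegBounds) (hG : G.Generic)
    (hS : ∃ S, G.IsSpanningTree t S) {R : Set (Fin k → ℝ)} (hR : G.IsRegion t R) :
    ∃ T, G.IsShortestPathTree t T ∧ (interior (G.cell T)).Nonempty ∧ G.cell T = R := by
  obtain ⟨hi, q, hq⟩ := hR
  have hRB : R ⊆ G.box := by rw [hq]; exact fun z hz => hz.1
  obtain ⟨S, hS⟩ := hS
  -- finitely many closed cells cover the interior of the region
  have : ∃ T, G.IsSpanningTree t T ∧ (interior (G.cell T ∩ R)).Nonempty := by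
    by_contra! hcon
    -- Baire: otherwise the complements of the sets `cell ∩ closure (interior R)` are open and
    -- dense, and some point of `interior R` lies in no cell. The closure makes these sets closed.
    have hd : Dense (⋂ T ∈ {T | G.IsSpanningTree t T},
        (G.cell T ∩ closure (interior R))ᶜ) := by
      refine dense_biInter_of_isOpen
        (fun T _ => (isClosed_cell.inter isClosed_closure).isOpen_compl)
        (finite_trees _).countable fun T hT => ?_
      rw [← interior_eq_empty_iff_dense_compl, Set.eq_empty_iff_forall_notMem]
      intro z hz
      have hz' : z ∈ closure (interior R) := (interior_subset hz).2
      obtain ⟨y, hy, hyR⟩ := mem_closure_iff.1 hz' _ isOpen_interior hz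
      have hsub : interior (G.cell T ∩ closure (interior R)) ∩ interior R ⊆ G.cell T ∩ R :=
        fun x hx => ⟨(interior_subset hx.1).1, interior_subset hx.2⟩
      have := interior_maximal hsub (isOpen_interior.inter isOpen_interior) ⟨hy, hyR⟩
      rw [hcon T hT] at this
      exact this
    obtain ⟨z, hz, hzN⟩ := hd.inter_open_nonempty _ isOpen_interior hi
    obtain ⟨T, hT, hzT⟩ := hG.exists_mem_cell hB hS (hRB (interior_subset hz))
    exact Set.mem_iInter₂.1 hzN T hT ⟨hzT, subset_closure hz⟩
  obtain ⟨T, hT, z, hz⟩ := this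
  have heq : ∀ v y, (q v).eval y = (G.dist T v).eval y := by
    intro v
    refine eval_eq_of_eqOn_open hz fun y hy => ?_
    have h1 := hy.2
    rw [hq] at h1
    have := (h1.2 v).symm.trans (kleeneStar_eq_dist hT hy.1 v)
    simpa using this
  have hzc : z ∈ interior (G.cell T) := interior_mono Set.inter_subset_left hz
  refine ⟨T, hT.isShortestPathTree (interior_mono cell_subset_box hzc) (interior_subset hzc),
    ⟨z, hzc⟩, ?_⟩
  rw [cell_eq_setOf_kleeneStar_eq hT ⟨S, hS⟩ hB hG, hq]
  simp only [heq]

theorem reflTransGen_of_isRegion {R : Set (Fin k → ℝ)} (hR : G.IsRegion t R) (v : Fin n) :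
    Relation.ReflTransGen (fun a b => (a, b) ∈ G.arcs) v t := by
  obtain ⟨⟨z, hz⟩, q, hq⟩ := hR
  have h1 := interior_subset hz
  rw [hq] at h1
  refine reflTransGen_of_kleeneStar_ne (z := z) ?_
  rw [h1.2 v]
  intro h
  exact WithTop.coe_ne_top (Tropical.trop_injective h)

end ParamNetwork

/-! ## The number of forests with given roots -/

section Forests

open Finset

variable {V : Type*} [Fintype V] [DecidableEq V]

open Classical in
/-- Successor maps of the forests with set of roots `R` and set of other nodes `A`. -/
noncomputable def forests (A R : Finset V) : Finset (V → V) :=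
  {T | (∀ v, v ∉ A → T v = v) ∧ (∀ v ∈ A, T v ∈ A ∪ R) ∧
    ∃ r : V → ℕ, ∀ v ∈ A, r (T v) < r v}

/-- The number of forests with `r` given roots and `m` other nodes. -/
def forestCount (m r : ℕ) : ℕ := if m = 0 then 1 else r * (m + r) ^ (m - 1)

/-- After `(i + 1) * (M + 1).choose (i + 1) = (M + 1) * M.choose i`, this is the binomial expansion
of `(r + (M + 1)) ^ M`, multiplied by `r`. The summand `j = 0` vanishes since there are no roots
left. -/
theorem sum_choose_forestCount (m r : ℕ) (hm : m ≠ 0) :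
    ∑ j ∈ range (m + 1), m.choose j * (r ^ j * forestCount (m - j) j) = forestCount m r := by
  obtain ⟨M, rfl⟩ := Nat.exists_eq_succ_of_ne_zero hm
  rw [Finset.sum_range_succ']
  have h0 : forestCount (M.succ - 0) 0 = 0 := by simp [forestCount]
  have key : ∀ i ∈ range (M + 1), M.succ.choose (i + 1) *
      (r ^ (i + 1) * forestCount (M.succ - (i + 1)) (i + 1)) =
      r * (r ^ i * (M + 1) ^ (M - i) * M.choose i) := by
    intro i hi
    have : M.succ.choose (i + 1) * forestCount (M.succ - (i + 1)) (i + 1) =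
        (M + 1) ^ (M - i) * M.choose i := by
      rw [Nat.succ_sub_succ]
      rcases eq_or_ne i M with rfl | hne
      · simp [forestCount]
      · have hlt : i < M := by have := mem_range.1 hi; omega
        have h1 := Nat.add_one_mul_choose_eq M i
        obtain ⟨d, rfl⟩ := Nat.exists_eq_add_of_lt hlt
        have e1 : i + d + 1 - i = d + 1 := by omega
        have e2 : d + 1 + (i + 1) = i + d + 1 + 1 := by omega
        simp only [forestCount, e1, Nat.succ_ne_zero, if_false, Nat.add_sub_cancel, e2]
        rw [pow_succ, ← mul_assoc, ← h1]
        ring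
    calc _ = r ^ (i + 1) * (M.succ.choose (i + 1) * forestCount (M.succ - (i + 1)) (i + 1)) := by
          ring
      _ = _ := by rw [this]; ring
  have hp := add_pow r (M + 1) M
  simp only [Nat.cast_id] at hp
  rw [Finset.sum_congr rfl key, h0, ← Finset.mul_sum, ← hp]
  simp [forestCount, add_comm]

/-- Classify forests by the set `J` of children of the roots. Such a forest is determined by a map
`J → R` and a forest on `A \ J` with root set `J`, to which induction applies. -/
theorem card_forests_le (A R : Finset V) (hd : Disjoint A R) :
    #(forests A R) ≤ forestCount #A #R := by
  classical
  induction hm : #A using Nat.strong_induction_on generalizing A R with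
  | _ m ih =>
    rcases eq_or_ne m 0 with rfl | hm0
    · obtain rfl := card_eq_zero.1 hm
      refine (card_le_one.2 ?_).trans (by simp [forestCount])
      intro T hT U hU
      simp only [forests, mem_filter, mem_univ, true_and] at hT hU
      funext v
      rw [hT.1 v (by simp), hU.1 v (by simp)]
    -- Despite the name, these are the nodes adjacent to a root.
    let leaf : (V → V) → Finset V := fun T => A.filter fun v => T v ∈ R
    have hmaps : ∀ T ∈ forests A R, leaf T ∈ A.powerset := fun T _ =>
      mem_powerset.2 (filter_subset _ _)
    rw [card_eq_sum_card_fiberwise hmaps]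
    have hfib : ∀ J ∈ A.powerset, #{T ∈ forests A R | leaf T = J} ≤
        #R ^ #J * forestCount (m - #J) #J := by
      intro J hJ
      have hJA := mem_powerset.1 hJ
      rcases eq_or_ne J ∅ with rfl | hJ0
      -- A node of minimal rank in the nonempty set `A` cannot have its successor in `A`, so it is a
      -- child of a root.
      · have : {T ∈ forests A R | leaf T = ∅} = ∅ := by
          refine filter_eq_empty_iff.2 fun T hT hl => ?_
          simp only [forests, mem_filter, mem_univ, true_and] at hT
          obtain ⟨r, hr⟩ := hT.2.2
          obtain ⟨v, hv, hmin⟩ := exists_min_image A r (card_pos.1 (by omega))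
          have hnR : T v ∉ R := fun h => by
            have : v ∈ leaf T := mem_filter.2 ⟨hv, h⟩
            rw [hl] at this; simp at this
          have hA : T v ∈ A := (mem_union.1 (hT.2.1 v hv)).resolve_right hnR
          exact absurd (hr v hv) (not_lt.2 (hmin _ hA))
        rw [this]; simp
      have hcard : #(A \ J) = m - #J := by rw [card_sdiff_of_subset hJA, hm]
      have hJpos : 0 < #J := card_pos.2 (nonempty_iff_ne_empty.2 hJ0)
      have h1 := ih (m - #J) (by omega) (A \ J) J sdiff_disjoint hcard
      have h2 : #(Fintype.piFinset fun v => if v ∈ J then R else {v}) = #R ^ #J := by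
        rw [Fintype.card_piFinset]
        have : ∀ v, #(if v ∈ J then R else {v}) = if v ∈ J then #R else 1 := by
          intro v; split_ifs <;> simp
        simp only [this, prod_ite_mem, univ_inter, prod_const]
      refine le_trans ?_ (Nat.mul_le_mul h2.le h1)
      rw [← card_product]
      refine card_le_card_of_injOn
        (fun T => (fun v => if v ∈ J then T v else v, fun v => if v ∈ A \ J then T v else v))
        ?_ ?_
      · intro T hT
        obtain ⟨hT, hl⟩ := mem_filter.1 (mem_coe.1 hT)
        simp only [forests, mem_filter, mem_univ, true_and] at hT
        have hlm : ∀ v, v ∈ J ↔ v ∈ A ∧ T v ∈ R := fun v => by rw [← hl]; exact mem_filter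
        rw [mem_coe, mem_product, Fintype.mem_piFinset]
        refine ⟨fun v => ?_, ?_⟩
        · by_cases hv : v ∈ J
          · simp only [hv, if_true]; exact ((hlm v).1 hv).2
          · simp [hv]
        · simp only [forests, mem_filter, mem_univ, true_and]
          refine ⟨fun v hv => if_neg hv, fun v hv => ?_, ?_⟩
          · rw [if_pos hv, sdiff_union_of_subset hJA]
            obtain ⟨hvA, hvJ⟩ := mem_sdiff.1 hv
            exact (mem_union.1 (hT.2.1 v hvA)).resolve_right fun h => hvJ ((hlm v).2 ⟨hvA, h⟩)
          · obtain ⟨r, hr⟩ := hT.2.2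
            refine ⟨r, fun v hv => ?_⟩
            rw [if_pos hv]; exact hr v (mem_sdiff.1 hv).1
      · intro T hT U hU he
        obtain ⟨hT, -⟩ := mem_filter.1 (mem_coe.1 hT)
        obtain ⟨hU, -⟩ := mem_filter.1 (mem_coe.1 hU)
        simp only [forests, mem_filter, mem_univ, true_and] at hT hU
        have he1 := congrArg Prod.fst he
        have he2 := congrArg Prod.snd he
        funext v
        have e1 := congrFun he1 v
        have e2 := congrFun he2 v
        by_cases hvA : v ∈ A
        · by_cases hvJ : v ∈ J
          · simpa [hvJ] using e1
          · simpa [hvJ, hvA] using e2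
        · rw [hT.1 v hvA, hU.1 v hvA]
    refine (sum_le_sum hfib).trans ?_
    rw [sum_powerset_apply_card (fun j => #R ^ j * forestCount (m - j) j), hm]
    simp only [smul_eq_mul]
    exact (sum_choose_forestCount m #R hm0).le

end Forests

namespace ParamNetwork

variable {n k : ℕ} {G : ParamNetwork n k} {t : Fin n} {T U : SuccMap n}

/-! ## The number of shortest-path trees -/

open Finset

open Classical in
variable (G t) in
/-- The shortest-path trees with target `t`. -/
noncomputable def shortestPathTrees : Finset (SuccMap n) := {T | G.IsShortestPathTree t T}

theorem mem_shortestPathTrees : T ∈ G.shortestPathTrees t ↔ G.IsShortestPathTree t T := by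
  simp [shortestPathTrees]

theorem numTrees_eq_card : G.numTrees t = #(G.shortestPathTrees t) := by
  classical
  rw [numTrees, Set.ncard_eq_toFinset_card']
  congr 1
  ext; simp [shortestPathTrees]

/-- Cayley's bound: these are forests with the single root `t` and `n - 1` other nodes. Sending
`none` to the node itself turns a successor map into a total one. -/
theorem numTrees_le_pow : (G.numTrees t : ℝ) ≤ (n : ℝ) ^ ((n : ℤ) - 2) := by
  have hn : n ≠ 0 := fun h => by subst h; exact t.elim0
  have h1 : #(G.shortestPathTrees t) ≤ #(forests (univ.erase t) {t}) := by
    refine card_le_card_of_injOn (fun T v => (T v).getD v) ?_ ?_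
    · intro T hT
      have hT := (mem_shortestPathTrees.1 hT).1
      simp only [forests, coe_filter, mem_univ, true_and, Set.mem_ofPred_eq]
      refine ⟨fun v hv => ?_, fun v _ => ?_, ?_⟩
      · have : v = t := by simpa using hv
        subst this; simp [hT.1]
      · by_cases h : (T v).getD v = t <;> simp [h]
      · obtain ⟨r, -, -, hr⟩ := hT.exists_depth
        refine ⟨r, fun v hv => ?_⟩
        obtain ⟨w, hw⟩ := hT.2.1 v (mem_erase.1 hv).1
        rw [hw, Option.getD_some, hr v w hw]; omega
    · intro T hT U hU he
      have hT := (mem_shortestPathTrees.1 hT).1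
      have hU := (mem_shortestPathTrees.1 hU).1
      funext v
      by_cases hv : v = t
      · subst hv; rw [hT.1, hU.1]
      · obtain ⟨w, hw⟩ := hT.2.1 v hv
        obtain ⟨x, hx⟩ := hU.2.1 v hv
        have := congrFun he v
        simp only [hw, hx, Option.getD_some] at this
        rw [hw, hx, this]
  have h2 := h1.trans (card_forests_le _ _ (by simp))
  rw [card_erase_of_mem (mem_univ t), card_univ, Fintype.card_fin, card_singleton,
    ← numTrees_eq_card] at h2
  refine (Nat.cast_le.2 h2).trans ?_
  obtain ⟨m, rfl⟩ := Nat.exists_eq_succ_of_ne_zero hn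
  -- For `n = 1` the integer exponent is `-1`, and the bound reads `1 ^ (-1) = 1`.
  rcases m with _ | m
  · simp [forestCount]
  · have e : ((m.succ.succ : ℕ) : ℤ) - 2 = (m : ℤ) := by push_cast; ring
    simp only [forestCount, Nat.succ_eq_add_one, Nat.add_sub_cancel] at e ⊢
    rw [e, zpow_natCast]
    simp

theorem numTrees_le_choose : G.numTrees t ≤ G.numArcs.choose (n - 1) := by
  classical
  have harcs : G.numArcs = #(univ.filter fun e => e ∈ G.arcs) := by
    rw [numArcs, Set.ncard_eq_toFinset_card']; congr 1; ext; simp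
  rw [numTrees_eq_card, harcs, ← card_powersetCard]
  refine card_le_card_of_injOn (fun T => univ.filter fun e => T e.1 = some e.2) ?_ ?_
  · intro T hT
    have hT := (mem_shortestPathTrees.1 hT).1
    rw [mem_coe, mem_powersetCard]
    refine ⟨fun e he => ?_, ?_⟩
    · simp only [mem_filter, mem_univ, true_and] at he ⊢
      exact hT.2.2.1 _ _ he
    · have : #(univ.erase t) = n - 1 := by simp
      rw [← this]
      refine card_bij (fun e _ => e.1) ?_ ?_ ?_
      · intro e he
        simp only [mem_filter, mem_univ, true_and] at he
        simpa using hT.ne_target he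
      · rintro ⟨a, b⟩ ha ⟨c, d⟩ hc rfl
        simp only [mem_filter, mem_univ, true_and] at ha hc
        rw [ha] at hc; cases hc; rfl
      · intro v hv
        obtain ⟨w, hw⟩ := hT.2.1 v (mem_erase.1 hv).1
        exact ⟨(v, w), by simpa using hw, rfl⟩
  · intro T _ U _ he
    funext v
    ext w
    have := congrArg (fun s => (v, w) ∈ s) he
    simpa using this

/-- Recursion along a spanning tree. -/
theorem IsSpanningTree.exists_rec (hT : G.IsSpanningTree t T) {β : Type*} (b : β)
    (F : Fin n → Fin n → β → β) :
    ∃ a : Fin n → β, a t = b ∧ ∀ v w, T v = some w → a v = F v w (a w) := by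
  obtain ⟨r, -, hr0, hr⟩ := hT.exists_depth
  have : ∀ s, ∃ a : Fin n → β, a t = b ∧ ∀ v w, T v = some w → r v ≤ s → a v = F v w (a w) := by
    intro s
    induction s with
    | zero =>
      refine ⟨fun _ => b, rfl, fun v w h h0 => ?_⟩
      have := hr v w h; omega
    | succ s ih =>
      obtain ⟨a, hat, ha⟩ := ih
      refine ⟨fun v => if r v ≤ s then a v else (T v).elim b fun w => F v w (a w), ?_, ?_⟩
      · simp [hr0, hat]
      · intro v w h hs
        have h1 := hr v w h
        have hw : r w ≤ s := by omega
        by_cases hv : r v ≤ s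
        · simp only [hv, hw, if_true]; exact ha v w h hv
        · simp [hv, hw, h]
  obtain ⟨a, hat, ha⟩ := this (univ.sup r)
  exact ⟨a, hat, fun v w h => ha v w h (le_sup (f := r) (mem_univ v))⟩

/-- A shortest-path tree is determined by the exponents of its distances. -/
theorem Generic.eq_of_exp_eq (hB : G.NonnegBounds) (hG : G.Generic) (hT : G.IsShortestPathTree t T)
    (hU : G.IsShortestPathTree t U) (h : ∀ v, (G.dist T v).exp = (G.dist U v).exp) : T = U := by
  have key : ∀ {T U : SuccMap n}, G.IsShortestPathTree t T → G.IsShortestPathTree t U →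
      (∀ v, (G.dist T v).exp = (G.dist U v).exp) →
      ∀ v, (G.dist T v).coeff ≤ (G.dist U v).coeff := by
    intro T U hT hU h
    refine hU.1.induction ?_ ?_
    · rw [hT.1.dist_target, hU.1.dist_target]
    · intro v w hvw ih
      have hn := hT.2 v w (hU.1.2.2.1 v w hvw)
      have hd := hU.1.dist_eq hvw
      -- As the exponents agree, `p_v` and `d_vw + p_w` in `T` differ by a constant. A larger
      -- coefficient of `p_v` would make the arc a strict improvement, against the choice of `T`.
      have he : ∀ z, (G.dist T v).eval z - (G.weight v w + G.dist T w).eval z =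
          (G.dist T v).coeff - ((G.weight v w).coeff + (G.dist T w).coeff) := by
        intro z
        have : (G.dist T v).exp = (G.weight v w + G.dist T w).exp := by
          rw [h v, hd]; funext i; simp [h w]
        simp only [TropMonomial.eval, this, TropMonomial.add_coeff]
        ring
      by_contra! hlt
      rw [hd, TropMonomial.add_coeff] at hlt
      refine hn ⟨fun z _ => ?_, fun hle => ?_⟩
      · have := he z; linarith
      · have := he G.lo; have := hle _ (lo_mem_box hB); linarith
  funext v
  refine hG.succ_eq hT.1 hU.1 ?_
  rw [TropMonomial.ext (le_antisymm (key hT hU h v) (key hU hT (fun v => (h v).symm) v)) (h v)]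

end ParamNetwork

namespace ParamNetwork

variable {n k : ℕ} {G : ParamNetwork n k} {t : Fin n} {T U : SuccMap n}

/-! ### First variables on paths and the bound `treeBound` -/

open Finset

/-- `a v` is the first variable on the path from `v` to the target of the spanning tree `T`. -/
def IsFirstVariable (G : ParamNetwork n k) (t : Fin n) (T : SuccMap n)
    (a : Fin n → Option (Fin k)) : Prop :=
  a t = none ∧ ∀ v w, T v = some w →
    (∀ i, G.D v w = some (.var i) → a v = some i) ∧
    ((∀ i, G.D v w ≠ some (.var i)) → a v = a w)

theorem IsSpanningTree.exists_firstVariable (hT : G.IsSpanningTree t T) :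
    ∃ a, G.IsFirstVariable t T a := by
  obtain ⟨a, hat, ha⟩ := hT.exists_rec (none : Option (Fin k)) fun v w x =>
    match G.D v w with
    | some (.var i) => some i
    | _ => x
  refine ⟨a, hat, fun v w h => ⟨fun i hi => ?_, fun hi => ?_⟩⟩
  · rw [ha v w h, hi]
  · rw [ha v w h]
    cases hD : G.D v w with
    | none => rfl
    | some x =>
      cases x with
      | const c => rfl
      | var i => exact absurd hD (hi i)

theorem IsFirstVariable.exp_of_none {a : Fin n → Option (Fin k)} (ha : G.IsFirstVariable t T a)
    (hT : G.IsSpanningTree t T) (v : Fin n) : a v = none → (G.dist T v).exp = fun _ => 0 := by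
  revert v
  refine hT.induction ?_ ?_
  · intro _; rw [hT.dist_target]; rfl
  · intro v w h ih hv
    obtain ⟨x, hx⟩ := exists_weight (hT.2.2.1 v w h)
    cases x with
    | const c =>
      have hw := (ha.2 v w h).2 (by simp [hx])
      funext i
      rw [hT.dist_eq h, weight_eq hx, TropMonomial.add_exp, ih (hw ▸ hv)]
      rfl
    | var i =>
      rw [(ha.2 v w h).1 i hx] at hv; cases hv

/-- Before the arc `(x, y)` that carries the first variable, only constants occur; so the exponent
of `p_v` is a unit vector plus that of `p_y`. -/
theorem IsFirstVariable.exp_of_some {a : Fin n → Option (Fin k)} (ha : G.IsFirstVariable t T a)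
    (hT : G.IsSpanningTree t T) (i : Fin k) (v : Fin n) : a v = some i →
    ∃ x y, T x = some y ∧ G.D x y = some (.var i) ∧
      ∀ j, (G.dist T v).exp j = (Pi.single i 1 : Fin k → ℕ) j + (G.dist T y).exp j := by
  revert v
  refine hT.induction ?_ ?_
  · intro h; rw [ha.1] at h; cases h
  · intro v w h ih hv
    obtain ⟨b, hb⟩ := exists_weight (hT.2.2.1 v w h)
    cases b with
    | const c =>
      have hw := (ha.2 v w h).2 (by simp [hb])
      obtain ⟨x, y, hxy, hD, he⟩ := ih (hw ▸ hv)
      refine ⟨x, y, hxy, hD, fun j => ?_⟩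
      rw [hT.dist_eq h, weight_eq hb, TropMonomial.add_exp, he]
      exact zero_add _
    | var l =>
      rw [(ha.2 v w h).1 l hb] at hv
      cases hv
      refine ⟨v, w, h, hb, fun j => ?_⟩
      rw [hT.dist_eq h, weight_eq hb, TropMonomial.add_exp]
      rfl

/-- The first variables on the paths determine the exponents of the distances. -/
theorem IsFirstVariable.exp_eq (hS : G.SeparatedVariables) {a : Fin n → Option (Fin k)}
    (ha : G.IsFirstVariable t T a) (hT : G.IsSpanningTree t T) (ha' : G.IsFirstVariable t U a)
    (hU : G.IsSpanningTree t U) (v : Fin n) : (G.dist T v).exp = (G.dist U v).exp := by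
  -- Induction on the degree: by separated variables, the first variable has the same arc in both
  -- trees, and passing to the head of this arc lowers the degree.
  induction hs : ∑ j, (G.dist T v).exp j using Nat.strong_induction_on generalizing v with
  | _ s ih =>
    cases hv : a v with
    | none => rw [ha.exp_of_none hT v hv, ha'.exp_of_none hU v hv]
    | some i =>
      obtain ⟨x, y, hxy, hD, he⟩ := ha.exp_of_some hT i v hv
      obtain ⟨x', y', hxy', hD', he'⟩ := ha'.exp_of_some hU i v hv
      obtain ⟨e, -, hu⟩ := hS i
      have h1 := (hu (x, y) hD).trans (hu (x', y') hD').symm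
      cases h1
      funext j
      rw [he, he', ih _ ?_ y rfl]
      rw [← hs]
      refine sum_lt_sum (fun j _ => by rw [he]; omega) ⟨i, mem_univ i, ?_⟩
      rw [he, Pi.single_eq_same]; omega

/-- Trees are grouped by the set `S` of their variables, and within a group they are determined by
the first variables. These are forced at the target and at the tails of the arcs of `S`, altogether
`#S + 1` nodes; elsewhere they lie in `insertNone S`. -/
theorem numTrees_le_treeBound (hB : G.NonnegBounds) (hS : G.SeparatedVariables)
    (hG : G.Generic) : (G.numTrees t : ℝ) ≤ treeBound n k := by
  classical
  rw [numTrees_eq_card]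
  choose e he heu using hS
  let F := G.shortestPathTrees t
  have hex : ∀ T, ∃ a, G.IsShortestPathTree t T → G.IsFirstVariable t T a := by
    intro T
    by_cases hT : G.IsShortestPathTree t T
    · obtain ⟨a, ha⟩ := hT.1.exists_firstVariable
      exact ⟨a, fun _ => ha⟩
    · exact ⟨fun _ => none, fun h => absurd h hT⟩
  choose a ha using hex
  let vars : SuccMap n → Finset (Fin k) := fun T => univ.filter fun i => T (e i).1 = some (e i).2
  have hatail : ∀ T, G.IsShortestPathTree t T → ∀ i ∈ vars T, a T (e i).1 = some i := by
    intro T hT i hi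
    exact ((ha T hT).2 _ _ (by simpa [vars] using hi)).1 i (he i)
  have hmem : ∀ T, G.IsShortestPathTree t T → ∀ v i, a T v = some i → i ∈ vars T := by
    intro T hT v i hv
    obtain ⟨x, y, hxy, hD, -⟩ := (ha T hT).exp_of_some hT.1 i v hv
    have := heu i (x, y) hD
    simp only [vars, mem_filter, mem_univ, true_and, ← this]
    exact hxy
  have hfib : ∀ S : Finset (Fin k), (#{T ∈ F | vars T = S} : ℝ) ≤
      ((#S : ℝ) + 1) ^ ((n : ℤ) - #S - 1) := by
    intro S
    rcases Finset.eq_empty_or_nonempty {T ∈ F | vars T = S} with h0 | ⟨T₀, hT₀⟩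
    · rw [h0]; simp only [card_empty, Nat.cast_zero]; positivity
    obtain ⟨hT₀, hv₀⟩ := mem_filter.1 hT₀
    have hT₀ := mem_shortestPathTrees.1 hT₀
    -- The tails are distinct, since the first variable at the tail of the arc of `i` is `i` itself.
    have hinj : ∀ i ∈ S, ∀ j ∈ S, (e i).1 = (e j).1 → i = j := by
      intro i hi j hj hij
      have h1 := hatail T₀ hT₀ i (hv₀ ▸ hi)
      rw [hij, hatail T₀ hT₀ j (hv₀ ▸ hj)] at h1
      exact (Option.some.inj h1).symm
    let fixed : Finset (Fin n) := insert t (S.image fun i => (e i).1)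
    have hfixed : #fixed = #S + 1 := by
      rw [card_insert_of_notMem, card_image_of_injOn fun i hi j hj h => hinj i hi j hj h]
      intro h
      obtain ⟨i, hi, hit⟩ := mem_image.1 h
      have := hatail T₀ hT₀ i (hv₀ ▸ hi)
      rw [hit, (ha T₀ hT₀).1] at this; cases this
    let choices : Fin n → Finset (Option (Fin k)) := fun v =>
      if v ∈ fixed then {a T₀ v} else insertNone S
    have hle : #{T ∈ F | vars T = S} ≤ #(Fintype.piFinset choices) := by
      refine card_le_card_of_injOn a ?_ ?_
      · intro T hT
        obtain ⟨hT, hv⟩ := mem_filter.1 (mem_coe.1 hT)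
        have hT := mem_shortestPathTrees.1 hT
        rw [mem_coe, Fintype.mem_piFinset]
        intro v
        by_cases hvf : v ∈ fixed
        · simp only [choices, hvf, if_true, mem_singleton]
          rcases mem_insert.1 hvf with rfl | hvf
          · rw [(ha T hT).1, (ha T₀ hT₀).1]
          · obtain ⟨i, hi, rfl⟩ := mem_image.1 hvf
            rw [hatail T hT i (hv ▸ hi), hatail T₀ hT₀ i (hv₀ ▸ hi)]
        · simp only [choices, hvf, if_false, mem_insertNone]
          intro i hi
          exact hv ▸ hmem T hT v i hi
      · intro T hT U hU hTU
        have hT := mem_shortestPathTrees.1 (mem_filter.1 (mem_coe.1 hT)).1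
        have hU := mem_shortestPathTrees.1 (mem_filter.1 (mem_coe.1 hU)).1
        have h1 := ha T hT
        rw [hTU] at h1
        exact hG.eq_of_exp_eq hB hT hU fun v =>
          h1.exp_eq (fun i => ⟨e i, he i, heu i⟩) hT.1 (ha U hU) hU.1 v
    have hcard : #(Fintype.piFinset choices) = (#S + 1) ^ (n - (#S + 1)) := by
      rw [Fintype.card_piFinset]
      have : ∀ v, #(choices v) = if v ∈ fixedᶜ then #S + 1 else 1 := by
        intro v
        by_cases hvf : v ∈ fixed <;> simp [choices, hvf, card_insertNone]
      simp only [this, prod_ite_mem, univ_inter, prod_const, card_compl, Fintype.card_fin, hfixed]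
    have hn : #S + 1 ≤ n := by
      rw [← hfixed]; exact (card_le_univ _).trans (by simp)
    have hexp : (n : ℤ) - #S - 1 = ((n - (#S + 1) : ℕ) : ℤ) := by omega
    rw [hexp, zpow_natCast]
    exact_mod_cast hle.trans hcard.le
  have h1 := card_eq_sum_card_fiberwise (f := vars) (s := F) (t := (univ : Finset (Fin k)).powerset)
    fun T _ => mem_coe.2 (mem_powerset.2 (subset_univ _))
  have h2 := sum_powerset_apply_card (fun i => ((i : ℝ) + 1) ^ ((n : ℤ) - i - 1))
    (x := (univ : Finset (Fin k)))
  simp only [card_univ, Fintype.card_fin, nsmul_eq_mul] at h2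
  rw [treeBound, ← h2]
  calc (#F : ℝ) = ∑ S ∈ (univ : Finset (Fin k)).powerset, (#{T ∈ F | vars T = S} : ℝ) := by
        rw [h1]; push_cast; rfl
    _ ≤ _ := sum_le_sum fun S _ => hfib S

end ParamNetwork

/-! ## Bounds for metered computations -/

/-- The result satisfies `P`, and the computation needs at most `t` steps and `s` cells. -/
structure Metered.Meets {α : Type} (x : Metered α) (P : α → Prop) (t s : ℕ) : Prop where
  val : P x.val
  time : x.time ≤ t
  live : x.live ≤ s
  peak : x.peak ≤ s

namespace Metered

variable {α β : Type} {P : α → Prop} {Q : β → Prop} {t s : ℕ}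

theorem Meets.mono {x : Metered α} {P' : α → Prop} {t' s' : ℕ} (h : x.Meets P t s)
    (hP : ∀ a, P a → P' a) (ht : t ≤ t') (hs : s ≤ s') : x.Meets P' t' s' :=
  ⟨hP _ h.val, h.time.trans ht, h.live.trans hs, h.peak.trans hs⟩

theorem Meets.pure {a : α} (h : P a) : (pure a : Metered α).Meets P t s :=
  ⟨h, Nat.zero_le _, Nat.zero_le _, Nat.zero_le _⟩

theorem Meets.elem {a : α} (h : P a) (ht : 1 ≤ t := by omega) (hs : 1 ≤ s := by omega) :
    (elem a).Meets P t s := ⟨h, ht, hs, hs⟩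

/-- Subtracting the cost of the first part from the budget lets budgets be fixed in advance. Its
peak is counted as if still allocated, which is valid as an upper bound. -/
theorem Meets.bind {x : Metered α} {f : α → Metered β} {t' s' : ℕ} (hx : x.Meets P t' s')
    (hf : ∀ a, P a → (f a).Meets Q (t - t') (s - s')) (ht : t' ≤ t := by omega)
    (hs : s' ≤ s := by omega) : (x >>= f).Meets Q t s := by
  obtain ⟨h1, h2, h3, h4⟩ := hf _ hx.val
  refine ⟨h1, ?_, ?_, ?_⟩
  · change x.time + (f x.val).time ≤ t
    have := hx.time; omega
  · change x.live + (f x.val).live ≤ s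
    have := hx.live; omega
  · change max x.peak (x.live + (f x.val).peak) ≤ s
    have := hx.live; have := hx.peak; omega

theorem Meets.elem_bind {a : α} {f : α → Metered β} (hf : (f a).Meets Q (t - 1) (s - 1))
    (ht : 1 ≤ t := by omega) (hs : 1 ≤ s := by omega) : (_root_.elem a >>= f).Meets Q t s :=
  Meets.bind (P := fun b => b = a) (Meets.elem rfl) (fun _ h => h ▸ hf)

theorem Meets.ite {c : Prop} [Decidable c] {x y : Metered α} (hx : c → x.Meets P t s)
    (hy : ¬ c → y.Meets P t s) : (if c then x else y).Meets P t s := by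
  split_ifs with h
  · exact hx h
  · exact hy h

/-- The auxiliary cells are released after each entry, so `s` is paid only once, whereas the stored
entries and the time accumulate. -/
theorem tabulate_meets {n c : ℕ} [Sized α] {f : Fin n → Metered α} {P : Fin n → α → Prop}
    (hf : ∀ i, (f i).Meets (P i) t s) (hc : ∀ i a, P i a → Sized.cells a ≤ c) :
    (tabulate f).Meets (fun a => ∀ i, P i (a i)) (n * (t + 1)) (n * c + s) := by
  have h1 : ∑ i, Sized.cells (f i).val ≤ n * c := by
    refine (Finset.sum_le_card_nsmul _ _ c fun i _ => hc i _ (hf i).val).trans ?_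
    simp
  refine ⟨fun i => (hf i).val, ?_, h1.trans (Nat.le_add_right _ _), ?_⟩
  · change ∑ i, ((f i).time + 1) ≤ _
    refine (Finset.sum_le_card_nsmul _ _ (t + 1) fun i _ => ?_).trans (by simp)
    have := (hf i).time; omega
  · exact Nat.add_le_add h1 (Finset.sup_le fun i _ => (hf i).peak)

/-- The invariant `I` depends on the remaining part of the list. -/
theorem loop_meets {σ : Type} [Sized σ] {body : σ → α → Metered σ} {c : ℕ}
    (I : List α → σ → Prop) (hc : ∀ l x, I l x → Sized.cells x ≤ c)
    (hbody : ∀ a l x, I (a :: l) x → (body x a).Meets (I l) t s) (l : List α) (x : σ)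
    (h : I l x) : (loop body x l).Meets (I []) (l.length * (t + 1) + 1) (c + s) := by
  induction l generalizing x with
  | nil =>
    have := hc _ _ h
    refine ⟨h, by simp [loop], ?_, ?_⟩ <;> · change Sized.cells x ≤ _; omega
  | cons a l ih =>
    have hb := hbody a l x h
    have hy := ih _ hb.val
    have hx := hc _ _ h
    refine ⟨hy.val, ?_, hy.live, ?_⟩
    · change 1 + (body x a).time + (loop body (body x a).val l).time ≤ _
      have h1 := hb.time
      have h2 := hy.time
      rw [List.length_cons, Nat.add_mul]; omega
    · change max (Sized.cells x + (body x a).peak) (loop body (body x a).val l).peak ≤ _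
      have h1 := hb.peak
      have h2 := hy.peak
      omega

/-- The potential `Φ` bounds the number of steps. -/
theorem whileLoop_meets {σ ρ : Type} [Sized σ] [Sized ρ] {body : σ → Metered (σ ⊕ ρ)}
    (I : σ → Prop) (Φ : σ → ℕ) (R : ρ → Prop) (S : ℕ)
    (hpeak : ∀ x, I x → Sized.cells x + (body x).peak ≤ S)
    (hl : ∀ x x', I x → (body x).val = .inl x' → I x' ∧ 1 + (body x).time + Φ x' ≤ Φ x)
    (hr : ∀ x r, I x → (body x).val = .inr r →
      R r ∧ 1 + (body x).time ≤ Φ x ∧ Sized.cells r ≤ S)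
    (fuel : ℕ) (x : σ) (hx : I x) (hfuel : Φ x ≤ fuel) :
    (whileLoop body fuel x).Meets (fun o => ∃ r, o = some r ∧ R r) (Φ x) S := by
  induction fuel generalizing x with
  | zero =>
    -- Any outcome of the body uses at least one unit of potential, so `Φ x ≤ 0` is impossible; this
    -- is why the fuel cannot run out.
    cases hv : (body x).val with
    | inl x' => have := (hl x x' hx hv).2; omega
    | inr r => have := (hr x r hx hv).2.1; omega
  | succ fuel ih =>
    have hb := hpeak x hx
    cases hv : (body x).val with
    | inl x' =>
      obtain ⟨hI, hle⟩ := hl x x' hx hv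
      have h := ih x' hI (by omega)
      have hw : whileLoop body (fuel + 1) x = ⟨(whileLoop body fuel x').val,
          1 + (body x).time + (whileLoop body fuel x').time, (whileLoop body fuel x').live,
          max (Sized.cells x + (body x).peak) (whileLoop body fuel x').peak⟩ := by
        simp only [whileLoop]; rw [hv]
      rw [hw]
      exact ⟨h.val, (Nat.add_le_add_left h.time _).trans hle, h.live, max_le hb h.peak⟩
    | inr r =>
      obtain ⟨hR, hle, hcell⟩ := hr x r hx hv
      have hw : whileLoop body (fuel + 1) x = ⟨some r, 1 + (body x).time, Sized.cells r,
          Sized.cells x + (body x).peak⟩ := by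
        simp only [whileLoop]; rw [hv]
      rw [hw]
      exact ⟨⟨r, rfl, hR⟩, hle, hcell, hb⟩

end Metered

/-! ### Sizes of lists, arrays and monomials -/

theorem cells_list_le {α : Type} [Sized α] {c : ℕ} (l : List α)
    (h : ∀ a ∈ l, Sized.cells a ≤ c) : Sized.cells l ≤ 1 + l.length * (1 + c) := by
  change 1 + (l.map fun a => 1 + Sized.cells a).sum ≤ _
  have := List.sum_le_card_nsmul (l.map fun a => 1 + Sized.cells a) (1 + c) (by
    intro x hx
    obtain ⟨a, ha, rfl⟩ := List.mem_map.1 hx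
    have := h a ha; omega)
  simpa using this

theorem cells_fun_le {n : ℕ} {α : Type} [Sized α] {c : ℕ} (a : Fin n → α)
    (h : ∀ i, Sized.cells (a i) ≤ c) : Sized.cells a ≤ n * c := by
  change ∑ i, Sized.cells (a i) ≤ _
  refine (Finset.sum_le_card_nsmul _ _ c fun i _ => h i).trans (by simp)

theorem cells_option_fin_le {n : ℕ} (x : Option (Fin n)) : Sized.cells x ≤ 2 := by
  cases x with
  | none => exact Nat.le_succ 1
  | some _ => exact le_refl 2

theorem cells_succMap_le {n : ℕ} (T : SuccMap n) : Sized.cells T ≤ n * 2 :=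
  cells_fun_le T fun _ => cells_option_fin_le _

theorem cells_nodes_le {n : ℕ} (l : List (Fin n)) : Sized.cells l ≤ 1 + l.length * 2 :=
  cells_list_le l fun _ _ => le_rfl

theorem cells_monomials_le {n k : ℕ} (p : Fin n → TropMonomial k) :
    Sized.cells p ≤ n * (k + 1) :=
  cells_fun_le p fun _ => le_rfl

open Metered

theorem reverseList_meets {α : Type} [Sized α] {c : ℕ} (l : List α)
    (h : ∀ a ∈ l, Sized.cells a ≤ c) :
    (reverseList l).Meets (· = l.reverse) (l.length * 2 + 1) (2 + l.length * (1 + c)) := by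
  refine (loop_meets (t := 1) (s := 1) (c := 1 + l.length * (1 + c))
    (fun r x => ∃ p, p ++ r = l ∧ x = p.reverse) ?_ ?_ l [] ⟨[], rfl, rfl⟩).mono ?_ le_rfl ?_
  · rintro r _ ⟨p, rfl, rfl⟩
    refine (cells_list_le (c := c) p.reverse fun a ha => h a (by simp_all)).trans ?_
    rw [List.length_reverse, List.length_append, Nat.add_mul]; omega
  · rintro a r _ ⟨p, rfl, rfl⟩
    exact Meets.elem ⟨p ++ [a], by simp, by simp⟩
  · rintro _ ⟨p, rfl, rfl⟩; simp
  · omega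

namespace ParamNetwork

variable {n k : ℕ} {G : ParamNetwork n k} {t : Fin n} {T U : SuccMap n}

/-! ## Arithmetic of monomials -/

theorem zeroM_meets : (zeroM : Metered (TropMonomial k)).Meets (· = 0) (2 * k + 1) (k + 2) := by
  have h := tabulate_meets (n := k) (t := 1) (s := 1) (c := 1)
    (f := fun _ => elem (0 : ℕ)) (P := fun _ a => a = 0) (fun _ => Meets.elem rfl) fun _ _ _ => le_rfl
  refine Meets.bind h ?_
  intro e he
  exact Meets.elem (TropMonomial.ext rfl (funext he))

theorem addArc_meets (a : ArcWeight k) (f : TropMonomial k) :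
    (addArc a f).Meets (· = a.toMonomial + f) (8 * (k + 1)) (8 * (k + 1)) := by
  cases a with
  | const c =>
    refine Meets.elem_bind (Meets.elem_bind ?_)
    refine Meets.bind (tabulate_meets (t := 1) (s := 1) (c := 1) (P := fun j x => x = f.exp j)
      (fun j => Meets.elem rfl) fun _ _ _ => le_rfl) fun e he => Meets.elem ?_
    exact TropMonomial.ext rfl (funext fun j => (he j).trans (zero_add _).symm)
  | var i =>
    refine Meets.elem_bind ?_
    refine Meets.bind (tabulate_meets (t := 3) (s := 3) (c := 1)
      (P := fun j x => x = (Pi.single i 1 : Fin k → ℕ) j + f.exp j)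
      (fun j => Meets.elem_bind (Meets.elem_bind (Meets.ite (fun h => Meets.elem ?_)
        fun h => Meets.pure ?_))) fun _ _ _ => le_rfl) fun e he => Meets.elem ?_
    · obtain rfl : j = i := by simpa using h
      rw [Pi.single_eq_same]
    · have : j ≠ i := by simpa using h
      rw [Pi.single_eq_of_ne this, zero_add]
    · exact TropMonomial.ext (zero_add _).symm (funext he)

/-- The supremum of `f - g` on the feasible domain is attained coordinatewise. -/
noncomputable def supTerm (G : ParamNetwork n k) (f g : TropMonomial k) (i : Fin k) :
    WithTop ℝ :=
  if f.exp i ≤ g.exp i then ((((f.exp i : ℝ) - g.exp i) * G.lo i : ℝ) : WithTop ℝ)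
  else (G.hi i).map fun x => ((f.exp i : ℝ) - g.exp i) * x

theorem eval_sub_eval (f g : TropMonomial k) (z : Fin k → ℝ) :
    f.eval z - g.eval z = f.coeff - g.coeff + ∑ i, ((f.exp i : ℝ) - g.exp i) * z i := by
  simp only [TropMonomial.eval, sub_mul, Finset.sum_sub_distrib]
  ring

/-- On a product of intervals a linear form is maximized in each coordinate separately: at the lower
bound if the slope is at most zero, otherwise at the upper bound, or without bound on a ray. -/
theorem sum_supTerm_le_iff (hB : G.NonnegBounds) (f g : TropMonomial k) :
    ((f.coeff - g.coeff : ℝ) : WithTop ℝ) + ∑ i, G.supTerm f g i ≤ 0 ↔ G.LE f g := by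
  constructor
  · intro h z hz
    have h1 : ∀ i, (((((f.exp i : ℝ) - g.exp i) * z i : ℝ)) : WithTop ℝ) ≤ G.supTerm f g i := by
      intro i
      unfold supTerm
      split_ifs with hi
      · refine WithTop.coe_le_coe.2 (mul_le_mul_of_nonpos_left (hz i).1 ?_)
        have : (f.exp i : ℝ) ≤ g.exp i := by exact_mod_cast hi
        linarith
      · have hpos : (g.exp i : ℝ) < f.exp i := by exact_mod_cast not_le.1 hi
        have h2 := (hz i).2
        revert h2
        cases G.hi i with
        | top => exact fun _ => le_top
        | coe c =>
          intro h2
          exact WithTop.coe_le_coe.2 (mul_le_mul_of_nonneg_left (WithTop.coe_le_coe.1 h2)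
            (by linarith))
    have h2 : ((f.eval z - g.eval z : ℝ) : WithTop ℝ) ≤ 0 := by
      rw [eval_sub_eval, WithTop.coe_add, WithTop.coe_sum]
      exact (add_le_add_right (Finset.sum_le_sum fun i _ => h1 i) _).trans h
    have : f.eval z - g.eval z ≤ 0 := WithTop.coe_le_coe.1 h2
    linarith
  · intro h
    by_cases htop : ∃ i, G.supTerm f g i = ⊤
    · exfalso
      obtain ⟨i, hi⟩ := htop
      unfold supTerm at hi
      split_ifs at hi with hle
      · cases hi
      have hinf : G.hi i = ⊤ := by
        cases hh : G.hi i with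
        | top => rfl
        | coe c => rw [hh] at hi; cases hi
      have hone : (1 : ℝ) ≤ (f.exp i : ℝ) - g.exp i := by
        have : g.exp i + 1 ≤ f.exp i := not_le.1 hle
        have : ((g.exp i + 1 : ℕ) : ℝ) ≤ f.exp i := by exact_mod_cast this
        push_cast at this; linarith
      -- The slope in coordinate `i` is at least `1`, so moving by `M` from the lower corner makes
      -- `f - g` positive.
      set M : ℝ := |f.eval G.lo - g.eval G.lo| + 1 with hM
      have hM0 : 0 ≤ M := by positivity
      have hz : Function.update G.lo i (G.lo i + M) ∈ G.box := by
        intro j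
        by_cases hj : j = i
        · subst hj; rw [Function.update_self, hinf]; exact ⟨by linarith, le_top⟩
        · rw [Function.update_of_ne hj]; exact lo_mem_box hB j
      have h1 := h _ hz
      have h2 := eval_sub_eval f g (Function.update G.lo i (G.lo i + M))
      have h3 := eval_sub_eval f g G.lo
      have h4 : ∑ j, ((f.exp j : ℝ) - g.exp j) * Function.update G.lo i (G.lo i + M) j =
          ∑ j, ((f.exp j : ℝ) - g.exp j) * G.lo j + ((f.exp i : ℝ) - g.exp i) * M := by
        rw [← Finset.add_sum_erase _ _ (Finset.mem_univ i),
          ← Finset.add_sum_erase _ (fun j => ((f.exp j : ℝ) - g.exp j) * G.lo j)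
            (Finset.mem_univ i), Function.update_self,
          Finset.sum_congr rfl fun j hj => by
            rw [Function.update_of_ne (Finset.ne_of_mem_erase hj)]]
        ring
      have h5 : M ≤ ((f.exp i : ℝ) - g.exp i) * M := le_mul_of_one_le_left hM0 hone
      have h6 := neg_abs_le (f.eval G.lo - g.eval G.lo)
      linarith
    · push Not at htop
      -- The maximizing corner. The default value of `untopD` is never used, as an infinite upper
      -- bound with positive slope has been excluded.
      let z : Fin k → ℝ := fun i => if f.exp i ≤ g.exp i then G.lo i else (G.hi i).untopD 0
      have hterm : ∀ i, G.supTerm f g i = ((((f.exp i : ℝ) - g.exp i) * z i : ℝ) : WithTop ℝ) := by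
        intro i
        have := htop i
        unfold supTerm at this ⊢
        simp only [z]
        split_ifs with hi
        · rfl
        · rw [if_neg hi] at this
          revert this
          cases G.hi i with
          | top => exact fun h => absurd rfl h
          | coe c => exact fun _ => rfl
      have hz : z ∈ G.box := by
        intro i
        have := htop i
        unfold supTerm at this
        simp only [z]
        split_ifs with hi
        · exact lo_mem_box hB i
        · rw [if_neg hi] at this
          have hlt := (hB.2 i).2
          revert this hlt
          cases G.hi i with
          | top => exact fun h => absurd rfl h
          | coe c => exact fun _ hlt => ⟨(WithTop.coe_lt_coe.1 hlt).le, le_rfl⟩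
      simp only [hterm]
      rw [← WithTop.coe_sum, ← WithTop.coe_add, ← eval_sub_eval]
      have := h z hz
      exact WithTop.coe_le_coe.2 (by linarith)

/-- The partial sum plus the terms still to come is invariant. Only this sum survives an iteration,
so the space does not depend on `k`. -/
theorem leM_meets (hB : G.NonnegBounds) (f g : TropMonomial k) :
    (G.leM f g).Meets (fun b => b = true ↔ G.LE f g) (12 * (k + 1)) 20 := by
  refine Meets.elem_bind (Meets.elem_bind (Meets.elem_bind ?_))
  refine Meets.bind (loop_meets (t := 8) (s := 8) (c := 1)
    (fun l x => x + (l.map (G.supTerm f g)).sum =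
      ((f.coeff - g.coeff : ℝ) : WithTop ℝ) + ∑ i, G.supTerm f g i) (fun _ _ _ => le_rfl)
    ?_ _ _ ?_) ?_
    (by rw [List.length_finRange]; omega)
  · intro i l x hx
    refine Meets.elem_bind (Meets.elem_bind (Meets.elem_bind (Meets.elem_bind ?_)))
    rw [List.map_cons, List.sum_cons, ← add_assoc] at hx
    refine Meets.ite (fun h => Meets.elem_bind (Meets.elem_bind (Meets.elem ?_)))
      (fun h => Meets.elem_bind (Meets.elem_bind (Meets.elem ?_)))
    · rw [← hx, supTerm, if_pos (by simpa using h)]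
    · rw [← hx, supTerm, if_neg (by simpa using h)]
  · rw [← List.sum_ofFn, List.ofFn_eq_map]
  · intro x hx
    refine Meets.elem ?_ (by rw [List.length_finRange]; omega)
    rw [decide_eq_true_iff, ← sum_supTerm_le_iff hB, ← hx]
    simp

end ParamNetwork

namespace ParamNetwork

variable {n k : ℕ} {G : ParamNetwork n k} {t : Fin n} {T U : SuccMap n}

open Metered

/-! ## Distances along an order of the nodes -/

/-- All nodes in an order in which every node comes after its successor. -/
structure IsOrder (T : SuccMap n) (l : List (Fin n)) : Prop where
  nodup : l.Nodup
  mem : ∀ v, v ∈ l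
  pairwise : l.Pairwise fun a b => T a ≠ some b

theorem IsOrder.length_eq {l : List (Fin n)} (h : IsOrder T l) : l.length = n := by
  rw [← List.toFinset_card_of_nodup h.nodup]
  have : l.toFinset = Finset.univ := Finset.eq_univ_of_forall fun v => by simpa using h.mem v
  rw [this]; simp

theorem IsOrder.succ_mem {pre post : List (Fin n)} {v w : Fin n}
    (h : IsOrder T (pre ++ v :: post)) (hT : G.IsSpanningTree t T) (hw : T v = some w) :
    w ∈ pre := by
  have h1 := h.mem w
  have h2 := (List.pairwise_append.1 h.pairwise).2.1
  rw [List.mem_append, List.mem_cons] at h1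
  rcases h1 with h1 | rfl | h1
  · exact h1
  · exact absurd .refl (hT.irrefl hw)
  · exact absurd hw ((List.pairwise_cons.1 h2).1 w h1)

theorem pos_of_fin (t : Fin n) : 1 ≤ n := by have := t.2; omega

/-- In the given order, the distance of the successor is final when a node is treated, so each node
costs one addition of monomials. -/
theorem distances_meets (hT : G.IsSpanningTree t T) {order : List (Fin n)}
    (ho : IsOrder T order) :
    (G.distances T order).Meets (· = G.dist T) (20 * (n * (k + 1))) (20 * (n * (k + 1))) := by
  have hn := pos_of_fin t
  have h1 : k + 1 ≤ n * (k + 1) := Nat.le_mul_of_pos_left _ hn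
  have h2 : n ≤ n * (k + 1) := Nat.le_mul_of_pos_right _ (Nat.succ_pos k)
  have e1 : n * (2 * k + 1 + 1) = 2 * (n * (k + 1)) := by ring
  have e2 : n * (8 * (k + 1) + 4 + 1) = 8 * (n * (k + 1)) + n * 5 := by ring
  have hlen := ho.length_eq
  refine Meets.bind (tabulate_meets (t := 2 * k + 1) (s := k + 2) (c := k + 1)
    (P := fun _ a => a = 0) (fun _ => zeroM_meets) fun _ _ _ => le_rfl) fun p hp => ?_
  refine (loop_meets (t := 8 * (k + 1) + 4) (s := 8 * (k + 1) + 4) (c := n * (k + 1))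
    (fun l p => ∃ pre, pre ++ l = order ∧ p t = 0 ∧ ∀ v ∈ pre, p v = G.dist T v)
    (fun _ p _ => cells_monomials_le p) ?_ order p ⟨[], rfl, hp t, by simp⟩).mono ?_ ?_ ?_
  · rintro v l p ⟨pre, hpre, hpt, hpv⟩
    have hd : ∀ q : Fin n → TropMonomial k, q t = 0 → (∀ x, x ≠ v → q x = p x) →
        q v = G.dist T v → ∃ pre, pre ++ l = order ∧ q t = 0 ∧ ∀ v ∈ pre, q v = G.dist T v := by
      intro q hqt hq hqv
      refine ⟨pre ++ [v], by simp [hpre], hqt, fun x hx => ?_⟩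
      by_cases hxv : x = v
      · subst hxv; exact hqv
      · rw [hq x hxv]
        exact hpv x (by simpa [hxv] using hx)
    refine Meets.elem_bind ?_
    cases hy : T v with
    | none =>
      have hvt : v = t := by
        by_contra hvt
        obtain ⟨w, hw⟩ := hT.2.1 v hvt
        rw [hw] at hy; cases hy
      subst hvt
      exact Meets.pure (hd p hpt (fun _ _ => rfl) (hpt.trans hT.dist_target.symm))
    | some w =>
      obtain ⟨a, ha⟩ := exists_weight (hT.2.2.1 v w hy)
      refine Meets.elem_bind ?_
      rw [ha]
      refine Meets.elem_bind (Meets.bind (addArc_meets a (p w)) ?_)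
      rintro _ rfl
      refine Meets.elem (hd _ ?_ ?_ ?_)
      · rw [Function.update_of_ne (hT.ne_target hy).symm, hpt]
      · intro x hx; rw [Function.update_of_ne hx]
      · rw [Function.update_self, hT.dist_eq hy, weight_eq ha]
        rw [← hpre] at ho
        rw [hpv w (ho.succ_mem hT hy)]
  · rintro q ⟨pre, hpre, -, hq⟩
    funext v
    rw [List.append_nil] at hpre
    exact hq v (hpre ▸ ho.mem v)
  · rw [hlen]; omega
  · omega

/-! ## Exchange of arcs -/

/-- The stored data belong to a tree. -/
structure IsRecord (G : ParamNetwork n k) (t : Fin n) (e : TreeRecord n k) : Prop where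
  tree : G.IsSpanningTree t e.tree
  order : IsOrder e.tree e.order
  dist : e.dist = G.dist e.tree

/-- `b` marks the nodes whose path passes through `v`. No unmarked node has a marked successor, and
the only new arc leads from the marked node `v` to the unmarked node `w`; so the marked nodes may be
moved to the end. -/
theorem IsOrder.exchange {l : List (Fin n)} (h : IsOrder T l) {v w : Fin n} {b : Fin n → Bool}
    (hb : ∀ u, b u = true ↔ Relation.ReflTransGen (fun x y => T x = some y) u v)
    (hw : b w = false) :
    IsOrder (Function.update T v (some w)) (l.filter (fun u => !b u) ++ l.filter b) := by
  have hperm : (l.filter (fun u => !b u) ++ l.filter b).Perm l :=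
    List.perm_append_comm.trans (List.filter_append_perm b l)
  have hv : b v = true := (hb v).2 .refl
  refine ⟨hperm.nodup_iff.2 h.nodup, fun u => hperm.mem_iff.2 (h.mem u), ?_⟩
  refine List.pairwise_append.2 ⟨?_, ?_, ?_⟩
  · refine (h.pairwise.filter _).imp_of_mem fun {x y} hx _ hxy => ?_
    have hxv : x ≠ v := by
      rintro rfl
      have := (List.mem_filter.1 hx).2
      rw [hv] at this; cases this
    rwa [Function.update_of_ne hxv]
  · refine (h.pairwise.filter _).imp_of_mem fun {x y} _ hy hxy => ?_
    by_cases hxv : x = v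
    · subst hxv
      rw [Function.update_self]
      intro he
      cases he
      have := (List.mem_filter.1 hy).2
      rw [hw] at this; cases this
    · rwa [Function.update_of_ne hxv]
  · intro x hx y hy he
    have hx := (List.mem_filter.1 hx).2
    have hy := (List.mem_filter.1 hy).2
    have hxv : x ≠ v := by
      rintro rfl
      rw [hv] at hx; cases hx
    rw [Function.update_of_ne hxv] at he
    have := (hb x).2 (.head he ((hb y).1 hy))
    rw [this] at hx; cases hx

theorem exchange_meets {e : TreeRecord n k} (he : G.IsRecord t e) {v w : Fin n}
    (hw : ¬ Relation.ReflTransGen (fun x y => e.tree x = some y) w v)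
    (hT' : G.IsSpanningTree t (Function.update e.tree v (some w))) :
    (G.exchange e v w).Meets
      (fun e' => G.IsRecord t e' ∧ e'.tree = Function.update e.tree v (some w))
      (60 * (n * (k + 1))) (80 * (n * (k + 1))) := by
  have hn := pos_of_fin t
  have h2 : n ≤ n * (k + 1) := Nat.le_mul_of_pos_right _ (Nat.succ_pos k)
  have hlen := he.order.length_eq
  refine Meets.bind (tabulate_meets (t := 1) (s := 1) (c := 1) (P := fun _ b => b = false)
    (fun _ => Meets.elem rfl) fun _ _ _ => le_rfl) fun b₀ hb₀ => ?_
  -- A node is marked if it is `v` or if its successor is marked; the latter precedes it in the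
  -- order, so its mark is already known.
  refine Meets.bind (loop_meets (t := 4) (s := 4) (c := n * 1)
    (fun l b => ∃ pre, pre ++ l = e.order ∧ ∀ u, b u = true ↔
      u ∈ pre ∧ Relation.ReflTransGen (fun x y => e.tree x = some y) u v)
    (fun _ b _ => cells_fun_le b fun _ => le_rfl) ?_ e.order b₀ ⟨[], rfl, by simp [hb₀]⟩) ?_
  · rintro u l b ⟨pre, hpre, hb⟩
    have hd : ∀ c : Fin n → Bool, (∀ x, x ≠ u → c x = b x) →
        (c u = true ↔ Relation.ReflTransGen (fun x y => e.tree x = some y) u v) →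
        ∃ pre, pre ++ l = e.order ∧ ∀ u, c u = true ↔
          u ∈ pre ∧ Relation.ReflTransGen (fun x y => e.tree x = some y) u v := by
      intro c hc hcu
      refine ⟨pre ++ [u], by simp [hpre], fun x => ?_⟩
      by_cases hx : x = u
      · subst hx; simp [hcu]
      · rw [hc x hx, hb x]; simp [hx]
    refine Meets.elem_bind (Meets.ite (fun h => Meets.elem (hd _ ?_ ?_)) fun h => ?_)
    · intro x hx; rw [Function.update_of_ne hx]
    · obtain rfl : u = v := by simpa using h
      rw [Function.update_self]
      exact ⟨fun _ => .refl, fun _ => rfl⟩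
    · have huv : u ≠ v := by simpa using h
      have hu : b u = false := by
        rw [Bool.eq_false_iff, Ne, hb]
        rintro ⟨hu, -⟩
        have := he.order.nodup
        rw [← hpre] at this
        exact (List.nodup_append.1 this).2.2 u hu u (by simp) rfl
      refine Meets.elem_bind ?_
      cases hy : e.tree u with
      | none =>
        refine Meets.pure (hd b (fun _ _ => rfl) ?_)
        rw [hu]
        refine ⟨fun h => (Bool.false_ne_true h).elim, fun h => ?_⟩
        rcases h.cases_head with h | ⟨c, hc, -⟩
        · exact absurd h huv
        · rw [hy] at hc; cases hc
      | some x =>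
        refine Meets.elem_bind (Meets.elem (hd _ ?_ ?_))
        · intro x hx; rw [Function.update_of_ne hx]
        · have ho := he.order
          rw [← hpre] at ho
          rw [Function.update_self, hb x]
          refine ⟨fun h => .head hy h.2, fun h => ⟨ho.succ_mem he.tree hy, ?_⟩⟩
          rcases h.cases_head with h | ⟨c, hc, hr⟩
          · exact absurd h huv
          · rw [hy] at hc; cases hc; exact hr
  rintro b ⟨pre, hpre, hb⟩
  rw [List.append_nil] at hpre
  subst hpre
  replace hb : ∀ u, b u = true ↔ Relation.ReflTransGen (fun x y => e.tree x = some y) u v :=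
    fun u => (hb u).trans ⟨fun h => h.2, fun h => ⟨he.order.mem u, h⟩⟩
  -- Pushing to the front reverses both parts; the two later loops restore the original relative
  -- order.
  refine Meets.bind (loop_meets (t := 2) (s := 2) (c := 2 * (1 + n * 2))
    (fun l p => ∃ pre, pre ++ l = e.order ∧
      p = ((pre.filter fun u => !b u).reverse, (pre.filter b).reverse)) ?_ ?_ e.order ([], [])
    ⟨[], rfl, rfl⟩) ?_
  · rintro l _ ⟨pre, hpre, rfl⟩
    have hl : pre.length ≤ n := by
      have := congrArg List.length hpre
      rw [List.length_append] at this; omega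
    have h1 := cells_nodes_le (pre.filter fun u => !b u).reverse
    have h2 := cells_nodes_le (pre.filter b).reverse
    have h3 := List.length_filter_le (fun u => !b u) pre
    have h4 := List.length_filter_le b pre
    rw [List.length_reverse] at h1 h2
    refine le_trans (Nat.add_le_add h1 h2) ?_
    omega
  · rintro u l _ ⟨pre, hpre, rfl⟩
    refine Meets.elem_bind (Meets.ite (fun h => Meets.elem_bind (Meets.pure
      ⟨pre ++ [u], by simp [hpre], ?_⟩)) fun h => Meets.elem_bind (Meets.pure
      ⟨pre ++ [u], by simp [hpre], ?_⟩))
    · simp [h]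
    · simp [h]
  rintro _ ⟨pre, hpre, rfl⟩
  rw [List.append_nil] at hpre
  subst hpre
  have h3 := List.length_filter_le (fun u => !b u) e.order
  have h4 := List.length_filter_le b e.order
  have hsum : (e.order.filter (fun u => !b u) ++ e.order.filter b).length = n := by
    rw [(List.perm_append_comm.trans (List.filter_append_perm b e.order)).length_eq, hlen]
  refine Meets.bind ((reverseList_meets (c := 1) (e.order.filter b).reverse
    fun _ _ => le_rfl).mono (t' := n * 2 + 1) (s' := 2 + n * 2) (fun _ h => h)
      (by rw [List.length_reverse]; omega) (by rw [List.length_reverse]; omega)) ?_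
  rintro _ rfl
  rw [List.reverse_reverse]
  refine Meets.bind ((loop_meets (t := 1) (s := 1) (c := 1 + n * 2)
    (fun l x => l.reverse ++ x = e.order.filter (fun u => !b u) ++ e.order.filter b) ?_ ?_
    (e.order.filter fun u => !b u).reverse (e.order.filter b) (by simp)).mono
      (t' := n * 2 + 1) (s' := 1 + n * 2 + 1) (fun _ h => h)
      (by rw [List.length_reverse]; omega) le_rfl) ?_
  · intro l x hx
    have h1 := cells_nodes_le x
    have h2 := congrArg List.length hx
    rw [hsum, List.length_append] at h2
    omega
  · intro u l x hx
    exact Meets.elem (by simpa using hx)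
  intro order ho
  rw [List.reverse_nil, List.nil_append] at ho
  refine Meets.bind (tabulate_meets (t := 1) (s := 1) (c := 2) (P := fun u x => x = e.tree u)
    (fun _ => Meets.elem rfl) fun _ x _ => cells_option_fin_le x) ?_
  intro copy hcopy
  obtain rfl : copy = e.tree := funext hcopy
  refine Meets.elem_bind ?_
  have hord : IsOrder (Function.update e.tree v (some w)) order := by
    rw [ho]
    exact he.order.exchange hb (by rw [Bool.eq_false_iff, Ne, hb]; exact hw)
  refine Meets.bind (distances_meets hT' hord) ?_
  rintro _ rfl
  exact Meets.pure ⟨⟨hT', hord, rfl⟩, rfl⟩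

/-! ## Lists of arcs -/

/-- The list of all arcs, without repetitions. -/
structure IsArcList (G : ParamNetwork n k) (l : List (Fin n × Fin n × ArcWeight k)) : Prop where
  mem : ∀ e, e ∈ l ↔ G.D e.1 e.2.1 = some e.2.2
  length_le : l.length ≤ G.numArcs

theorem length_le_numArcs {l : List (Fin n × Fin n × ArcWeight k)} (hn : l.Nodup)
    (hl : ∀ e ∈ l, G.D e.1 e.2.1 = some e.2.2) : l.length ≤ G.numArcs := by
  classical
  have hnd : (l.map fun e => (e.1, e.2.1)).Nodup := by
    refine (List.nodup_map_iff_inj_on hn).2 ?_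
    rintro ⟨a, b, x⟩ hx ⟨c, d, y⟩ hy h
    cases h
    have h1 := hl _ hx
    have h2 := hl _ hy
    simp only at h1 h2
    rw [h1] at h2; cases h2; rfl
  rw [← List.length_map (f := fun e => (e.1, e.2.1)), ← List.toFinset_card_of_nodup hnd, numArcs,
    ← Set.ncard_coe_finset]
  refine Set.ncard_le_ncard ?_ (Set.toFinite _)
  intro x hx
  rw [Finset.mem_coe, List.mem_toFinset, List.mem_map] at hx
  obtain ⟨e, he, rfl⟩ := hx
  rw [mem_arcs, hl e he]; simp

theorem cells_arcList_le {l : List (Fin n × Fin n × ArcWeight k)} (hl : l.length ≤ G.numArcs) :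
    Sized.cells l ≤ 1 + G.numArcs * 5 := by
  have := cells_list_le (c := 4) l fun _ _ => le_rfl
  omega

/-- Every matrix entry is read, which costs quadratic time, but only arcs are stored, which keeps
the space linear in `n + m`. -/
theorem listArcs_meets (hn : 1 ≤ n) :
    G.listArcs.Meets G.IsArcList (12 * n ^ 2) (16 * (n + G.numArcs)) := by
  have hn2 : n ≤ n ^ 2 := Nat.le_self_pow (by norm_num) n
  have e1 : n * (n * (2 + 1) + 1 + 1) = 3 * n ^ 2 + n * 2 := by ring
  have hlen : (List.finRange n).length = n := List.length_finRange
  refine (loop_meets (t := n * (2 + 1) + 1) (s := 1 + G.numArcs * 5 + 2) (c := 1 + G.numArcs * 5)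
    (fun rem l => rem.Nodup ∧ l.Nodup ∧
      ∀ e, e ∈ l ↔ G.D e.1 e.2.1 = some e.2.2 ∧ e.1 ∉ rem) ?_ ?_ (List.finRange n) []
      ⟨List.nodup_finRange n, List.nodup_nil, by simp⟩).mono ?_ ?_ ?_
  · rintro rem l ⟨-, h1, h2⟩
    exact cells_arcList_le (length_le_numArcs h1 fun e he => ((h2 e).1 he).1)
  · rintro v rem l ⟨hrem, h1, h2⟩
    obtain ⟨hv, hrem⟩ := List.nodup_cons.1 hrem
    refine (loop_meets (t := 2) (s := 2) (c := 1 + G.numArcs * 5)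
      (fun rem' l => rem'.Nodup ∧ l.Nodup ∧ ∀ e, e ∈ l ↔ G.D e.1 e.2.1 = some e.2.2 ∧
        (e.1 ∉ v :: rem ∨ (e.1 = v ∧ e.2.1 ∉ rem'))) ?_ ?_ (List.finRange n) l
        ⟨List.nodup_finRange n, h1, by simpa using h2⟩).mono ?_ ?_ ?_
    · rintro rem' l ⟨-, h1, h2⟩
      exact cells_arcList_le (length_le_numArcs h1 fun e he => ((h2 e).1 he).1)
    · rintro w rem' l ⟨hrem', h1, h2⟩
      obtain ⟨hw, hrem'⟩ := List.nodup_cons.1 hrem'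
      refine Meets.elem_bind ?_
      cases hD : G.D v w with
      | none =>
        refine Meets.pure ⟨hrem', h1, fun e => ?_⟩
        rw [h2 e]
        refine and_congr_right fun he => or_congr_right (and_congr_right fun hev => ?_)
        have : e.2.1 ≠ w := by
          intro h; rw [hev, h, hD] at he; cases he
        simp [this]
      | some a =>
        refine Meets.elem ⟨hrem', List.nodup_cons.2 ⟨?_, h1⟩, fun e => ?_⟩
        · rw [h2]; simp
        · rw [List.mem_cons, h2 e]
          constructor
          · rintro (rfl | ⟨he, h | ⟨h, h'⟩⟩)
            · exact ⟨hD, Or.inr ⟨rfl, hw⟩⟩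
            · exact ⟨he, Or.inl h⟩
            · exact ⟨he, Or.inr ⟨h, fun h'' => h' (List.mem_cons_of_mem _ h'')⟩⟩
          · rintro ⟨he, h | ⟨h, h'⟩⟩
            · exact Or.inr ⟨he, Or.inl h⟩
            · by_cases hew : e.2.1 = w
              · left
                obtain ⟨x, y, b⟩ := e
                simp only at h hew he
                subst h hew
                rw [hD] at he
                cases he; rfl
              · exact Or.inr ⟨he, Or.inr ⟨h, by simp [hew, h']⟩⟩
    · rintro l ⟨-, h1, h2⟩
      refine ⟨hrem, h1, fun e => ?_⟩
      rw [h2]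
      refine and_congr_right fun _ => ?_
      by_cases hev : e.1 = v
      · simp [hev, hv]
      · simp [hev]
    · rw [hlen]
    · omega
  · rintro l ⟨-, h1, h2⟩
    exact ⟨fun e => by simpa using h2 e, length_le_numArcs h1 fun e he => ((h2 e).1 he).1⟩
  · rw [hlen]; omega
  · omega

theorem checkTree_meets (hB : G.NonnegBounds) {l : List (Fin n × Fin n × ArcWeight k)}
    (hl : G.IsArcList l) (hT : G.IsSpanningTree t T) :
    (G.checkTree l (G.dist T)).Meets (fun b => b = true ↔ G.IsShortestPathTree t T)
      (40 * (G.numArcs * (k + 1)) + 1) (60 * (k + 1)) := by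
  have e1 : G.numArcs * (36 * (k + 1) + 1) = 36 * (G.numArcs * (k + 1)) + G.numArcs := by ring
  have h2 : G.numArcs ≤ G.numArcs * (k + 1) := Nat.le_mul_of_pos_right _ (Nat.succ_pos k)
  have hlen : l.length * (36 * (k + 1) + 1) ≤ G.numArcs * (36 * (k + 1) + 1) :=
    Nat.mul_le_mul_right _ hl.length_le
  refine (loop_meets (t := 36 * (k + 1)) (s := 8 * (k + 1) + 43) (c := 1)
    (fun r ok => (ok = true ∧ ∀ a ∈ r,
      ¬ G.LT (a.2.2.toMonomial + G.dist T a.2.1) (G.dist T a.1)) ↔ ∀ a ∈ l,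
      ¬ G.LT (a.2.2.toMonomial + G.dist T a.2.1) (G.dist T a.1))
    (fun _ _ _ => le_rfl) ?_ l true (by simp)).mono ?_ ?_ ?_
  · rintro a r ok hok
    refine Meets.elem_bind (Meets.elem_bind (Meets.bind (addArc_meets _ _) ?_))
    rintro _ rfl
    refine Meets.bind (leM_meets hB _ _) fun x hx => ?_
    refine Meets.bind (leM_meets hB _ _) fun y hy => Meets.elem ?_
    rw [← hok, List.forall_mem_cons, ← and_assoc]
    refine and_congr_left fun _ => ?_
    rw [Bool.and_eq_true]
    refine and_congr_right fun _ => ?_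
    rw [LT, ← hx, ← hy]
    cases x <;> cases y <;> simp
  · intro ok hok
    simp only [List.not_mem_nil, false_implies, implies_true, and_true] at hok
    rw [hok]
    constructor
    · intro h
      refine ⟨hT, fun v w hvw => ?_⟩
      obtain ⟨a, ha⟩ := exists_weight hvw
      rw [weight_eq ha]
      exact h (v, w, a) ((hl.mem (v, w, a)).2 ha)
    · rintro h ⟨v, w, a⟩ ha
      have ha := (hl.mem (v, w, a)).1 ha
      have := h.2 v w (by rw [mem_arcs, ha]; simp)
      rwa [weight_eq ha] at this
  · omega
  · omega

end ParamNetwork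

open Metered

/-! ## Dictionaries -/

namespace Dictionary

variable {n : ℕ} {T : SuccMap n} {A : Fin n → Finset (Option (Fin n))}

/-- Does the dictionary contain the word `T` on the given positions? -/
def Contains (T : SuccMap n) : Dictionary n → List (Fin n) → Prop
  | _, [] => True
  | empty, _ :: _ => False
  | node x c a, v :: l => (x = T v ∧ Contains T c l) ∨ (x ≠ T v ∧ Contains T a (v :: l))

/-- The letters that are allowed at the first position. -/
def headLetters (A : Fin n → Finset (Option (Fin n))) : List (Fin n) → Finset (Option (Fin n))
  | [] => ∅
  | v :: _ => A v

/-- The alternatives at each position `v` are pairwise distinct and belong to `A v`; at the first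
position they belong to `S`. -/
def Trie (A : Fin n → Finset (Option (Fin n))) :
    Dictionary n → List (Fin n) → Finset (Option (Fin n)) → Prop
  | empty, _, _ => True
  | node _ _ _, [], _ => True
  | node x c a, v :: l, S => x ∈ S ∧ Trie A c l (headLetters A l) ∧ Trie A a (v :: l) (S.erase x)

/-- A bound for the number of nodes that are inspected while searching for a word. -/
def searchBound (A : Fin n → Finset (Option (Fin n))) (l : List (Fin n))
    (S : Finset (Option (Fin n))) : ℕ :=
  S.card + (l.tail.map fun v => (A v).card).sum

theorem searchBound_headLetters (l : List (Fin n)) :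
    searchBound A l (headLetters A l) = (l.map fun v => (A v).card).sum := by
  cases l <;> simp [searchBound, headLetters]

theorem searchBound_cons (v : Fin n) (l : List (Fin n)) (S : Finset (Option (Fin n))) :
    searchBound A (v :: l) S = S.card + searchBound A l (headLetters A l) := by
  rw [searchBound_headLetters]; rfl

/-- A failed comparison removes a letter from the alternatives at the current position, and a
successful one moves to the next position. The total number of available letters bounds the search.
-/
theorem lookup_meets (T : SuccMap n) (d : Dictionary n) (l : List (Fin n))
    (S : Finset (Option (Fin n))) (h : d.Trie A l S) :
    (d.lookup T l).Meets (fun b => b = true ↔ d.Contains T l) (3 * searchBound A l S + 3)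
      (3 * searchBound A l S + 3) := by
  induction d generalizing l S with
  | empty =>
    cases l with
    | nil => exact Meets.elem (by simp [Contains])
    | cons v l => exact Meets.elem (by simp [Contains])
  | node x c a ihc iha =>
    cases l with
    | nil => exact Meets.elem (by simp [Contains])
    | cons v l =>
      obtain ⟨hx, hc, ha⟩ := h
      have hcard := Finset.card_erase_add_one hx
      have e1 := searchBound_cons (A := A) v l S
      have e2 := searchBound_cons (A := A) v l (S.erase x)
      refine Meets.elem_bind (Meets.elem_bind (Meets.ite (fun h => ?_) fun h => ?_))
      · have h : x = T v := by simpa using h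
        refine (ihc l _ hc).mono (fun b hb => ?_) (by omega) (by omega)
        rw [hb]; simp [Contains, h]
      · have h : x ≠ T v := by simpa using h
        refine (iha (v :: l) _ ha).mono (fun b hb => ?_) (by omega) (by omega)
        rw [hb]; simp [Contains, h]

theorem single_meets (hT : ∀ v, T v ∈ A v) (l : List (Fin n)) (S : Finset (Option (Fin n)))
    (hS : ∀ v ∈ l.head?, T v ∈ S) :
    (single T l).Meets (fun d => d.Trie A l S ∧
      (∀ U : SuccMap n, d.Contains U l ↔ ∀ v ∈ l, U v = T v) ∧ d.size ≤ 1 + 4 * l.length)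
      (3 * l.length + 1) (3 * l.length + 1) := by
  induction l generalizing S with
  | nil => exact Meets.elem ⟨trivial, by simp [Contains], by simp [size]⟩
  | cons v l ih =>
    have h1 := ih (headLetters A l) fun u hu => by
      cases l with
      | nil => cases hu
      | cons w l => cases hu; exact hT _
    have hl : (v :: l).length = l.length + 1 := rfl
    refine Meets.elem_bind (Meets.bind h1 ?_)
    rintro c ⟨hc1, hc2, hc3⟩
    refine Meets.elem_bind (Meets.elem ⟨⟨hS v rfl, hc1, trivial⟩, fun U => ?_, ?_⟩)
    · simp only [Contains, hc2, and_false, or_false, List.forall_mem_cons, eq_comm (a := T v)]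
    · simp only [size, List.length_cons]; omega

/-- The search follows the common prefix and then attaches a fresh chain. Each new position adds a
node of size `3` and an empty alternative of size `1`. -/
theorem insert_meets (hT : ∀ v, T v ∈ A v) (d : Dictionary n) (l : List (Fin n))
    (S : Finset (Option (Fin n))) (h : d.Trie A l S) (hS : ∀ v ∈ l.head?, T v ∈ S) :
    (d.insert T l).Meets (fun d' => d'.Trie A l S ∧
      (∀ U : SuccMap n, d'.Contains U l ↔ (∀ v ∈ l, U v = T v) ∨ d.Contains U l) ∧
      d'.size ≤ d.size + 4 * l.length)
      (3 * searchBound A l S + 3) (3 * searchBound A l S + 3) := by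
  induction d generalizing l S with
  | empty =>
    cases l with
    | nil => exact Meets.elem ⟨h, by simp [Contains], by simp⟩
    | cons v l =>
      have hlen : l.length ≤ (l.map fun v => (A v).card).sum := by
        have := List.card_nsmul_le_sum (l.map fun v => (A v).card) 1 (by
          intro x hx
          obtain ⟨u, -, rfl⟩ := List.mem_map.1 hx
          exact Finset.card_pos.2 ⟨_, hT u⟩)
        simpa using this
      have hpos : 0 < S.card := Finset.card_pos.2 ⟨_, hS v rfl⟩
      have e1 := searchBound_cons (A := A) v l S
      rw [searchBound_headLetters] at e1
      have hl : (v :: l).length = l.length + 1 := rfl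
      refine (single_meets hT (v :: l) S hS).mono ?_ (by omega) (by omega)
      rintro d ⟨h1, h2, h3⟩
      exact ⟨h1, fun U => by rw [h2]; simp [Contains], h3⟩
  | node x c a ihc iha =>
    cases l with
    | nil => exact Meets.elem ⟨h, by simp [Contains], by simp⟩
    | cons v l =>
      obtain ⟨hx, hc, ha⟩ := h
      have hcard := Finset.card_erase_add_one hx
      have e1 := searchBound_cons (A := A) v l S
      have e2 := searchBound_cons (A := A) v l (S.erase x)
      refine Meets.elem_bind (Meets.elem_bind (Meets.ite (fun h => ?_) fun h => ?_))
      · have h : x = T v := by simpa using h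
        refine Meets.bind (ihc l _ hc fun u hu => ?_) ?_
        · cases l with
          | nil => cases hu
          | cons w l => cases hu; exact hT _
        · rintro c' ⟨h1, h2, h3⟩
          refine Meets.elem ⟨⟨hx, h1, ha⟩, fun U => ?_, ?_⟩
          · by_cases hU : x = U v
            · have hUT : U v = T v := hU.symm.trans h
              simp only [Contains, hU, h2, List.forall_mem_cons]
              simp [hUT]
            · have hUT : U v ≠ T v := fun h' => hU (h.trans h'.symm)
              simp [Contains, hU, hUT]
          · simp only [size, List.length_cons]; omega
      · have h : x ≠ T v := by simpa using h
        refine Meets.bind (iha (v :: l) _ ha fun u hu => ?_) ?_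
        · cases hu
          exact Finset.mem_erase.2 ⟨h.symm, hS v rfl⟩
        · rintro a' ⟨h1, h2, h3⟩
          refine Meets.elem ⟨⟨hx, hc, h1⟩, fun U => ?_, ?_⟩
          · by_cases hU : x = U v
            · have hUT : U v ≠ T v := fun h' => h (hU.trans h')
              simp [Contains, hU, hUT]
            · simp only [Contains, hU, h2, false_and, not_false_eq_true, true_and, false_or, ne_eq]
          · simp only [size, List.length_cons] at h3 ⊢; omega

end Dictionary

namespace ParamNetwork

variable {n k : ℕ} {G : ParamNetwork n k} {t : Fin n} {T U : SuccMap n}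

open Metered

/-! ## Dijkstra's algorithm -/

variable (G) in
/-- The weight of an arc at the lower bounds. -/
noncomputable def loWeight (u v : Fin n) : WithTop ℝ := ((G.weight u v).eval G.lo : ℝ)

theorem Generic.loWeight_pos (hB : G.NonnegBounds) (hG : G.Generic) {u v : Fin n}
    (h : (u, v) ∈ G.arcs) : 0 < G.loWeight u v :=
  WithTop.coe_pos.2 (hG.weight_pos hB h (lo_mem_box hB))

/-- The invariant of Dijkstra's algorithm. -/
structure IsDijkstraState (G : ParamNetwork n k) (t : Fin n) (s : DijkstraState n) : Prop where
  settled_iff : ∀ v, s.settled v = true ↔ v ∈ s.order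
  nodup : s.order.Nodup
  target : s.label t = (0, none)
  nonneg : ∀ v, 0 ≤ (s.label v).1
  succ : ∀ v w, (s.label v).2 = some w →
    (v, w) ∈ G.arcs ∧ w ∈ s.order ∧ (s.label v).1 = G.loWeight v w + (s.label w).1
  eq_top : ∀ v, v ≠ t → (s.label v).2 = none → (s.label v).1 = ⊤
  ne_top : ∀ v ∈ s.order, (s.label v).1 ≠ ⊤
  feasible : ∀ v w, (v, w) ∈ G.arcs → w ∈ s.order →
    (s.label v).1 ≤ G.loWeight v w + (s.label w).1
  mono : ∀ v ∈ s.order, ∀ u, u ∉ s.order → (s.label v).1 ≤ (s.label u).1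
  pairwise : s.order.Pairwise fun b a => (s.label a).2 ≠ some b

/-- The relation between the old and the new label of `u` when `v` is settled. -/
def IsUpdatedLabel (G : ParamNetwork n k) (s : DijkstraState n) (v u : Fin n)
    (l : WithTop ℝ × Option (Fin n)) : Prop :=
  (l = s.label u ∧ ((u, v) ∈ G.arcs → s.settled u = false →
      (s.label u).1 ≤ G.loWeight u v + (s.label v).1)) ∨
    ((u, v) ∈ G.arcs ∧ s.settled u = false ∧ G.loWeight u v + (s.label v).1 < (s.label u).1 ∧
      l = (G.loWeight u v + (s.label v).1, some v))

/-- Arc weights are positive and `v` has the smallest open label, so no label drops below that of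
`v`. Settled labels stay fixed, and arcs from settled nodes to `v` are feasible by monotonicity. -/
theorem IsDijkstraState.settle (hB : G.NonnegBounds) (hG : G.Generic) {s : DijkstraState n}
    (hs : G.IsDijkstraState t s) {v : Fin n} (hv : v ∉ s.order) (hvt : (s.label v).1 ≠ ⊤)
    (hmin : ∀ u, u ∉ s.order → (s.label v).1 ≤ (s.label u).1)
    {label : Fin n → WithTop ℝ × Option (Fin n)} (hl : ∀ u, G.IsUpdatedLabel s v u (label u)) :
    G.IsDijkstraState t ⟨label, Function.update s.settled v true, v :: s.order⟩ := by
  have hsettled : ∀ u, s.settled u = false ↔ u ∉ s.order := fun u => by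
    rw [← hs.settled_iff, Bool.not_eq_true]
  have hle : ∀ u, (u, v) ∈ G.arcs → (s.label v).1 ≤ G.loWeight u v + (s.label v).1 := fun u hu =>
    le_add_of_nonneg_left (hG.loWeight_pos hB hu).le
  have hold : ∀ u ∈ s.order, label u = s.label u := by
    intro u hu
    rcases hl u with h | ⟨-, h, -⟩
    · exact h.1
    · exact absurd hu ((hsettled u).1 h)
  have hlv : label v = s.label v := by
    rcases hl v with h | ⟨h1, -, h, -⟩
    · exact h.1
    · exact absurd h (not_lt.2 (hle v h1))
  have hdec : ∀ u, (label u).1 ≤ (s.label u).1 := by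
    intro u
    rcases hl u with h | ⟨-, -, h, h'⟩
    · rw [h.1]
    · rw [h']; exact h.le
  have hlow : ∀ u, ∀ x : WithTop ℝ, x ≤ (s.label u).1 → x ≤ (s.label v).1 → x ≤ (label u).1 := by
    intro u x hx hx'
    rcases hl u with h | ⟨h1, -, h, h'⟩
    · rw [h.1]; exact hx
    · rw [h']; exact hx'.trans (hle u h1)
  refine ⟨?_, List.nodup_cons.2 ⟨hv, hs.nodup⟩, ?_, ?_, ?_, ?_, ?_, ?_, ?_, ?_⟩
  · intro u
    simp only [List.mem_cons]
    by_cases huv : u = v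
    · subst huv; simp
    · rw [Function.update_of_ne huv, hs.settled_iff]; simp [huv]
  · rcases hl t with h | ⟨h1, -, h, -⟩
    · exact h.1.trans hs.target
    · rw [hs.target] at h
      exact absurd h (not_lt.2 ((hs.nonneg v).trans (hle t h1)))
  · exact fun u => hlow u 0 (hs.nonneg u) (hs.nonneg v)
  · intro u w hw
    simp only at hw ⊢
    rcases hl u with h | ⟨h1, -, -, h⟩
    · rw [h.1] at hw ⊢
      obtain ⟨h1, h2, h3⟩ := hs.succ u w hw
      exact ⟨h1, List.mem_cons_of_mem _ h2, by rw [hold w h2]; exact h3⟩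
    · rw [h] at hw ⊢
      cases hw
      exact ⟨h1, List.mem_cons_self, by rw [hlv]⟩
  · intro u hu hn
    simp only at hn ⊢
    rcases hl u with h | ⟨-, -, -, h⟩
    · rw [h.1] at hn ⊢; exact hs.eq_top u hu hn
    · rw [h] at hn; cases hn
  · intro u hu
    rcases List.mem_cons.1 hu with rfl | hu
    · simp only [hlv]; exact hvt
    · simp only [hold u hu]; exact hs.ne_top u hu
  · intro u w huw hw
    rcases List.mem_cons.1 hw with rfl | hw
    · simp only [hlv]
      rcases hl u with h | ⟨-, -, -, h⟩
      · rw [h.1]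
        by_cases hu : u ∈ s.order
        · exact (hs.mono u hu w hv).trans (hle u huw)
        · exact h.2 huw ((hsettled u).2 hu)
      · rw [h]
    · simp only [hold w hw]
      exact (hdec u).trans (hs.feasible u w huw hw)
  · intro x hx u hu
    simp only [List.mem_cons, not_or] at hu
    rcases List.mem_cons.1 hx with rfl | hx
    · simp only [hlv]
      exact hlow u _ (hmin u hu.2) le_rfl
    · simp only [hold x hx]
      exact hlow u _ (hs.mono x hx u hu.2) (hs.mono x hx v hv)
  -- A settled node has its first arc into the old settled set, which does not contain `v`; this
  -- makes the reversed list an order for the tree.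
  · refine List.pairwise_cons.2 ⟨fun u hu h => ?_, hs.pairwise.imp_of_mem ?_⟩
    · simp only [hold u hu] at h
      exact hv (hs.succ u v h).2.1
    · intro b a _ ha h
      simp only [hold a ha]; exact h

theorem minWeight_meets (a : ArcWeight k) :
    (G.minWeight a).Meets (· = a.toMonomial.eval G.lo) 1 1 := by
  cases a with
  | const c => exact Meets.elem (by simp)
  | var i => exact Meets.elem (by simp)

theorem cells_dijkstraState_le (s : DijkstraState n) (h : s.order.length ≤ n) :
    Sized.cells s ≤ 1 + 6 * n := by
  have h1 : Sized.cells s.label ≤ n * 3 :=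
    cells_fun_le _ fun i => Nat.add_le_add_left (cells_option_fin_le (s.label i).2) 1
  have h2 : Sized.cells s.settled ≤ n * 1 := cells_fun_le _ fun _ => le_rfl
  have h3 := cells_nodes_le s.order
  exact (Nat.add_le_add (Nat.add_le_add h1 h2) h3).trans (by omega)

theorem IsDijkstraState.length_le {s : DijkstraState n} (hs : G.IsDijkstraState t s) :
    s.order.length ≤ n := by
  simpa using hs.nodup.length_le_card

/-- The alternative in the conclusion measures progress: one more node is settled, or all open
labels are infinite and nothing changes from then on. -/
theorem dijkstraRound_meets (hB : G.NonnegBounds) (hG : G.Generic) {s : DijkstraState n}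
    (hs : G.IsDijkstraState t s) :
    (G.dijkstraRound s).Meets (fun s' => G.IsDijkstraState t s' ∧
      ((s'.order.length = s.order.length + 1 ∧ ∃ u, u ∉ s.order ∧ (s.label u).1 ≠ ⊤) ∨
        ∀ u, u ∉ s'.order → (s'.label u).1 = ⊤))
      (30 * n) (40 * n) := by
  have hn := pos_of_fin t
  have hlen : (List.finRange n).length = n := List.length_finRange
  have hsettled : ∀ u, s.settled u = false ↔ u ∉ s.order := fun u => by
    rw [← hs.settled_iff, Bool.not_eq_true]
  refine Meets.bind (loop_meets (t := 8) (s := 8) (c := 2)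
    (fun l b => ∃ pre, pre ++ l = List.finRange n ∧
      (∀ v, b = some v → v ∉ s.order ∧ (s.label v).1 ≠ ⊤) ∧
      ∀ u ∈ pre, u ∉ s.order → (s.label u).1 ≠ ⊤ →
        ∃ v, b = some v ∧ (s.label v).1 ≤ (s.label u).1)
    (fun _ b _ => cells_option_fin_le b) ?_ (List.finRange n) none
    ⟨[], rfl, by simp, by simp⟩) ?_
  · rintro u l b ⟨pre, hpre, hb1, hb2⟩
    have hd : ∀ c : Option (Fin n), (∀ v, c = some v → v ∉ s.order ∧ (s.label v).1 ≠ ⊤) →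
        (∀ v, b = some v → ∃ v', c = some v' ∧ (s.label v').1 ≤ (s.label v).1) →
        (u ∉ s.order → (s.label u).1 ≠ ⊤ → ∃ v, c = some v ∧ (s.label v).1 ≤ (s.label u).1) →
        ∃ pre, pre ++ l = List.finRange n ∧
          (∀ v, c = some v → v ∉ s.order ∧ (s.label v).1 ≠ ⊤) ∧
          ∀ u ∈ pre, u ∉ s.order → (s.label u).1 ≠ ⊤ →
            ∃ v, c = some v ∧ (s.label v).1 ≤ (s.label u).1 := by
      intro c hc1 hc2 hc3
      refine ⟨pre ++ [u], by simp [hpre], hc1, fun x hx hx1 hx2 => ?_⟩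
      rcases List.mem_append.1 hx with hx | hx
      · obtain ⟨v, hv, hle⟩ := hb2 x hx hx1 hx2
        obtain ⟨v', hv', hle'⟩ := hc2 v hv
        exact ⟨v', hv', hle'.trans hle⟩
      · obtain rfl : x = u := by simpa using hx
        exact hc3 hx1 hx2
    refine Meets.elem_bind (Meets.elem_bind (Meets.elem_bind (Meets.ite (fun h => ?_) fun h => ?_)))
    · refine Meets.pure (hd b hb1 (fun v hv => ⟨v, hv, le_rfl⟩) fun h1 h2 => ?_)
      rw [← hsettled] at h1
      simp [h1, h2] at h
    · have h' : u ∉ s.order ∧ (s.label u).1 ≠ ⊤ := by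
        rw [← hsettled]
        simpa using h
      cases b with
      | none =>
        refine Meets.elem (hd _ ?_ (by simp) fun _ _ => ⟨u, rfl, le_rfl⟩)
        rintro v hv; cases hv; exact h'
      | some v =>
        refine Meets.elem_bind (Meets.elem_bind (Meets.ite (fun h => ?_) fun h => ?_))
        · have hlt : (s.label u).1 < (s.label v).1 := by simpa using h
          refine Meets.elem (hd _ ?_ ?_ fun _ _ => ⟨u, rfl, le_rfl⟩)
          · rintro v hv; cases hv; exact h'
          · rintro v' hv'; cases hv'; exact ⟨u, rfl, hlt.le⟩
        · have hle : (s.label v).1 ≤ (s.label u).1 := by simpa using h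
          exact Meets.pure (hd _ hb1 (fun v' hv' => ⟨v', hv', le_rfl⟩)
            fun _ _ => ⟨v, rfl, hle⟩)
  rintro b ⟨pre, hpre, hb1, hb2⟩
  rw [List.append_nil] at hpre
  subst hpre
  cases b with
  | none =>
    refine Meets.pure ⟨hs, Or.inr fun u hu => ?_⟩
    by_contra hne
    obtain ⟨v, hv, -⟩ := hb2 u (List.mem_finRange u) hu hne
    cases hv
  | some v =>
    obtain ⟨hv, hvt⟩ := hb1 v rfl
    have hmin : ∀ u, u ∉ s.order → (s.label v).1 ≤ (s.label u).1 := by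
      intro u hu
      by_cases hut : (s.label u).1 = ⊤
      · rw [hut]; exact le_top
      · obtain ⟨v', hv', hle⟩ := hb2 u (List.mem_finRange u) hu hut
        cases hv'; exact hle
    refine Meets.elem_bind ?_
    refine Meets.bind (tabulate_meets (t := 7) (s := 7) (c := 3)
      (P := fun u l => G.IsUpdatedLabel s v u l) (fun u => ?_)
      fun _ a _ => Nat.add_le_add_left (cells_option_fin_le a.2) 1) fun label hl => ?_
    · refine Meets.elem_bind (Meets.elem_bind (Meets.elem_bind ?_))
      cases hD : G.D u v with
      | none => exact Meets.pure (Or.inl ⟨rfl, fun h => absurd hD h⟩)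
      | some a =>
        have harc : (u, v) ∈ G.arcs := by rw [mem_arcs, hD]; simp
        have hw : G.loWeight u v = ((a.toMonomial.eval G.lo : ℝ) : WithTop ℝ) := by
          rw [loWeight, weight_eq hD]
        refine Meets.bind (minWeight_meets a) ?_
        rintro _ rfl
        rw [← hw]
        refine Meets.elem_bind (Meets.elem_bind (Meets.ite (fun h => ?_) fun h => ?_))
        · rw [Bool.and_eq_true, decide_eq_true_iff, Bool.not_eq_true'] at h
          exact Meets.elem (Or.inr ⟨harc, h.2, h.1, rfl⟩)
        · refine Meets.pure (Or.inl ⟨rfl, fun _ hu => ?_⟩)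
          by_contra hlt
          rw [Bool.and_eq_true, decide_eq_true_iff, Bool.not_eq_true'] at h
          exact h ⟨not_le.1 hlt, hu⟩
    · refine Meets.elem_bind (Meets.elem_bind (Meets.pure ⟨?_, Or.inl ⟨rfl, v, hv, hvt⟩⟩))
      exact hs.settle hB hG hv hvt hmin hl

theorem dijkstra_meets (hB : G.NonnegBounds) (hG : G.Generic) (t : Fin n) :
    (G.dijkstra t).Meets (fun s => G.IsDijkstraState t s ∧
      ∀ u, u ∉ s.order → (s.label u).1 = ⊤) (50 * n ^ 2) (80 * n) := by
  have hn := pos_of_fin t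
  have hn2 : n ≤ n ^ 2 := Nat.le_self_pow (by norm_num) n
  have e1 : n * (30 * n + 1) = 30 * n ^ 2 + n := by ring
  have hlen : (List.finRange n).length = n := List.length_finRange
  refine Meets.bind (tabulate_meets (t := 2) (s := 2) (c := 3)
    (P := fun v l => l = if v = t then ((0 : WithTop ℝ), none) else (⊤, none))
    (fun v => Meets.elem_bind (Meets.ite (fun h => Meets.elem ?_) fun h => Meets.elem ?_))
    fun _ a _ => Nat.add_le_add_left (cells_option_fin_le a.2) 1) fun label hl => ?_
  · rw [if_pos (by simpa using h)]
  · rw [if_neg (by simpa using h)]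
  refine Meets.bind (tabulate_meets (t := 1) (s := 1) (c := 1) (P := fun _ b => b = false)
    (fun _ => Meets.elem rfl) fun _ _ _ => le_rfl) fun settled hst => ?_
  have hinit : G.IsDijkstraState t ⟨label, settled, []⟩ := by
    refine ⟨by simp [hst], List.nodup_nil, by simp [hl], ?_, ?_, ?_, by simp, by simp, by simp,
      List.Pairwise.nil⟩
    · intro v
      simp only [hl]
      split_ifs
      · exact le_rfl
      · exact le_top
    · intro v w hw
      simp only [hl] at hw
      split_ifs at hw
    · intro v hv _
      simp [hl, hv]
  refine (loop_meets (t := 30 * n) (s := 40 * n) (c := 1 + 6 * n)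
    (fun l s => G.IsDijkstraState t s ∧
      (s.order.length + l.length = n ∨ ∀ u, u ∉ s.order → (s.label u).1 = ⊤))
    (fun _ s hs => cells_dijkstraState_le s hs.1.length_le) ?_ (List.finRange n) _
    ⟨hinit, Or.inl (by simp)⟩).mono ?_ ?_ ?_
  · rintro a l s ⟨hs, h⟩
    refine (dijkstraRound_meets hB hG hs).mono ?_ le_rfl le_rfl
    rintro s' ⟨hs', h'⟩
    refine ⟨hs', ?_⟩
    rcases h' with ⟨h', u, hu, hut⟩ | h'
    · rcases h with h | h
      · left; rw [List.length_cons] at h; omega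
      · exact absurd (h u hu) hut
    · exact Or.inr h'
  · rintro s ⟨hs, h⟩
    refine ⟨hs, ?_⟩
    rcases h with h | h
    · intro u hu
      have h1 : (u :: s.order).length ≤ n := by
        simpa using (List.nodup_cons.2 ⟨hu, hs.nodup⟩).length_le_card
      simp at h h1
      omega
    · exact h
  · rw [hlen]; omega
  · omega

/-! ### The resulting tree -/

/-- Going back along a walk from `t`, the tail of an arc into a settled node has a finite label by
feasibility, so at the end it must be settled. -/
theorem IsDijkstraState.mem_order {s : DijkstraState n} (hs : G.IsDijkstraState t s)
    (hs' : ∀ u, u ∉ s.order → (s.label u).1 = ⊤) {v : Fin n}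
    (h : Relation.ReflTransGen (fun a b => (a, b) ∈ G.arcs) v t) : v ∈ s.order := by
  refine Relation.ReflTransGen.head_induction_on h ?_ ?_
  · by_contra ht
    have := hs' t ht
    rw [hs.target] at this
    exact WithTop.zero_ne_top this
  · intro a c hac _ hc
    by_contra ha
    have h1 := hs.feasible a c hac hc
    rw [hs' a ha, top_le_iff, WithTop.add_eq_top] at h1
    exact h1.elim WithTop.coe_ne_top (hs.ne_top c hc)

/-- Once all nodes are settled, the labels are a finite feasible potential at the lower corner that
is tight on the chosen arcs, hence equal to the tree distances. -/
theorem IsDijkstraState.tree (hB : G.NonnegBounds) (hG : G.Generic) {s : DijkstraState n}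
    (hs : G.IsDijkstraState t s) (hlen : s.order.length = n) :
    G.IsSpanningTree t (fun v => (s.label v).2) ∧ G.lo ∈ G.cell (fun v => (s.label v).2) ∧
      IsOrder (fun v => (s.label v).2) s.order.reverse := by
  have hall : ∀ v, v ∈ s.order := by
    intro v
    by_contra hv
    have h1 : (v :: s.order).length ≤ n := by
      simpa using (List.nodup_cons.2 ⟨hv, hs.nodup⟩).length_le_card
    simp [hlen] at h1
  have hreal : ∀ v, ∃ x : ℝ, (s.label v).1 = x := fun v =>
    ⟨_, (WithTop.coe_untop _ (hs.ne_top v (hall v))).symm⟩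
  choose φ hφ using hreal
  have hφt : φ t = 0 := by
    have := hφ t
    rw [hs.target] at this
    exact (WithTop.coe_eq_coe.1 this).symm
  have hsucc : ∀ v w, (s.label v).2 = some w →
      (v, w) ∈ G.arcs ∧ φ v = (G.weight v w).eval G.lo + φ w := by
    intro v w h
    obtain ⟨h1, -, h2⟩ := hs.succ v w h
    rw [hφ, hφ] at h2
    exact ⟨h1, WithTop.coe_eq_coe.1 h2⟩
  have hT : G.IsSpanningTree t (fun v => (s.label v).2) := by
    refine isSpanningTree_of_decreasing φ (by simp [hs.target]) ?_ (fun v w h => (hsucc v w h).1) ?_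
    · intro v hv
      refine Option.ne_none_iff_exists'.1 fun hn => ?_
      exact hs.ne_top v (hall v) (hs.eq_top v hv hn)
    · intro v w h
      have h1 := hsucc v w h
      have h2 := hG.weight_pos hB h1.1 (lo_mem_box hB)
      linarith
  have hd := hT.dist_eq_potential hφt fun v w h => (hsucc v w h).2
  refine ⟨hT, mem_cell_iff.2 ⟨lo_mem_box hB, fun v w h => ?_⟩, ?_⟩
  · have := hs.feasible v w h (hall w)
    rw [hφ, hφ] at this
    rw [hd, hd]
    exact WithTop.coe_le_coe.1 this
  · exact ⟨List.nodup_reverse.2 hs.nodup, fun v => List.mem_reverse.2 (hall v),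
      List.pairwise_reverse.2 hs.pairwise⟩

end ParamNetwork

namespace ParamNetwork

variable {n k : ℕ} {G : ParamNetwork n k} {t : Fin n} {T U : SuccMap n}

open Metered

/-! ## Neighbors in the graph of shortest-path trees -/

theorem dist_le_of_reflTransGen (hB : G.NonnegBounds) (hG : G.Generic)
    (hT : G.IsSpanningTree t T) {z : Fin k → ℝ} (hz : z ∈ G.box) {v w : Fin n}
    (h : Relation.ReflTransGen (fun x y => T x = some y) w v) :
    (G.dist T v).eval z ≤ (G.dist T w).eval z := by
  induction h with
  | refl => exact le_rfl
  | tail _ h ih => exact (hG.dist_lt hB hT hz h).le.trans ih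

/-- Incomparability provides a point at which the path through `w` is strictly shorter. There `w` is
closer to the target than `v`, so it does not lie below `v`. -/
theorem Generic.exchange (hB : G.NonnegBounds) (hG : G.Generic) (hT : G.IsSpanningTree t T)
    {v w : Fin n} (h : (v, w) ∈ G.arcs)
    (hi : G.Incomparable (G.dist T v) (G.weight v w + G.dist T w)) :
    ¬ Relation.ReflTransGen (fun x y => T x = some y) w v ∧
      G.IsSpanningTree t (Function.update T v (some w)) := by
  obtain ⟨z, hz, hlt⟩ : ∃ z ∈ G.box,
      (G.weight v w + G.dist T w).eval z < (G.dist T v).eval z := by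
    have := hi.1
    unfold LE at this
    push Not at this
    exact this
  rw [TropMonomial.eval_add] at hlt
  have hw := hG.weight_pos hB h hz
  have hv : v ≠ t := by
    rintro rfl
    rw [hT.dist_target, TropMonomial.eval_zero] at hlt
    linarith [hG.dist_nonneg hB hT hz w]
  refine ⟨fun hr => ?_, hG.isSpanningTree_update hB hT hz hv h (by linarith)⟩
  linarith [dist_le_of_reflTransGen hB hG hT hz hr]

/-- The path from `v` in the new tree has length `d_vw + p_w` with the old `p_w`, so the local test
of the algorithm detects exactly the edges. -/
theorem treeGraph_adj_iff (hT : G.IsShortestPathTree t T)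
    (hU : G.IsShortestPathTree t U) :
    (G.treeGraph t).Adj ⟨T, hT⟩ ⟨U, hU⟩ ↔ ∃ v w, (v, w) ∈ G.arcs ∧
      G.Incomparable (G.dist T v) (G.weight v w + G.dist T w) ∧
      U = Function.update T v (some w) := by
  constructor
  · rintro ⟨u, hne, heq, hi⟩
    have hut : u ≠ t := by rintro rfl; exact hne (hT.1.1.trans hU.1.1.symm)
    obtain ⟨w, hw⟩ := hU.1.2.1 u hut
    simp only at hne heq hi
    rw [hT.1.dist_exchange hU.1 heq hw] at hi
    refine ⟨u, w, hU.1.2.2.1 u w hw, hi, funext fun x => ?_⟩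
    by_cases hx : x = u
    · subst hx; rw [Function.update_self, hw]
    · rw [Function.update_of_ne hx, heq x hx]
  · rintro ⟨v, w, h, hi, rfl⟩
    have hne : ∀ x, x ≠ v → T x = Function.update T v (some w) x :=
      fun x hx => (Function.update_of_ne hx _ _).symm
    have hd := hT.1.dist_exchange hU.1 hne (Function.update_self ..)
    refine ⟨v, fun he => ?_, hne, ?_⟩
    · simp only [Function.update_self] at he
      rw [hT.1.dist_eq he] at hi
      exact hi.1 fun z _ => le_rfl
    · change G.Incomparable (G.dist T v) _
      rw [hd]; exact hi

/-- The comparisons of incomparable monomials describe the cell. -/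
theorem IsShortestPathTree.cell_eq (hT : G.IsShortestPathTree t T)
    {ineqs : List (TropMonomial k × TropMonomial k)}
    (h1 : ∀ q ∈ ineqs, ∃ v w, (v, w) ∈ G.arcs ∧ q = (G.dist T v, G.weight v w + G.dist T w))
    (h2 : ∀ v w, (v, w) ∈ G.arcs → G.Incomparable (G.dist T v) (G.weight v w + G.dist T w) →
      (G.dist T v, G.weight v w + G.dist T w) ∈ ineqs) :
    G.cell T = {z ∈ G.box | ∀ q ∈ ineqs, q.1.eval z ≤ q.2.eval z} := by
  ext z
  refine and_congr_right fun hz => ⟨fun h q hq => ?_, fun h v w hvw => ?_⟩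
  · obtain ⟨v, w, hvw, rfl⟩ := h1 q hq
    exact h v w hvw
  · by_cases hi : G.Incomparable (G.dist T v) (G.weight v w + G.dist T w)
    · exact h _ (h2 v w hvw hi)
    · by_cases hle : G.LE (G.dist T v) (G.weight v w + G.dist T w)
      · exact hle z hz
      · exfalso
        refine hi ⟨hle, fun hge => ?_⟩
        exact hT.2 v w hvw ⟨hge, hle⟩

/-- Without variables all monomials are constants; hence the search never exchanges an arc for `k =
0`. -/
theorem LE.total_of_subsingleton (f g : TropMonomial 0) (H : ParamNetwork n 0) :
    H.LE f g ∨ H.LE g f := by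
  rcases le_total f.coeff g.coeff with h | h
  · exact Or.inl fun z _ => by simpa [TropMonomial.eval] using h
  · exact Or.inr fun z _ => by simpa [TropMonomial.eval] using h

/-! ## The set of visited trees -/

open Classical in
variable (G) in
/-- The possible successors of a node. -/
noncomputable def letters (v : Fin n) : Finset (Option (Fin n)) :=
  insert none ((Finset.univ.filter fun w => (v, w) ∈ G.arcs).image some)

theorem IsSpanningTree.mem_letters (hT : G.IsSpanningTree t T) (v : Fin n) :
    T v ∈ G.letters v := by
  unfold letters
  cases h : T v with
  | none => simp
  | some w => simpa using hT.2.2.1 v w h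

/-- A node has its outgoing arcs and `none` as letters. This is what bounds a dictionary operation
by `O(n + m)`. -/
theorem sum_card_letters_le :
    ((List.finRange n).map fun v => (G.letters v).card).sum ≤ n + G.numArcs := by
  classical
  rw [← List.ofFn_eq_map, List.sum_ofFn]
  have h1 : ∀ v, (G.letters v).card ≤ 1 + (Finset.univ.filter fun w => (v, w) ∈ G.arcs).card := by
    intro v
    unfold letters
    refine (Finset.card_insert_le _ _).trans ?_
    have := Finset.card_image_le (s := Finset.univ.filter fun w => (v, w) ∈ G.arcs)
      (f := (some : Fin n → Option (Fin n)))
    omega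
  refine (Finset.sum_le_sum fun v _ => h1 v).trans ?_
  rw [Finset.sum_add_distrib]
  have h2 : G.numArcs = (Finset.univ.filter fun e : Fin n × Fin n => e ∈ G.arcs).card := by
    rw [numArcs, Set.ncard_eq_toFinset_card']; congr 1; ext; simp
  rw [h2, Finset.card_filter, Fintype.sum_prod_type]
  simp only [Finset.card_filter, Finset.sum_const, Finset.card_univ, Fintype.card_fin,
    smul_eq_mul, mul_one, le_refl]

/-- The dictionary `d` contains the trees in the list `L`, which are pairwise distinct
shortest-path trees with the property `C`. -/
structure IsVisited (G : ParamNetwork n k) (t : Fin n) (C : SuccMap n → Prop) (d : Dictionary n)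
    (L : List (SuccMap n)) : Prop where
  trie : d.Trie G.letters (List.finRange n) (Dictionary.headLetters G.letters (List.finRange n))
  contains : ∀ U, d.Contains U (List.finRange n) ↔ U ∈ L
  size_le : d.size ≤ 1 + 4 * (n * L.length)
  nodup : L.Nodup
  prop : ∀ U ∈ L, G.IsShortestPathTree t U ∧ C U

variable {C : SuccMap n → Prop}

theorem IsVisited.length_le {d : Dictionary n} {L : List (SuccMap n)}
    (h : G.IsVisited t C d L) : L.length ≤ G.numTrees t := by
  classical
  rw [← List.toFinset_card_of_nodup h.nodup, numTrees_eq_card]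
  exact Finset.card_le_card fun U hU =>
    mem_shortestPathTrees.2 (h.prop U (List.mem_toFinset.1 hU)).1

theorem IsVisited.perm {d : Dictionary n} {L L' : List (SuccMap n)} (h : G.IsVisited t C d L)
    (hp : L.Perm L') : G.IsVisited t C d L' :=
  ⟨h.trie, fun U => (h.contains U).trans hp.mem_iff, hp.length_eq ▸ h.size_le,
    hp.nodup_iff.1 h.nodup, fun U hU => h.prop U (hp.mem_iff.2 hU)⟩

theorem IsVisited.lookup_meets {d : Dictionary n} {L : List (SuccMap n)}
    (h : G.IsVisited t C d L) (U : SuccMap n) :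
    (d.lookup U (List.finRange n)).Meets (fun b => b = true ↔ U ∈ L)
      (3 * (n + G.numArcs) + 3) (3 * (n + G.numArcs) + 3) := by
  have h1 := sum_card_letters_le (G := G)
  have h2 := Dictionary.searchBound_headLetters (A := G.letters) (List.finRange n)
  exact (Dictionary.lookup_meets U d _ _ h.trie).mono (fun b hb => hb.trans (h.contains U))
    (by omega) (by omega)

theorem IsVisited.insert_meets {d : Dictionary n} {L : List (SuccMap n)}
    (h : G.IsVisited t C d L) (hU : G.IsShortestPathTree t U) (hC : C U) (hUL : U ∉ L) :
    (d.insert U (List.finRange n)).Meets (fun d' => G.IsVisited t C d' (U :: L))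
      (3 * (n + G.numArcs) + 3) (3 * (n + G.numArcs) + 3) := by
  have h1 := sum_card_letters_le (G := G)
  have h2 := Dictionary.searchBound_headLetters (A := G.letters) (List.finRange n)
  refine (Dictionary.insert_meets hU.1.mem_letters d _ _ h.trie ?_).mono ?_ (by omega) (by omega)
  · intro v hv
    cases hl : List.finRange n with
    | nil => rw [hl] at hv; cases hv
    | cons w l => rw [hl] at hv; cases hv; exact hU.1.mem_letters _
  · rintro d' ⟨h3, h4, h5⟩
    refine ⟨h3, fun V => ?_, ?_, List.nodup_cons.2 ⟨hUL, h.nodup⟩, ?_⟩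
    · rw [h4, h.contains, List.mem_cons, funext_iff]
      simp
    · have := h.size_le
      rw [List.length_finRange] at h5
      rw [List.length_cons, Nat.mul_add]
      omega
    · rintro V hV
      rcases List.mem_cons.1 hV with rfl | hV
      · exact ⟨hU, hC⟩
      · exact h.prop V hV

/-! ## Sizes of the stored data -/

theorem IsRecord.cells_le {e : TreeRecord n k} (he : G.IsRecord t e) :
    Sized.cells e ≤ 6 * (n * (k + 1)) := by
  have hn := pos_of_fin t
  have h2 : n ≤ n * (k + 1) := Nat.le_mul_of_pos_right _ (Nat.succ_pos k)
  have h3 := cells_succMap_le e.tree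
  have h4 := cells_nodes_le e.order
  have h5 := cells_monomials_le e.dist
  rw [he.order.length_eq] at h4
  exact (Nat.add_le_add (Nat.add_le_add h3 h4) h5).trans (by omega)

theorem cells_records_le {l : List (TreeRecord n k)} (h : ∀ e ∈ l, G.IsRecord t e) {s : ℕ}
    (hl : l.length ≤ s) : Sized.cells l ≤ 1 + 7 * (n * (k + 1) * s) := by
  have hn := pos_of_fin t
  have h2 : 1 ≤ n * (k + 1) := Nat.mul_pos hn (Nat.succ_pos k)
  refine (cells_list_le l fun e he => (h e he).cells_le).trans ?_
  have : l.length * (1 + 6 * (n * (k + 1))) ≤ s * (7 * (n * (k + 1))) :=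
    Nat.mul_le_mul hl (by omega)
  have e1 : s * (7 * (n * (k + 1))) = 7 * (n * (k + 1) * s) := by ring
  omega

theorem cells_ineqs_le {l : List (TropMonomial k × TropMonomial k)} {m : ℕ}
    (hl : l.length ≤ m) : Sized.cells l ≤ 1 + 3 * (m * (k + 1)) := by
  refine (cells_list_le (c := 2 * (k + 1)) l fun e _ => ?_).trans ?_
  · change (k + 1) + (k + 1) ≤ _; omega
  · have : l.length * (1 + 2 * (k + 1)) ≤ m * (3 * (k + 1)) := Nat.mul_le_mul hl (by omega)
    have e1 : m * (3 * (k + 1)) = 3 * (m * (k + 1)) := by ring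
    omega

/-! ## Expansion of a tree -/

/-- The state of the expansion of `e` after the arcs in `pre` have been treated; `others` are the
visited trees that are not in the back part of the queue, and `init` are the trees that were
visited at the beginning. -/
structure IsExpansion (G : ParamNetwork n k) (t : Fin n) (C : SuccMap n → Prop)
    (T : SuccMap n) (init others : List (SuccMap n)) (pre : List (Fin n × Fin n × ArcWeight k))
    (s : List (TropMonomial k × TropMonomial k) × List (TreeRecord n k) × Dictionary n) :
    Prop where
  length_le : s.1.length ≤ pre.length
  ineqs : ∀ q ∈ s.1, ∃ v w, (v, w) ∈ G.arcs ∧ q = (G.dist T v, G.weight v w + G.dist T w)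
  mem_ineqs : ∀ a ∈ pre,
    G.Incomparable (G.dist T a.1) (a.2.2.toMonomial + G.dist T a.2.1) →
      (G.dist T a.1, a.2.2.toMonomial + G.dist T a.2.1) ∈ s.1
  record : ∀ e ∈ s.2.1, G.IsRecord t e
  visited : G.IsVisited t C s.2.2 (s.2.1.map TreeRecord.tree ++ others)
  init_subset : ∀ U ∈ init, U ∈ s.2.1.map TreeRecord.tree ++ others
  neighbors : ∀ a ∈ pre,
    G.Incomparable (G.dist T a.1) (a.2.2.toMonomial + G.dist T a.2.1) →
      G.IsShortestPathTree t (Function.update T a.1 (some a.2.1)) →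
        Function.update T a.1 (some a.2.1) ∈ s.2.1.map TreeRecord.tree ++ others

/-- `W` bounds the time for one arc. Two comparisons are always needed; exchange, check and
dictionary access only for incomparable monomials, so the larger bound `hW'` is conditional on `k ≠
0`. The property `C` passes along edges and later stands for membership in the component of the
starting tree. -/
theorem expand_meets (hB : G.NonnegBounds) (hG : G.Generic)
    (hC : ∀ T U (hT : G.IsShortestPathTree t T) (hU : G.IsShortestPathTree t U), C T →
      (G.treeGraph t).Adj ⟨T, hT⟩ ⟨U, hU⟩ → C U)
    {arcList : List (Fin n × Fin n × ArcWeight k)} (hl : G.IsArcList arcList)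
    {e : TreeRecord n k} (he : G.IsRecord t e) (heT : G.IsShortestPathTree t e.tree)
    (heC : C e.tree) {others : List (SuccMap n)}
    {back : List (TreeRecord n k)} {visited : Dictionary n} {init : List (SuccMap n)}
    (hsub : ∀ U ∈ init, U ∈ back.map TreeRecord.tree ++ others)
    (hback : ∀ e ∈ back, G.IsRecord t e)
    (hvis : G.IsVisited t C visited (back.map TreeRecord.tree ++ others)) {W : ℕ}
    (hW : 32 * (k + 1) + 3 ≤ W)
    (hW' : k ≠ 0 → 32 * (k + 1) + 60 * (n * (k + 1)) + 40 * (G.numArcs * (k + 1)) +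
      6 * (n + G.numArcs) + 20 ≤ W) :
    (G.expand arcList e back visited).Meets (G.IsExpansion t C e.tree init others arcList)
      (G.numArcs * (W + 1) + 1)
      (300 * ((n * (k + 1) + G.numArcs * (k + 1)) * (G.numTrees t + 1))) := by
  have hn := pos_of_fin t
  have h1 : k + 1 ≤ n * (k + 1) := Nat.le_mul_of_pos_left _ hn
  have h2 : n ≤ n * (k + 1) := Nat.le_mul_of_pos_right _ (Nat.succ_pos k)
  have h3 : G.numArcs ≤ G.numArcs * (k + 1) := Nat.le_mul_of_pos_right _ (Nat.succ_pos k)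
  have hinit : G.IsExpansion t C e.tree init others [] ([], back, visited) :=
    ⟨le_rfl, by simp, by simp, hback, hvis, hsub, by simp⟩
  refine (loop_meets (t := W) (s := 200 * (n * (k + 1) + G.numArcs * (k + 1)))
    (c := 3 + 3 * (G.numArcs * (k + 1)) + 7 * (n * (k + 1) * G.numTrees t) +
      4 * (n * G.numTrees t))
    (fun r s => ∃ pre, pre ++ r = arcList ∧ G.IsExpansion t C e.tree init others pre s) ?_ ?_ arcList
    ([], back, visited) ⟨[], rfl, hinit⟩).mono ?_ ?_ ?_
  · rintro r ⟨ineqs, back, visited⟩ ⟨pre, hpre, hs⟩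
    have hlen := hs.length_le
    have hvis := hs.visited
    have hL := hvis.length_le
    have hlpre := congrArg List.length hpre
    have hl' := hl.length_le
    have hsz := hvis.size_le
    rw [List.length_append] at hlpre
    simp only at hlen
    have c1 := cells_ineqs_le (k := k) (l := ineqs) (m := G.numArcs) (by omega)
    have c2 := cells_records_le (l := back) hs.record (s := G.numTrees t) (by
      rw [List.length_append, List.length_map] at hL; simp only at hL; omega)
    have c3 := Nat.mul_le_mul_left n hL
    refine (Nat.add_le_add c1 (Nat.add_le_add c2 (hsz.trans (Nat.add_le_add_left
      (Nat.mul_le_mul_left 4 c3) 1)))).trans ?_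
    omega
  · rintro a r ⟨ineqs, back, visited⟩ ⟨pre, hpre, hs⟩
    have hmem : a ∈ arcList := by rw [← hpre]; simp
    have hD := (hl.mem a).1 hmem
    have harc : (a.1, a.2.1) ∈ G.arcs := by rw [mem_arcs, hD]; simp
    have hw := weight_eq hD
    refine Meets.elem_bind (Meets.elem_bind (Meets.bind (addArc_meets _ _) ?_))
    rintro _ rfl
    rw [he.dist]
    refine Meets.bind (leM_meets hB _ _) fun x hx => ?_
    refine Meets.bind (leM_meets hB _ _) fun y hy => ?_
    refine Meets.ite (fun h => Meets.pure ⟨pre ++ [a], by simp [hpre], ?_⟩) fun h => ?_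
    · have hni : ¬ G.Incomparable (G.dist e.tree a.1)
          (a.2.2.toMonomial + G.dist e.tree a.2.1) := by
        rintro ⟨h1, h2⟩
        rw [← hx] at h1
        rw [← hy] at h2
        rw [Bool.or_eq_true] at h
        exact h.elim h1 h2
      refine ⟨hs.length_le.trans (by simp), hs.ineqs, ?_, hs.record, hs.visited, hs.init_subset, ?_⟩
      · intro b hb hi
        rcases List.mem_append.1 hb with hb | hb
        · exact hs.mem_ineqs b hb hi
        · obtain rfl : b = a := by simpa using hb
          exact absurd hi hni
      · intro b hb hi
        rcases List.mem_append.1 hb with hb | hb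
        · exact hs.neighbors b hb hi
        · obtain rfl : b = a := by simpa using hb
          exact absurd hi hni
    · have hi : G.Incomparable (G.dist e.tree a.1)
          (a.2.2.toMonomial + G.dist e.tree a.2.1) := by
        rw [Bool.or_eq_true, hx, hy] at h
        exact ⟨fun h' => h (Or.inl h'), fun h' => h (Or.inr h')⟩
      have hk : k ≠ 0 := by
        rintro rfl
        exact (LE.total_of_subsingleton _ _ G).elim hi.1 hi.2
      have hWk := hW' hk
      have hi' : G.Incomparable (G.dist e.tree a.1)
          (G.weight a.1 a.2.1 + G.dist e.tree a.2.1) := by rw [hw]; exact hi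
      obtain ⟨hbelow, hT'⟩ := hG.exchange hB he.tree harc hi'
      -- the invariant after the treatment of the arc
      have hd : ∀ (back' : List (TreeRecord n k)) (visited' : Dictionary n),
          (∀ e ∈ back', G.IsRecord t e) →
          G.IsVisited t C visited' (back'.map TreeRecord.tree ++ others) →
          (∀ U ∈ back.map TreeRecord.tree ++ others,
            U ∈ back'.map TreeRecord.tree ++ others) →
          (G.IsShortestPathTree t (Function.update e.tree a.1 (some a.2.1)) →
            Function.update e.tree a.1 (some a.2.1) ∈ back'.map TreeRecord.tree ++ others) →
          ∃ pre, pre ++ r = arcList ∧ G.IsExpansion t C e.tree init others pre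
            ((G.dist e.tree a.1, a.2.2.toMonomial + G.dist e.tree a.2.1) :: ineqs,
              back', visited') := by
        intro back' visited' hb1 hb2 hb3 hb4
        refine ⟨pre ++ [a], by simp [hpre], ?_, ?_, ?_, hb1, hb2,
          fun U hU => hb3 U (hs.init_subset U hU), ?_⟩
        · simpa using hs.length_le
        · intro q hq
          rcases List.mem_cons.1 hq with rfl | hq
          · exact ⟨a.1, a.2.1, harc, by rw [hw]⟩
          · exact hs.ineqs q hq
        · intro b hb hi
          rcases List.mem_append.1 hb with hb | hb
          · exact List.mem_cons_of_mem _ (hs.mem_ineqs b hb hi)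
          · obtain rfl : b = a := by simpa using hb
            exact List.mem_cons_self
        · intro b hb hi hU
          rcases List.mem_append.1 hb with hb | hb
          · exact hb3 _ (hs.neighbors b hb hi hU)
          · obtain rfl : b = a := by simpa using hb
            exact hb4 hU
      refine Meets.elem_bind (Meets.bind (exchange_meets he hbelow hT') ?_)
      rintro e' ⟨he', hee'⟩
      rw [he'.dist]
      refine Meets.bind (checkTree_meets hB hl he'.tree) fun ok hok => ?_
      refine Meets.ite (fun h => ?_) fun h => ?_
      · have hU : G.IsShortestPathTree t e'.tree := hok.1 h
        refine Meets.bind (hs.visited.lookup_meets e'.tree) fun seen hseen => ?_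
        refine Meets.ite (fun h => ?_) fun h => ?_
        · refine Meets.pure (hd back visited hs.record hs.visited (fun _ h => h) fun _ => ?_)
          rw [← hee']; exact hseen.1 h
        · have hCU : C e'.tree := by
            refine hC _ _ heT hU heC ((treeGraph_adj_iff heT hU).2 ?_)
            exact ⟨a.1, a.2.1, harc, hi', hee'⟩
          refine Meets.bind (hs.visited.insert_meets hU hCU fun h' => h (hseen.2 h')) ?_
          intro visited' hvis'
          refine Meets.elem_bind (Meets.pure (hd (e' :: back) visited' ?_ hvis' ?_ fun _ => ?_))
          · rintro f hf
            rcases List.mem_cons.1 hf with rfl | hf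
            · exact he'
            · exact hs.record f hf
          · exact fun U hU => List.mem_cons_of_mem _ hU
          · rw [← hee']; exact List.mem_cons_self
      · refine Meets.pure (hd back visited hs.record hs.visited (fun _ h => h) fun hU => ?_)
        rw [← hee'] at hU
        exact absurd (hok.2 hU) h
  · rintro s ⟨pre, hpre, hs⟩
    rw [List.append_nil] at hpre
    exact hpre ▸ hs
  · have := Nat.mul_le_mul_right (W + 1) hl.length_le
    omega
  · have e1 : (n * (k + 1) + G.numArcs * (k + 1)) * (G.numTrees t + 1) =
        n * (k + 1) * G.numTrees t + G.numArcs * (k + 1) * G.numTrees t + n * (k + 1) +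
          G.numArcs * (k + 1) := by ring
    have e2 := Nat.mul_le_mul_right (G.numTrees t) h2
    omega

end ParamNetwork

namespace ParamNetwork

variable {n k : ℕ} {G : ParamNetwork n k} {t : Fin n} {T U : SuccMap n}
  {C : SuccMap n → Prop}

open Metered

/-! ## The traversal -/

/-- The output for a tree consists of its distances and a description of its cell. -/
structure IsOutput (G : ParamNetwork n k) (o : TreeOutput n k) : Prop where
  dist : o.dist = G.dist o.tree
  cell : G.cell o.tree = {z ∈ G.box | ∀ q ∈ o.ineqs, q.1.eval z ≤ q.2.eval z}
  length_le : o.ineqs.length ≤ G.numArcs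

/-- The trees that have been considered so far. -/
def SearchState.trees (s : SearchState n k) : List (SuccMap n) :=
  s.back.map TreeRecord.tree ++ (s.front.map TreeRecord.tree ++ s.out.map TreeOutput.tree)

theorem SearchState.length_trees (s : SearchState n k) :
    (trees s).length = s.back.length + (s.front.length + s.out.length) := by
  simp [trees]

/-- The invariant of the traversal that starts at `T₀`. -/
structure IsSearchState (G : ParamNetwork n k) (t : Fin n) (C : SuccMap n → Prop)
    (T₀ : SuccMap n) (s : SearchState n k) : Prop where
  front : ∀ e ∈ s.front, G.IsRecord t e
  back : ∀ e ∈ s.back, G.IsRecord t e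
  visited : G.IsVisited t C s.visited (SearchState.trees s)
  start : T₀ ∈ SearchState.trees s
  out : ∀ o ∈ s.out, G.IsOutput o
  neighbors : ∀ o ∈ s.out, ∀ v w, (v, w) ∈ G.arcs →
    G.Incomparable (G.dist o.tree v) (G.weight v w + G.dist o.tree w) →
      G.IsShortestPathTree t (Function.update o.tree v (some w)) →
        Function.update o.tree v (some w) ∈ SearchState.trees s

theorem cells_outputs_le {l : List (TreeOutput n k)} (h : ∀ o ∈ l, G.IsOutput o) (t : Fin n)
    {s : ℕ} (hl : l.length ≤ s) :
    Sized.cells l ≤ 1 + (5 * (n * (k + 1) * s) + 3 * (G.numArcs * (k + 1) * s)) := by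
  have hn := pos_of_fin t
  have h1 : n ≤ n * (k + 1) := Nat.le_mul_of_pos_right _ (Nat.succ_pos k)
  refine (cells_list_le (c := 2 * n + n * (k + 1) + (1 + 3 * (G.numArcs * (k + 1)))) l
    fun o ho => ?_).trans ?_
  · have h3 := cells_succMap_le o.tree
    have h4 := cells_monomials_le o.dist
    have h5 := cells_ineqs_le (h o ho).length_le
    exact (Nat.add_le_add (Nat.add_le_add h3 h4) h5).trans (by omega)
  · have h2 : l.length * (1 + (2 * n + n * (k + 1) + (1 + 3 * (G.numArcs * (k + 1))))) ≤
        s * (5 * (n * (k + 1)) + 3 * (G.numArcs * (k + 1))) := Nat.mul_le_mul hl (by omega)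
    have e1 : s * (5 * (n * (k + 1)) + 3 * (G.numArcs * (k + 1))) =
      5 * (n * (k + 1) * s) + 3 * (G.numArcs * (k + 1) * s) := by ring
    omega

theorem IsSearchState.cells_le {T₀ : SuccMap n} {s : SearchState n k}
    (hs : G.IsSearchState t C T₀ s) : Sized.cells s ≤
      30 * ((n * (k + 1) + G.numArcs * (k + 1)) * (G.numTrees t + 1)) := by
  have hL := hs.visited.length_le
  have hlen := SearchState.length_trees s
  have h1 := cells_records_le hs.front (s := G.numTrees t) (by omega)
  have h2 := cells_records_le hs.back (s := G.numTrees t) (by omega)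
  have h3 := hs.visited.size_le
  have h4 := cells_outputs_le hs.out t (s := G.numTrees t) (by omega)
  have h5 := Nat.mul_le_mul_left n hL
  have hn := pos_of_fin t
  have h6 : n ≤ n * (k + 1) := Nat.le_mul_of_pos_right _ (Nat.succ_pos k)
  have e1 : (n * (k + 1) + G.numArcs * (k + 1)) * (G.numTrees t + 1) =
    n * (k + 1) * G.numTrees t + G.numArcs * (k + 1) * G.numTrees t + n * (k + 1) +
      G.numArcs * (k + 1) := by ring
  have e2 := Nat.mul_le_mul_right (G.numTrees t) h6
  refine (Nat.add_le_add (Nat.add_le_add (Nat.add_le_add h1 h2) h3) h4).trans ?_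
  omega

/-- A bound for the number of steps that remain to be done, where `E` bounds the time for the
expansion of one tree. -/
noncomputable def potential (G : ParamNetwork n k) (t : Fin n) (E : ℕ) (s : SearchState n k) : ℕ :=
  (E + 2) * (G.numTrees t - s.out.length) + 6 * s.back.length +
    6 * (G.numTrees t - (SearchState.trees s).length) + 2

/-- In `potential`, each tree not yet returned carries `E + 2`, which pays for its expansion. A
discovery moves `6` units from the undiscovered trees to the back list. Reversing a nonempty back
list of length `b` costs `2 * b + 2` including the iteration, at most the `6 * b` released. -/
theorem searchStep_meets (hB : G.NonnegBounds) (hG : G.Generic)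
    (hC : ∀ T U (hT : G.IsShortestPathTree t T) (hU : G.IsShortestPathTree t U), C T →
      (G.treeGraph t).Adj ⟨T, hT⟩ ⟨U, hU⟩ → C U)
    {arcList : List (Fin n × Fin n × ArcWeight k)} (hl : G.IsArcList arcList) {W : ℕ}
    (hW : 32 * (k + 1) + 3 ≤ W)
    (hW' : k ≠ 0 → 32 * (k + 1) + 60 * (n * (k + 1)) + 40 * (G.numArcs * (k + 1)) +
      6 * (n + G.numArcs) + 20 ≤ W) {T₀ : SuccMap n} {s : SearchState n k}
    (hs : G.IsSearchState t C T₀ s) :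
    ∃ τ, (G.searchStep arcList s).Meets (fun y =>
      (∃ s', y = .inl s' ∧ G.IsSearchState t C T₀ s' ∧
        1 + τ + G.potential t (G.numArcs * (W + 1) + 1) s' ≤
          G.potential t (G.numArcs * (W + 1) + 1) s) ∨
      (y = .inr s.out ∧ s.front = [] ∧ s.back = [] ∧
        1 + τ ≤ G.potential t (G.numArcs * (W + 1) + 1) s)) τ
      (301 * ((n * (k + 1) + G.numArcs * (k + 1)) * (G.numTrees t + 1))) := by
  have hn := pos_of_fin t
  have hX : 0 < (n * (k + 1) + G.numArcs * (k + 1)) * (G.numTrees t + 1) :=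
    Nat.mul_pos (Nat.add_pos_left (Nat.mul_pos hn (Nat.succ_pos k)) _) (Nat.succ_pos _)
  obtain ⟨front, back, visited, out⟩ := s
  have hL := hs.visited.length_le
  rw [SearchState.length_trees] at hL
  generalize hE : G.numArcs * (W + 1) + 1 = E
  match front, back with
  | e :: front, back =>
    refine ⟨E + 1, ?_⟩
    have heL : e.tree ∈ SearchState.trees ⟨e :: front, back, visited, out⟩ := by
      simp [SearchState.trees]
    obtain ⟨heT, heC⟩ := hs.visited.prop _ heL
    refine Meets.bind ((expand_meets hB hG hC hl (hs.front e List.mem_cons_self) heT heC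
      (fun _ h => h) hs.back hs.visited hW hW').mono (t' := E) (fun _ h => h) hE.le le_rfl) ?_
    rintro ⟨ineqs, back', visited'⟩ hx
    have hperm : (back'.map TreeRecord.tree ++
        ((e :: front).map TreeRecord.tree ++ out.map TreeOutput.tree)).Perm
        (SearchState.trees ⟨front, back', visited', ⟨e.tree, e.dist, ineqs⟩ :: out⟩) := by
      refine List.Perm.append_left _ ?_
      rw [List.map_cons, List.map_cons, List.cons_append]
      exact List.perm_middle.symm
    have hvis := hx.visited.perm hperm
    have hsub : ∀ U ∈ SearchState.trees ⟨e :: front, back, visited, out⟩,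
        U ∈ SearchState.trees ⟨front, back', visited', ⟨e.tree, e.dist, ineqs⟩ :: out⟩ := by
      exact fun U hU => hperm.mem_iff.1 (hx.init_subset U hU)
    have hL' := hvis.length_le
    rw [SearchState.length_trees] at hL'
    refine Meets.elem_bind (Meets.pure (Or.inl ⟨_, rfl, ⟨?_, hx.record, hvis, hsub _ hs.start,
      ?_, ?_⟩, ?_⟩))
    · exact fun f hf => hs.front f (List.mem_cons_of_mem _ hf)
    · intro o ho
      rcases List.mem_cons.1 ho with rfl | ho
      · refine ⟨(hs.front e List.mem_cons_self).dist, heT.cell_eq hx.ineqs ?_,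
          hx.length_le.trans hl.length_le⟩
        intro v w hvw hi
        obtain ⟨a, ha⟩ := exists_weight hvw
        rw [weight_eq ha] at hi ⊢
        exact hx.mem_ineqs (v, w, a) ((hl.mem (v, w, a)).2 ha) hi
      · exact hs.out o ho
    · intro o ho v w hvw hi hU
      rcases List.mem_cons.1 ho with rfl | ho
      · obtain ⟨a, ha⟩ := exists_weight hvw
        rw [weight_eq ha] at hi
        exact hperm.mem_iff.1 (hx.neighbors (v, w, a) ((hl.mem (v, w, a)).2 ha) hi hU)
      · exact hsub _ (hs.neighbors o ho v w hvw hi hU)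
    · simp only [potential, SearchState.length_trees, List.length_cons] at hL hL' ⊢
      obtain ⟨d, hd⟩ := Nat.exists_eq_add_of_le (show out.length + 1 ≤ G.numTrees t by omega)
      have e1 : G.numTrees t - (out.length + 1) = d := by omega
      have e2 : G.numTrees t - out.length = d + 1 := by omega
      rw [e1, e2, Nat.mul_add]
      omega
  | [], b :: back =>
    refine ⟨(b :: back).length * 2 + 1, ?_⟩
    have h6 := Nat.mul_le_mul_left (n * (k + 1)) (show (b :: back).length ≤ G.numTrees t by
      simp only at hL; omega)
    have h7 : (b :: back).length ≤ n * (k + 1) * (b :: back).length :=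
      Nat.le_mul_of_pos_left _ (Nat.mul_pos hn (Nat.succ_pos k))
    have e1 : (b :: back).length * (1 + 6 * (n * (k + 1))) =
      (b :: back).length + 6 * (n * (k + 1) * (b :: back).length) := by ring
    have e2 : (n * (k + 1) + G.numArcs * (k + 1)) * (G.numTrees t + 1) =
      n * (k + 1) * G.numTrees t + G.numArcs * (k + 1) * G.numTrees t + n * (k + 1) +
        G.numArcs * (k + 1) := by ring
    refine Meets.bind (reverseList_meets (c := 6 * (n * (k + 1))) (b :: back)
      fun e he => (hs.back e he).cells_le) ?_
    rintro _ rfl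
    have hperm : (SearchState.trees ⟨[], b :: back, visited, out⟩).Perm
        (SearchState.trees ⟨(b :: back).reverse, [], visited, out⟩) := by
      simp only [SearchState.trees, List.map_nil, List.nil_append, List.map_reverse]
      exact List.Perm.append_right _ (List.reverse_perm _).symm
    refine Meets.pure (Or.inl ⟨_, rfl, ⟨?_, ?_, hs.visited.perm hperm,
      hperm.mem_iff.1 hs.start, hs.out, ?_⟩, ?_⟩)
    · exact fun e he => hs.back e (List.mem_reverse.1 he)
    · simp
    · exact fun o ho v w hvw hi hU => hperm.mem_iff.1 (hs.neighbors o ho v w hvw hi hU)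
    · simp only [potential, SearchState.length_trees, List.length_cons, List.length_reverse,
        List.length_nil]
      omega
  | [], [] =>
    exact ⟨0, Meets.pure (Or.inr ⟨rfl, rfl, rfl, by unfold potential; omega⟩)⟩

/-- The list of the trees that are connected to `T₀`, each of them once, with correct data. -/
structure IsCompleteOutput (G : ParamNetwork n k) (C : SuccMap n → Prop)
    (out : List (TreeOutput n k)) : Prop where
  nodup : (out.map TreeOutput.tree).Nodup
  mem : ∀ T, T ∈ out.map TreeOutput.tree ↔ C T
  out : ∀ o ∈ out, G.IsOutput o

/-- With an empty queue, the output contains the starting tree and is closed under adjacency, so it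
exhausts the component; the invariant `C` excludes all other trees. -/
theorem IsSearchState.complete {T₀ : SuccMap n} {h₀ : G.IsShortestPathTree t T₀}
    {s : SearchState n k}
    (hs : G.IsSearchState t (fun T => ∃ hT : G.IsShortestPathTree t T,
      (G.treeGraph t).Reachable ⟨T₀, h₀⟩ ⟨T, hT⟩) T₀ s) (hf : s.front = []) (hb : s.back = []) :
    G.IsCompleteOutput (fun T => ∃ hT : G.IsShortestPathTree t T,
      (G.treeGraph t).Reachable ⟨T₀, h₀⟩ ⟨T, hT⟩) s.out := by
  have hL : SearchState.trees s = s.out.map TreeOutput.tree := by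
    simp [SearchState.trees, hf, hb]
  refine ⟨hL ▸ hs.visited.nodup, fun T => ⟨fun h => (hs.visited.prop T (hL ▸ h)).2, ?_⟩, hs.out⟩
  rintro ⟨hT, hr⟩
  rw [SimpleGraph.reachable_iff_reflTransGen] at hr
  have : ∀ x : {T // G.IsShortestPathTree t T},
      Relation.ReflTransGen (G.treeGraph t).Adj ⟨T₀, h₀⟩ x → x.1 ∈ s.out.map TreeOutput.tree := by
    intro x hx
    induction hx with
    | refl => exact hL ▸ hs.start
    | @tail y z _ hyz ih =>
      obtain ⟨o, ho, hoy⟩ := List.mem_map.1 ih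
      obtain ⟨v, w, hvw, hi, hz⟩ := (treeGraph_adj_iff y.2 z.2).1 hyz
      rw [← hoy] at hi hz
      rw [← hL, hz]
      exact hs.neighbors o ho v w hvw hi (hz ▸ z.2)
  exact this ⟨T, hT⟩ hr

/-- The search yields the component of Dijkstra's tree, which has a full-dimensional cell. The final
implication supplies the spanning tree that the treatment of regions requires. -/
theorem traverse_meets (hB : G.NonnegBounds) (hG : G.Generic) {W : ℕ}
    (hW : 32 * (k + 1) + 3 ≤ W)
    (hW' : G.numTrees t ≠ 0 → k ≠ 0 → 32 * (k + 1) + 60 * (n * (k + 1)) +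
      40 * (G.numArcs * (k + 1)) + 6 * (n + G.numArcs) + 20 ≤ W) {fuel : ℕ}
    (hfuel : (G.numArcs * (W + 1) + 1 + 2) * G.numTrees t + 6 * G.numTrees t + 2 ≤ fuel) :
    (G.traverse t fuel).Meets (fun o => ∃ out, o = some out ∧
      G.IsCompleteOutput (fun T => ∃ (hT : G.IsShortestPathTree t T)
        (U : {U // G.IsShortestPathTree t U}),
        (interior (G.cell U.1)).Nonempty ∧ (G.treeGraph t).Reachable U ⟨T, hT⟩) out ∧
      ((∀ v, Relation.ReflTransGen (fun a b => (a, b) ∈ G.arcs) v t) →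
        ∃ T, G.IsSpanningTree t T))
      (80 * n ^ 2 + G.numTrees t * (20 * (n * (k + 1)) + 3 * (n + G.numArcs) +
        G.numArcs * (W + 1) + 30))
      (1000 * ((n * (k + 1) + G.numArcs * (k + 1)) * (G.numTrees t + 1))) := by
  have hn := pos_of_fin t
  have hn2 : n ≤ n ^ 2 := Nat.le_self_pow (by norm_num) n
  have h2 : n ≤ n * (k + 1) := Nat.le_mul_of_pos_right _ (Nat.succ_pos k)
  have h3 : G.numArcs ≤ G.numArcs * (k + 1) := Nat.le_mul_of_pos_right _ (Nat.succ_pos k)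
  have eX : (n * (k + 1) + G.numArcs * (k + 1)) * (G.numTrees t + 1) =
    (n * (k + 1) + G.numArcs * (k + 1)) * G.numTrees t + n * (k + 1) +
      G.numArcs * (k + 1) := by ring
  refine Meets.bind (listArcs_meets hn) fun arcList hl => ?_
  refine Meets.bind (dijkstra_meets hB hG t) ?_
  rintro s ⟨hs, hs'⟩
  have hsl := hs.length_le
  refine Meets.bind ((reverseList_meets (c := 1) s.order fun _ _ => le_rfl).mono
    (t' := n * 2 + 1) (s' := 2 + n * 2) (fun _ h => h) (by omega) (by omega)) ?_
  rintro _ rfl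
  refine Meets.bind ((loop_meets (t := 1) (s := 1) (c := 1)
    (fun l c => c + l.length = s.order.length) (fun _ _ _ => le_rfl)
    (fun a l c hc => Meets.elem (by simp only [List.length_cons] at hc; omega))
    s.order.reverse 0 (by simp)).mono (t' := n * 2 + 1) (fun _ h => h)
    (by rw [List.length_reverse]; omega) le_rfl) ?_
  intro count hcount
  rw [List.length_nil, Nat.add_zero] at hcount
  subst hcount
  refine Meets.elem_bind (Meets.ite (fun h => ?_) fun h => ?_)
  · have hlen : s.order.length = n := by simpa using h
    obtain ⟨hT, hlo, hord⟩ := hs.tree hB hG hlen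
    have hint := hG.interior_cell_nonempty hB hT hlo
    have hS : G.IsShortestPathTree t fun v => (s.label v).2 := by
      obtain ⟨z, hz⟩ := hint
      exact hT.isShortestPathTree (interior_mono cell_subset_box hz) (interior_subset hz)
    have hpos : 1 ≤ G.numTrees t := by
      rw [numTrees_eq_card]
      exact Finset.card_pos.2 ⟨_, mem_shortestPathTrees.2 hS⟩
    have e1 : G.numTrees t * (20 * (n * (k + 1)) + 3 * (n + G.numArcs) +
        G.numArcs * (W + 1) + 30) = G.numTrees t * (20 * (n * (k + 1)) + 3 * (n + G.numArcs)) +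
        (G.numArcs * (W + 1) + 1 + 2) * G.numTrees t + 27 * G.numTrees t := by ring
    have h4 : 20 * (n * (k + 1)) + 3 * (n + G.numArcs) ≤
        G.numTrees t * (20 * (n * (k + 1)) + 3 * (n + G.numArcs)) := Nat.le_mul_of_pos_left _ hpos
    refine Meets.bind (tabulate_meets (t := 1) (s := 1) (c := 2)
      (P := fun v x => x = (s.label v).2) (fun _ => Meets.elem rfl)
      fun _ x _ => cells_option_fin_le x) ?_
    intro T hTeq
    obtain rfl : T = fun v => (s.label v).2 := funext hTeq
    refine Meets.bind (distances_meets hT hord) ?_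
    rintro _ rfl
    let C : SuccMap n → Prop := fun T => ∃ hT : G.IsShortestPathTree t T,
      (G.treeGraph t).Reachable ⟨_, hS⟩ ⟨T, hT⟩
    have hC₀ : C fun v => (s.label v).2 := ⟨hS, .rfl⟩
    have hC : ∀ T U (hT : G.IsShortestPathTree t T) (hU : G.IsShortestPathTree t U), C T →
        (G.treeGraph t).Adj ⟨T, hT⟩ ⟨U, hU⟩ → C U := by
      rintro T U hT hU ⟨hT', hr⟩ hadj
      exact ⟨hU, hr.trans hadj.reachable⟩
    have hempty : G.IsVisited t C Dictionary.empty [] := by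
      refine ⟨trivial, fun U => ?_, by simp [Dictionary.size], List.nodup_nil, by simp⟩
      cases hfr : List.finRange n with
      | nil => have := congrArg List.length hfr; simp at this; omega
      | cons v l => simp [Dictionary.Contains]
    refine Meets.bind (hempty.insert_meets hS hC₀ (by simp)) ?_
    intro visited hvis
    refine Meets.elem_bind ?_
    have hrec : G.IsRecord t ⟨fun v => (s.label v).2, s.order.reverse,
        G.dist fun v => (s.label v).2⟩ := ⟨hT, hord, rfl⟩
    have hinit : G.IsSearchState t C (fun v => (s.label v).2)
        ⟨[⟨fun v => (s.label v).2, s.order.reverse, G.dist fun v => (s.label v).2⟩], [],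
          visited, []⟩ := by
      refine ⟨?_, by simp, hvis, by simp [SearchState.trees], by simp, by simp⟩
      intro e he
      rw [List.mem_singleton.1 he]; exact hrec
    refine (whileLoop_meets (fun s' => G.IsSearchState t C (fun v => (s.label v).2) s')
      (G.potential t (G.numArcs * (W + 1) + 1)) (G.IsCompleteOutput C)
      (400 * ((n * (k + 1) + G.numArcs * (k + 1)) * (G.numTrees t + 1))) ?_ ?_ ?_ fuel _ hinit
      ?_).mono ?_ ?_ ?_
    · intro x hx
      obtain ⟨τ, h⟩ := searchStep_meets hB hG hC hl hW (hW' (by omega)) hx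
      have h1 := h.peak
      have h2 := hx.cells_le
      omega
    · intro x x' hx hv
      obtain ⟨τ, h⟩ := searchStep_meets hB hG hC hl hW (hW' (by omega)) hx
      have h1 := h.time
      rcases h.val with ⟨s', h2, h3, h4⟩ | ⟨h2, -⟩
      · rw [hv] at h2; cases h2
        exact ⟨h3, by omega⟩
      · rw [hv] at h2; cases h2
    · intro x r hx hv
      obtain ⟨τ, h⟩ := searchStep_meets hB hG hC hl hW (hW' (by omega)) hx
      have h1 := h.time
      rcases h.val with ⟨s', h2, -⟩ | ⟨h2, h3, h4, h5⟩
      · rw [hv] at h2; cases h2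
      · rw [hv] at h2; cases h2
        refine ⟨hx.complete h3 h4, by omega, ?_⟩
        have h6 := hx.cells_le
        have h7 : Sized.cells x.out ≤ Sized.cells x := Nat.le_add_left _ _
        omega
    · simp only [potential, List.length_nil, Nat.sub_zero]
      omega
    · rintro o ⟨out, rfl, ho⟩
      -- Any tree with a full-dimensional cell lies in the component of the starting tree, so it may
      -- replace the latter.
      refine ⟨out, rfl, ⟨ho.nodup, fun T => (ho.mem T).trans ?_, ho.out⟩, fun _ => ⟨_, hT⟩⟩
      constructor
      · rintro ⟨hT, hr⟩
        exact ⟨hT, ⟨_, hS⟩, hint, hr⟩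
      · rintro ⟨hT, ⟨U, hU⟩, hUi, hr⟩
        exact ⟨hT, (hG.reachable_of_interior hB hS hU hint hUi).trans hr⟩
    · simp only [potential, List.length_nil, Nat.sub_zero]
      omega
    · omega
  · have hlen : s.order.length ≠ n := by simpa using h
    have hno : ¬ ∀ v, Relation.ReflTransGen (fun a b => (a, b) ∈ G.arcs) v t := by
      intro hall
      have huniv : s.order.toFinset = Finset.univ :=
        Finset.eq_univ_of_forall fun v => List.mem_toFinset.2 (hs.mem_order hs' (hall v))
      apply hlen
      rw [← List.toFinset_card_of_nodup hs.nodup, huniv, Finset.card_univ, Fintype.card_fin]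
    refine Meets.pure ⟨[], rfl, ⟨by simp, fun T => ?_, by simp⟩, fun h => absurd h hno⟩
    simp only [List.map_nil, List.not_mem_nil, false_iff]
    rintro ⟨hT, -⟩
    exact hno fun v => Relation.ReflTransGen.mono (fun a b hab => hT.1.2.2.1 a b hab) _ _
      (hT.1.2.2.2 v)

/-! ### Elementary estimates and the main theorem -/

theorem numArcs_le_sq : G.numArcs ≤ n ^ 2 := by
  have := Set.ncard_le_card G.arcs
  simpa [numArcs, sq] using this

theorem one_le_numArcs (hS : G.SeparatedVariables) (hk : k ≠ 0) : 1 ≤ G.numArcs := by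
  obtain ⟨e, he, -⟩ := hS ⟨0, Nat.pos_of_ne_zero hk⟩
  exact (Set.ncard_pos (Set.toFinite _)).2 ⟨e, by rw [arcs, Set.mem_ofPred_eq, he]; simp⟩

/-- For `k = 0` the sum `treeBound` is its single term `1 ^ (n - 1) = 1`. -/
theorem numTrees_le_one_of_constant {G : ParamNetwork n 0} {t : Fin n} (hB : G.NonnegBounds)
    (hS : G.SeparatedVariables) (hG : G.Generic) : G.numTrees t ≤ 1 := by
  have := numTrees_le_treeBound (t := t) hB hS hG
  simp only [treeBound, zero_add, Finset.range_one, Finset.sum_singleton, Nat.choose_self,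
    Nat.cast_one, Nat.cast_zero, one_zpow, mul_one] at this
  exact_mod_cast this

end ParamNetwork

open ParamNetwork in
theorem mainTheorem1 :
    ∃ C : ℕ, ∀ (n k : ℕ) (G : ParamNetwork n k) (t : Fin n),
      G.NonnegBounds → G.SeparatedVariables → G.Generic →
      (G.numTrees t : ℝ) ≤
          min (treeBound n k) (min ((n : ℝ) ^ ((n : ℤ) - 2)) (G.numArcs.choose (n - 1) : ℝ)) ∧
      ∃ (fuel : ℕ) (out : List (TreeOutput n k)),
        -- the algorithm terminates with output `out`, within the time and space bounds
        (G.traverse t fuel).val = some out ∧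
        (G.traverse t fuel).time ≤ C * (k * G.numArcs ^ 2 * G.numTrees t + n ^ 2) ∧
        (G.traverse t fuel).peak ≤ C * (max k 1 * (n + G.numArcs) * max (G.numTrees t) 1) ∧
        -- no tree is returned twice
        (out.map TreeOutput.tree).Nodup ∧
        -- the trees are the shortest-path trees connected to one with a full-dimensional cell
        (∀ T : SuccMap n, T ∈ out.map TreeOutput.tree ↔
          ∃ (hT : G.IsShortestPathTree t T) (U : {U // G.IsShortestPathTree t U}),
            (interior (G.cell U.1)).Nonempty ∧ (G.treeGraph t).Reachable U ⟨T, hT⟩) ∧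
        -- each tree comes with its distances and a description of its cell
        (∀ e ∈ out, e.dist = G.dist e.tree ∧
          G.cell e.tree = {z ∈ G.box | ∀ q ∈ e.ineqs, q.1.eval z ≤ q.2.eval z}) ∧
        -- each region is described by exactly one of the systems of inequalities
        (∀ R, G.IsRegion t R → ∃! e, e ∈ out ∧ G.cell e.tree = R) := by
  -- The constant is dictated by the space bound, `1000 * 2 * 2`; the time bound needs less.
  refine ⟨4000, fun n k G t hB hS hG => ⟨le_min (numTrees_le_treeBound hB hS hG)
    (le_min numTrees_le_pow (Nat.cast_le.2 numTrees_le_choose)), ?_⟩⟩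
  have hn := pos_of_fin t
  have hsq := numArcs_le_sq (G := G)
  have hchoose := numTrees_le_choose (G := G) (t := t)
  -- A tree has `n - 1` arcs and a variable needs an arc, so `n ≤ m + 1 ≤ 2 * m`; this absorbs the
  -- terms in `n` into those in `m`.
  have hm : k ≠ 0 → G.numTrees t ≠ 0 → 1 ≤ G.numArcs ∧ n ≤ 2 * G.numArcs := by
    intro hk hne
    have h1 := one_le_numArcs hS hk
    have h2 : n - 1 ≤ G.numArcs := by
      by_contra hlt
      rw [Nat.choose_eq_zero_of_lt (by omega)] at hchoose
      omega
    omega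
  -- With `n ≤ 2 * m` and `k + 1 ≤ 2 * k`, the cost of one arc is at most a multiple of `k * m`; the
  -- summand `40` covers `k = 0`.
  obtain ⟨W, hWdef⟩ : ∃ W, W = 450 * (k * G.numArcs) + 40 := ⟨_, rfl⟩
  have hW : 32 * (k + 1) + 3 ≤ W := by
    rcases eq_or_ne k 0 with rfl | hk
    · omega
    · have := Nat.le_mul_of_pos_right k (one_le_numArcs hS hk)
      omega
  have hW' : G.numTrees t ≠ 0 → k ≠ 0 → 32 * (k + 1) + 60 * (n * (k + 1)) +
      40 * (G.numArcs * (k + 1)) + 6 * (n + G.numArcs) + 20 ≤ W := by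
    intro hne hk
    obtain ⟨h1, h2⟩ := hm hk hne
    have h3 := Nat.le_mul_of_pos_right k h1
    have h4 := Nat.le_mul_of_pos_left G.numArcs (Nat.pos_of_ne_zero hk)
    have h5 : n * (k + 1) ≤ 2 * G.numArcs * (2 * k) := Nat.mul_le_mul h2 (by omega)
    have h6 : G.numArcs * (k + 1) ≤ G.numArcs * (2 * k) := Nat.mul_le_mul_left _ (by omega)
    have e1 : 2 * G.numArcs * (2 * k) = 4 * (k * G.numArcs) := by ring
    have e2 : G.numArcs * (2 * k) = 2 * (k * G.numArcs) := by ring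
    have h7 : 1 ≤ k * G.numArcs := Nat.mul_pos (Nat.pos_of_ne_zero hk) h1
    omega
  obtain ⟨⟨out, hval, hout, hreach⟩, htime, -, hpeak⟩ :=
    traverse_meets (t := t) hB hG hW hW' le_rfl
  refine ⟨_, out, hval, htime.trans ?_, hpeak.trans ?_, hout.nodup, hout.mem,
    fun e he => ⟨(hout.out e he).dist, (hout.out e he).cell⟩, ?_⟩
  · subst hWdef
    -- For `k = 0` there is at most one tree and `W` is constant, so `m ≤ n ^ 2` leaves only the
    -- quadratic term. Without trees, only the preprocessing counts.
    rcases eq_or_ne k 0 with rfl | hk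
    · have h1 := numTrees_le_one_of_constant (t := t) hB hS hG
      have hn2 : n ≤ n ^ 2 := Nat.le_self_pow (by norm_num) n
      refine (Nat.add_le_add_left (Nat.mul_le_mul_right _ h1) _).trans ?_
      simp only [zero_mul, zero_add, mul_one, mul_zero, one_mul]
      omega
    · rcases eq_or_ne (G.numTrees t) 0 with h0 | h0
      · rw [h0]; omega
      · obtain ⟨h1, h2⟩ := hm hk h0
        have hk1 : 1 ≤ k := Nat.pos_of_ne_zero hk
        set m := G.numArcs
        have h3 : m ≤ k * m ^ 2 := by nlinarith
        have h4 : 1 ≤ k * m ^ 2 := h1.trans h3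
        have h5 : n * (k + 1) ≤ 2 * m * (2 * k) := Nat.mul_le_mul h2 (by omega)
        have h6 : k * m ≤ k * m ^ 2 := Nat.mul_le_mul_left _ (Nat.le_self_pow (by norm_num) m)
        have e1 : 2 * m * (2 * k) = 4 * (k * m) := by ring
        have e2 : m * (450 * (k * m) + 40 + 1) = 450 * (k * m ^ 2) + 41 * m := by ring
        have h7 : 20 * (n * (k + 1)) + 3 * (n + m) + m * (450 * (k * m) + 40 + 1) + 30 ≤
            1000 * (k * m ^ 2) := by omega
        have h8 := Nat.mul_le_mul_left (G.numTrees t) h7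
        have e3 : G.numTrees t * (1000 * (k * m ^ 2)) = 1000 * (k * m ^ 2 * G.numTrees t) := by
          ring
        omega
  · have h1 : (n * (k + 1) + G.numArcs * (k + 1)) * (G.numTrees t + 1) ≤
        (2 * (max k 1 * (n + G.numArcs))) * (2 * max (G.numTrees t) 1) := by
      refine Nat.mul_le_mul ?_ (by omega)
      rw [← Nat.add_mul, mul_comm, ← mul_assoc]
      exact Nat.mul_le_mul_right _ (by omega)
    refine (Nat.mul_le_mul_left 1000 h1).trans (le_of_eq ?_)
    ring
  · intro R hR
    -- A region forces finite entries in column `t`, so `t` is reachable from all nodes and a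
    -- spanning tree exists.
    obtain ⟨T, hT, hi, hc⟩ := hG.exists_cell_of_isRegion hB
      (hreach (reflTransGen_of_isRegion hR)) hR
    obtain ⟨e, he, rfl⟩ := List.mem_map.1 ((hout.mem T).2 ⟨hT, ⟨T, hT⟩, hi, .rfl⟩)
    refine ⟨e, ⟨he, hc⟩, ?_⟩
    rintro e' ⟨he', hc'⟩
    obtain ⟨hT', -⟩ := (hout.mem e'.tree).1 (List.mem_map_of_mem he')
    have := hG.eq_of_cell_eq hT.1 hT'.1 (hc.trans hc'.symm) hi
    exact List.inj_on_of_nodup_map hout.nodup he' he this.symm
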